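/- **Setting.** Let $R,R_f,R_q,L,M_g,L_r,L_s,M_s,U_s,\omega_s,U_f,T_1,\dots,T_4$ and $J_1,\dots,J_6$ be real numbers, let $\Delta=\tfrac32M_g^2-L_r(L_s+M_s+L)$, and assume that $R,R_f,R_q,L_r,L_s+M_s+L,\Delta,J_1,\dots,J_6$ are all nonzero. Let $K$ (stiffness) be a real symmetric $6\times6$ matrix and $D$ (friction) a real $6\times 6$ matrix. Put $J=\mathrm{diag}(J_1,\dots,J_6)$, $T=(T_1,T_2,T_3,T_4,0,0)^\top$, $\widetilde K_R=\mathrm{diag}(R^{-1},R^{-1},R_f^{-1},R_q^{-1})$, $\widetilde K_L=-\Delta^{-1}\mathrm{diag}(L_r,L_r,L_s+M_s+L,L_s+M_s+L)$, $\widetilde I_s(t)=\big(\tfrac{U_s}{R}\cos\omega_st,\tfrac{U_s}{R}\sin\omega_st,\tfrac{U_f}{R_f},0\big)^\top$ and $$\widetilde\Gamma(\theta)=\frac{\sqrt{3/2}\,M_g}{\Delta}\begin{pmatrix}0&0&\cos\theta_5&-\sin\theta_5\\0&0&\sin\theta_5&\cos\theta_5\\\cos\theta_5&\sin\theta_5&0&0\\-\sin\theta_5&\cos\theta_5&0&0\end{pmatrix}.$$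 The generator system, with unknown $x=(\dot{\widetilde\Psi};\widetilde\Psi;\dot\theta;\theta;t)\in\mathbb R^{4+4+6+6+1}$, is the port-Hamiltonian descriptor system $$M\dot x=(P-Q)z(x)+Nu(x),\qquad(1)$$ with $M=\mathrm{diag}(0,\widetilde K_L,J,E,1)$, $Q=\mathrm{diag}(\widetilde K_R,0,D,0,0)$, $N=\mathrm{diag}(I_4,0,I_6,0,1)$, $u(x)=(\widetilde I_s(t);0;T;0;1)$, $$P=\begin{pmatrix}0&-\widetilde K_L&0&0&0\\\widetilde K_L&0&0&0&0\\0&0&0&-E&0\\0&0&E&0&0\\0&0&0&0&0\end{pmatrix},\qquad z(x)=\begin{pmatrix}\dot{\widetilde\Psi}\\\widetilde K_L^{-1}(\widetilde K_L+\widetilde\Gamma(\theta))\widetilde\Psi\\\dot\theta\\E^{-1}\big(K\theta+\tfrac12(\widetilde\Psi^\top\partial_{\theta_5}\widetilde\Gamma(\theta)\widetilde\Psi)\,e_5\big)\\0\end{pmatrix},$$ where $e_5$ is the fifth unit vector of $\mathbb R^6$ and $E$ is an invertible symmetric real $6\times6$ matrix. One may take $E=K$ if $K$ is invertible; for the stiffness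 matrix of a free shaft (a chain of six masses joined by springs), which has zero row sums and hence is singular, one may take $E=I_6$. Let $s\ge1$, let $\gamma_1,\dots,\gamma_s$ be the zeros of $\frac{d^s}{dx^s}\big(x^s(x-1)^s\big)$, let $\ell_1,\dots,\ell_s$ be the Lagrange polynomials for these nodes, and let $a_{ij}=\int_0^{\gamma_i}\ell_j$, $b_j=\int_0^1\ell_j$. A step of size $h$ of the $s$-stage Gauss method for (1) goes from $x_n$ to $x_{n+1}=x_n+h\sum_jb_jk_j$, where $k_1,\dots,k_s\in\mathbb R^{21}$ satisfy $$Mk_i=(P-Q)z\Big(x_n+h\sum_ja_{ij}k_j\Big)+Nu\Big(x_n+h\sum_ja_{ij}k_j\Big),\qquad i=1,\dots,s.$$ **Theorem 1.** Let $T_m>0$, let $x_0$ be consistent initial values (time component $0$ and $\widetilde K_R\dot{\widetilde\Psi}_0+(\widetilde K_L+\widetilde\Gamma(\theta_0))\widetilde\Psi_0=\widetilde I_s(0)$), and let $x(t)$ be a solution of (1) on $[0,T_m]$ with $x(0)=x_0$. Then there are $h_0>0$ and $C$ such that for all $0<h\le h_0$ and all $n\ge 0$ with $t_n=nh\le T_m$,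 $n$ steps of the $s$-stage Gauss method can be carried out from $x_0$, and every result $x_n=(\dot{\widetilde\Psi}_n;\widetilde\Psi_n;\dot\theta_n;\theta_n;t_n)$ satisfies $$\|\widetilde\Psi_n-\widetilde\Psi(t_n)\|,\ \|\dot\theta_n-\dot\theta(t_n)\|,\ \|\theta_n-\theta(t_n)\|\le Ch^{2s},\qquad \|\dot{\widetilde\Psi}_n-\dot{\widetilde\Psi}(t_n)\|\le\begin{cases}Ch^{s},&s\text{ even},\\Ch^{s+1},&s\text{ odd}.\end{cases}$$ -/

import Mathlib

open scoped Matrix Polynomial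

noncomputable section

namespace Generator

/-- Data of the generator system. -/
structure Params where
  /-- line resistance, and resistances of the excitation and the damper winding -/
  (R Rf Rq : ℝ)
  /-- line inductance -/
  L : ℝ
  /-- inductance parameters of the generator -/
  (Mg Lr Ls Ms : ℝ)
  /-- amplitude and angular frequency of the AC source, excitation voltage -/
  (Us ωs Uf : ℝ)
  /-- moments of inertia of the six mass blocks -/
  inertia : Fin 6 → ℝ
  /-- stiffness matrix of the shaft -/
  K : Matrix (Fin 6) (Fin 6) ℝ
  /-- friction matrix of the shaft -/
  D : Matrix (Fin 6) (Fin 6) ℝ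
  /-- mechanical torques acting on the first four mass blocks -/
  torque : Fin 4 → ℝ

namespace Params

variable (p : Params)

/-- The denominator `3/2 M² - L_r (L_s + M_s + L)`. -/
def Δ : ℝ := 3 / 2 * p.Mg ^ 2 - p.Lr * (p.Ls + p.Ms + p.L)

/-- The quantities the model divides by do not vanish, and the stiffness matrix is symmetric. -/
structure Admissible : Prop where
  R_ne : p.R ≠ 0
  Rf_ne : p.Rf ≠ 0
  Rq_ne : p.Rq ≠ 0
  Lr_ne : p.Lr ≠ 0
  sum_ne : p.Ls + p.Ms + p.L ≠ 0
  Δ_ne : p.Δ ≠ 0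
  inertia_ne : ∀ i, p.inertia i ≠ 0
  K_symm : p.K.IsSymm

/-- Inertia matrix `J`. -/
def J : Matrix (Fin 6) (Fin 6) ℝ := Matrix.diagonal p.inertia

/-- Torque vector `T`. -/
def T : Fin 6 → ℝ := ![p.torque 0, p.torque 1, p.torque 2, p.torque 3, 0, 0]

/-- Resistance matrix `K̃_R`; flux linkages are ordered `(Ψ_{1α}, Ψ_{1β}, Ψ_f, Ψ_q)`. -/
def KR : Matrix (Fin 4) (Fin 4) ℝ := Matrix.diagonal ![p.R⁻¹, p.R⁻¹, p.Rf⁻¹, p.Rq⁻¹]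

/-- Inductance matrix `K̃_L`. -/
def KL : Matrix (Fin 4) (Fin 4) ℝ :=
  p.Δ⁻¹ • Matrix.diagonal
    ![-p.Lr, -p.Lr, -(p.Ls + p.Ms + p.L), -(p.Ls + p.Ms + p.L)]

/-- Magnetic coupling matrix `Γ̃`, as a function of the rotor angle `φ = θ₅`, the only
component of `θ` it depends on. -/
def Γ (φ : ℝ) : Matrix (Fin 4) (Fin 4) ℝ :=
  (√(3 / 2) * p.Mg / p.Δ) •
    !![0, 0, Real.cos φ, -Real.sin φ;
       0, 0, Real.sin φ, Real.cos φ;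
       Real.cos φ, Real.sin φ, 0, 0;
       -Real.sin φ, Real.cos φ, 0, 0]

/-- The entrywise derivative `∂Γ̃/∂θ₅`. -/
def dΓ (φ : ℝ) : Matrix (Fin 4) (Fin 4) ℝ :=
  Matrix.of fun i j => deriv (fun ψ => p.Γ ψ i j) φ

/-- Injected currents `Ĩ_s(t)`. -/
def Is (t : ℝ) : Fin 4 → ℝ :=
  ![p.Us / p.R * Real.cos (p.ωs * t), p.Us / p.R * Real.sin (p.ωs * t), p.Uf / p.Rf, 0]

/-- The vector `Ψ̃ᵀ (∂Γ̃(θ)/∂θ) Ψ̃`, whose only nonzero component is the fifth. -/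
def torqueForm (Ψ : Fin 4 → ℝ) (θ : Fin 6 → ℝ) : Fin 6 → ℝ :=
  ![0, 0, 0, 0, Ψ ⬝ᵥ (p.dΓ (θ 4) *ᵥ Ψ), 0]

end Params

/-- Indices of the 21 components of the state `x = (dΨ̃/dt; Ψ̃; dθ/dt; θ; t)`. -/
abbrev Idx : Type := (Fin 4 ⊕ Fin 4) ⊕ ((Fin 6 ⊕ Fin 6) ⊕ Unit)

abbrev State : Type := Idx → ℝ

/-- Column vector with the given five blocks. -/
def col (a b : Fin 4 → ℝ) (c d : Fin 6 → ℝ) (e : ℝ) : State :=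
  Sum.elim (Sum.elim a b) (Sum.elim (Sum.elim c d) fun _ => e)

namespace State

variable (x : State)

/-- Block `dΨ̃/dt` of the state. -/
def dPsi : Fin 4 → ℝ := fun i => x (.inl (.inl i))

/-- Block `Ψ̃` of the state. -/
def Psi : Fin 4 → ℝ := fun i => x (.inl (.inr i))

/-- Block `dθ/dt` of the state. -/
def dTheta : Fin 6 → ℝ := fun i => x (.inr (.inl (.inl i)))

/-- Block `θ` of the state. -/
def Theta : Fin 6 → ℝ := fun i => x (.inr (.inl (.inr i)))

/-- Time component of the state. -/
def time : ℝ := x (.inr (.inr ()))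

end State

/-! The port-Hamiltonian descriptor form. The equation `dθ/dt = ω` enters it multiplied by an
invertible symmetric matrix `E`. If the stiffness matrix `K` is invertible one may take `E = K`;
the stiffness matrix of a free shaft (a chain of springs) has zero row sums, so is singular,
and there one takes for instance `E = 1`. -/

section Descriptor

variable (p : Params) (E : Matrix (Fin 6) (Fin 6) ℝ)

/-- `M = diag(0, K̃_L, J, E, 1)`. -/
def mM : Matrix Idx Idx ℝ :=
  .fromBlocks (.fromBlocks 0 0 0 p.KL) 0 0
    (.fromBlocks (.fromBlocks p.J 0 0 E) 0 0 1)

def mP : Matrix Idx Idx ℝ :=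
  .fromBlocks (.fromBlocks 0 (-p.KL) p.KL 0) 0 0
    (.fromBlocks (.fromBlocks 0 (-E) E 0) 0 0 0)

/-- `Q = diag(K̃_R, 0, D, 0, 0)`. -/
def mQ : Matrix Idx Idx ℝ :=
  .fromBlocks (.fromBlocks p.KR 0 0 0) 0 0
    (.fromBlocks (.fromBlocks p.D 0 0 0) 0 0 0)

/-- `N = diag(I₄, 0, I₆, 0, 1)`. -/
def mN : Matrix Idx Idx ℝ :=
  .fromBlocks (.fromBlocks 1 0 0 0) 0 0
    (.fromBlocks (.fromBlocks 1 0 0 0) 0 0 1)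

def mV : Matrix Idx Idx ℝ := 0

/-- The effort `z(x)`. -/
def z (x : State) : State :=
  col x.dPsi
    (p.KL⁻¹ *ᵥ ((p.KL + p.Γ (x.Theta 4)) *ᵥ x.Psi))
    x.dTheta
    (E⁻¹ *ᵥ (p.K *ᵥ x.Theta + (1 / 2 : ℝ) • p.torqueForm x.Psi x.Theta))
    0

/-- The input `u(x)`. -/
def u (x : State) : State := col (p.Is x.time) 0 p.T 0 1

/-- Right-hand side `(P - Q) z(x) + (N - V) u(x)`. -/
def rhs (x : State) : State :=
  (mP p E - mQ p) *ᵥ z p E x + (mN - mV) *ᵥ u p x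

/-- `X` solves `M ẋ = (P - Q) z(x) + (N - V) u(x)` on `[0, Tm]`. -/
def IsSolution (Tm : ℝ) (X : ℝ → State) : Prop :=
  ∀ t ∈ Set.Icc 0 Tm, ∃ v : State,
    HasDerivWithinAt X v (Set.Icc 0 Tm) t ∧ mM p E *ᵥ v = rhs p E (X t)

/-- Consistent initial values at time `0`: the algebraic equation
`K̃_R dΨ̃/dt + (K̃_L + Γ̃(θ)) Ψ̃ = Ĩ_s(t)` holds. -/
def IsConsistent (x : State) : Prop :=
  x.time = 0 ∧
    p.KR *ᵥ x.dPsi + (p.KL + p.Γ (x.Theta 4)) *ᵥ x.Psi = p.Is x.time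

end Descriptor

section Collocation

variable {s : ℕ} (γ : Fin s → ℝ)

/-- `γ` lists the `s` distinct zeros of the shifted Legendre polynomial
`dˢ/dxˢ (xˢ (x - 1)ˢ)`, which has degree `s`. -/
def IsGaussNodes : Prop :=
  Function.Injective γ ∧
    ∀ i, (Polynomial.derivative^[s] ((Polynomial.X : ℝ[X]) ^ s * (Polynomial.X - 1) ^ s)).eval
      (γ i) = 0

/-- `a_{ij} = ∫₀^{γ_i} ℓ_j`. -/
def collA (i j : Fin s) : ℝ :=
  ∫ τ in (0 : ℝ)..(γ i), (Lagrange.basis Finset.univ γ j).eval τ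

/-- `b_i = ∫₀¹ ℓ_i`. -/
def collB (i : Fin s) : ℝ :=
  ∫ τ in (0 : ℝ)..1, (Lagrange.basis Finset.univ γ i).eval τ

/-- One step of size `h` of the collocation method, from `x` to `x'`. -/
def IsStep (p : Params) (E : Matrix (Fin 6) (Fin 6) ℝ) (h : ℝ) (x x' : State) : Prop :=
  ∃ k : Fin s → State,
    (∀ i, mM p E *ᵥ k i = rhs p E (x + h • ∑ j, collA γ i j • k j)) ∧
      x' = x + h • ∑ j, collB γ j • k j

/-- `xs 0, …, xs n` is produced from `x0` by `n` steps of size `h` of the method. -/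
def IsNumericalSolution (p : Params) (E : Matrix (Fin 6) (Fin 6) ℝ) (h : ℝ) (x0 : State)
    (n : ℕ) (xs : ℕ → State) : Prop :=
  xs 0 = x0 ∧ ∀ m < n, IsStep γ p E h (xs m) (xs (m + 1))

end Collocation

end Generator

end

/-! The resistance, inductance and inertia matrices and `E` are invertible, so the system has index
one: its first block determines dΨ/dt from v = (Ψ, dθ/dt, θ, t), and v solves a smooth equation v' =
f(v) with dΨ/dt = f(v).1 (`mM_mulVec_eq_rhs_iff`). A Gauss step splits in the same way
(`IsStep.exists_stages`): v undergoes a Gauss step for f with stages Y_i, while the algebraic part z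
= dΨ/dt is extrapolated, z' = (-1)^s z + ∑ w_i f(Y_i).1. The factor (-1)^s reflects the parity of
the shifted Legendre polynomial.

Order 2s for v (`exists_local_error_le`): let e be the collocation polynomial minus the solution,
and let W approximately solve the adjoint variational equation W' = -hWA, W(1) = 1, with A the
derivative of f along the solution. Then (We)' = hg, where g has Taylor expansions up to order 2s,
uniformly in the step. Gauss quadrature is exact below degree 2s, so it computes the increment of We
up to O(h^(2s+1)). At the nodes the collocation conditions leave in g only a quadratic Taylor
remainder and the error of W. This bounds the local error, and a discrete Gronwall argument gives
the global one.

For z the error obeys ζ_{m+1} = (-1)^s ζ_m + d_m with d_m = O(h^(s+1))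
(`exists_norm_extrapolationError_le`). For even s these contributions add up over O(1/h) steps to
O(h^s). For odd s consecutive ones nearly cancel, because d_{m+1} - d_m = O(h^(s+2))
(`exists_norm_extrapolationError_sub_le`), so O(h^(s+1)) survives.

The estimates must hold for every solution of the stage equations, not only for the one near the
exact solution. Spurious stages are confined by an a priori bound (`exists_norm_stage_field_le`),
which uses that f(v).1 grows only linearly in Ψ and that the quadratic torque depends on Ψ alone up
to bounded factors. -/

open scoped Matrix Polynomial

noncomputable section

namespace Generator

open Polynomial

/-! ### Primitives of polynomials and integration by parts -/

section Primitive

/-- The primitive of a real polynomial that vanishes at `0`. -/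
def primitive (p : ℝ[X]) : ℝ[X] := p.sum fun k a => monomial (k + 1) (a / (k + 1))

lemma derivative_primitive (p : ℝ[X]) : derivative (primitive p) = p := by
  conv_rhs => rw [← p.sum_monomial_eq]
  rw [primitive, Polynomial.sum, Polynomial.sum, derivative_sum]
  refine Finset.sum_congr rfl fun k _ => ?_
  rw [derivative_monomial]
  congr 1
  push_cast
  have : (k : ℝ) + 1 ≠ 0 := by positivity
  field_simp

lemma eval_zero_primitive (p : ℝ[X]) : (primitive p).eval 0 = 0 := by
  rw [primitive, Polynomial.sum, eval_finsetSum]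
  refine Finset.sum_eq_zero fun k _ => ?_
  simp

lemma natDegree_primitive_le (p : ℝ[X]) : (primitive p).natDegree ≤ p.natDegree + 1 := by
  rw [primitive, Polynomial.sum]
  refine natDegree_sum_le_of_forall_le _ _ fun k hk => ?_
  exact (natDegree_monomial_le _).trans (by have := le_natDegree_of_mem_supp k hk; omega)

lemma integral_eval_derivative (p : ℝ[X]) (a b : ℝ) :
    ∫ τ in a..b, (derivative p).eval τ = p.eval b - p.eval a :=
  intervalIntegral.integral_eq_sub_of_hasDerivAt (fun x _ => p.hasDerivAt x)
    ((derivative p).continuous.intervalIntegrable a b)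

lemma integral_eval (p : ℝ[X]) (x : ℝ) :
    ∫ τ in (0 : ℝ)..x, p.eval τ = (primitive p).eval x := by
  conv_lhs => rw [← derivative_primitive p]
  rw [integral_eval_derivative, eval_zero_primitive, sub_zero]

lemma integral_eval_mul_derivative (p q : ℝ[X]) :
    ∫ τ in (0 : ℝ)..1, p.eval τ * (derivative q).eval τ =
      p.eval 1 * q.eval 1 - p.eval 0 * q.eval 0 -
        ∫ τ in (0 : ℝ)..1, (derivative p).eval τ * q.eval τ :=
  intervalIntegral.integral_mul_deriv_eq_deriv_mul (fun x _ => p.hasDerivAt x)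
    (fun x _ => q.hasDerivAt x) ((derivative p).continuous.intervalIntegrable 0 1)
    ((derivative q).continuous.intervalIntegrable 0 1)

end Primitive

/-! ### Shifted Legendre polynomials: end values and orthogonality -/

section Legendre

/-- The polynomial `dˢ/dxˢ (xˢ (x - 1)ˢ)`. -/
def rodrigues (s : ℕ) : ℝ[X] := derivative^[s] ((X : ℝ[X]) ^ s * (X - 1) ^ s)

lemma eval_iterate_derivative_pow_mul (t : ℝ) (n : ℕ) (q : ℝ[X]) :
    (derivative^[n] ((X - C t) ^ n * q)).eval t = n.factorial * q.eval t := by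
  rw [iterate_derivative_mul, eval_finsetSum,
    Finset.sum_eq_single_of_mem 0 (Finset.mem_range.mpr n.succ_pos)]
  · simp [iterate_derivative_X_sub_pow_self]
  · intro i hi h0
    rw [iterate_derivative_X_sub_pow]
    have : n - (n - i) ≠ 0 := by
      have := Finset.mem_range.mp hi
      omega
    simp [this]

lemma eval_zero_rodrigues (s : ℕ) : (rodrigues s).eval 0 = (-1) ^ s * s.factorial := by
  have := eval_iterate_derivative_pow_mul 0 s ((X - 1) ^ s)
  simp only [C_0, sub_zero] at this
  rw [rodrigues, this]
  simp [mul_comm]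

lemma eval_one_rodrigues (s : ℕ) : (rodrigues s).eval 1 = s.factorial := by
  have := eval_iterate_derivative_pow_mul 1 s (X ^ s)
  simp only [C_1] at this
  rw [rodrigues, mul_comm, this]
  simp

lemma natDegree_rodrigues_le (s : ℕ) : (rodrigues s).natDegree ≤ s := by
  refine (natDegree_iterate_derivative _ _).trans ?_
  have h : ((X : ℝ[X]) ^ s * (X - 1) ^ s).natDegree ≤ s + s := by
    refine natDegree_mul_le.trans (add_le_add (by simp) ?_)
    refine natDegree_pow_le.trans ?_
    have : ((X : ℝ[X]) - 1).natDegree ≤ 1 := by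
      simpa using (natDegree_X_sub_C (1 : ℝ)).le
    calc s * ((X : ℝ[X]) - 1).natDegree ≤ s * 1 := Nat.mul_le_mul_left _ this
      _ = s := mul_one s
  omega

/-- Repeated integration by parts: derivatives of x^s (x-1)^s of order below s vanish at both end
points, and each integration lowers the degree of `p` until its derivative is zero. -/
lemma integral_mul_iterate_derivative (s k : ℕ) (hk : k ≤ s) (p : ℝ[X]) (hp : p.natDegree < k) :
    ∫ τ in (0 : ℝ)..1, p.eval τ *
      (derivative^[k] ((X : ℝ[X]) ^ s * (X - 1) ^ s)).eval τ = 0 := by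
  induction k generalizing p with
  | zero => omega
  | succ k ih =>
    rw [Function.iterate_succ_apply', integral_eval_mul_derivative]
    have h0 : (derivative^[k] ((X : ℝ[X]) ^ s * (X - 1) ^ s)).eval 0 = 0 := by
      have := pow_sub_dvd_iterate_derivative_of_pow_dvd k
        (Dvd.intro ((X - 1 : ℝ[X]) ^ s) rfl : (X : ℝ[X]) ^ s ∣ X ^ s * (X - 1) ^ s)
      refine eval_eq_zero_of_dvd_of_eval_eq_zero this ?_
      have : s - k ≠ 0 := by omega
      simp [this]
    have h1 : (derivative^[k] ((X : ℝ[X]) ^ s * (X - 1) ^ s)).eval 1 = 0 := by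
      have := pow_sub_dvd_iterate_derivative_of_pow_dvd k
        (Dvd.intro_left ((X : ℝ[X]) ^ s) rfl : (X - 1 : ℝ[X]) ^ s ∣ X ^ s * (X - 1) ^ s)
      refine eval_eq_zero_of_dvd_of_eval_eq_zero this ?_
      have : s - k ≠ 0 := by omega
      simp [this]
    rw [h0, h1]
    rcases Nat.eq_zero_or_pos p.natDegree with hd | hd
    · rw [eq_C_of_natDegree_eq_zero hd]; simp
    · rw [ih (by omega) (derivative p) ((natDegree_derivative_lt hd.ne').trans_le (by omega))]
      simp

lemma integral_mul_rodrigues {s : ℕ} (p : ℝ[X]) (hp : p.natDegree < s) :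
    ∫ τ in (0 : ℝ)..1, p.eval τ * (rodrigues s).eval τ = 0 :=
  integral_mul_iterate_derivative s s le_rfl p hp

end Legendre

/-! ### Gauss nodes: quadrature, the Runge–Kutta matrix and extrapolation -/

section Nodes

variable {s : ℕ} {γ : Fin s → ℝ}

lemma IsGaussNodes.exists_rodrigues_eq (hγ : IsGaussNodes γ) :
    ∃ c : ℝ, c ≠ 0 ∧ rodrigues s = C c * Lagrange.nodal Finset.univ γ := by
  have hne : rodrigues s ≠ 0 := by
    intro h
    have := eval_one_rodrigues s
    rw [h, eval_zero] at this
    exact Nat.factorial_ne_zero s (by exact_mod_cast this.symm)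
  have hdvd : Lagrange.nodal Finset.univ γ ∣ rodrigues s := by
    rw [Lagrange.nodal_eq]
    refine Finset.prod_dvd_of_coprime ?_ fun i _ => dvd_iff_isRoot.mpr (hγ.2 i)
    intro i _ j _ hij
    exact isCoprime_X_sub_C_of_isUnit_sub (sub_ne_zero.mpr (hγ.1.ne hij)).isUnit
  obtain ⟨r, hr⟩ := hdvd
  have hr0 : r ≠ 0 := fun h => hne (by rw [hr, h, mul_zero])
  have hdeg : r.natDegree = 0 := by
    have h1 := natDegree_rodrigues_le s
    rw [hr, natDegree_mul Lagrange.nodal_ne_zero hr0, Lagrange.natDegree_nodal] at h1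
    simp only [Finset.card_univ, Fintype.card_fin] at h1
    omega
  have hrC := eq_C_of_natDegree_eq_zero hdeg
  refine ⟨r.coeff 0, fun h => hr0 (by rw [hrC, h, C_0]), ?_⟩
  rw [← hrC, hr, mul_comm]

lemma IsGaussNodes.integral_mul_nodal (hγ : IsGaussNodes γ) (p : ℝ[X]) (hp : p.natDegree < s) :
    ∫ τ in (0 : ℝ)..1, p.eval τ * (Lagrange.nodal Finset.univ γ).eval τ = 0 := by
  obtain ⟨c, hc, h⟩ := hγ.exists_rodrigues_eq
  have h1 := integral_mul_rodrigues p hp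
  rw [h] at h1
  simp only [eval_mul, eval_C, mul_left_comm _ c, intervalIntegral.integral_const_mul] at h1
  exact (mul_eq_zero.mp h1).resolve_left hc

/-- This parity is the source of the factor (-1)^s in the recursion for the algebraic variables, and
hence of the distinction between even and odd s. -/
lemma IsGaussNodes.eval_one_nodal (hγ : IsGaussNodes γ) :
    (Lagrange.nodal Finset.univ γ).eval 1 = (-1) ^ s * (Lagrange.nodal Finset.univ γ).eval 0 := by
  obtain ⟨c, hc, h⟩ := hγ.exists_rodrigues_eq
  have h0 := eval_zero_rodrigues s
  have h1 := eval_one_rodrigues s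
  rw [h, eval_mul, eval_C] at h0 h1
  refine mul_left_cancel₀ hc ?_
  rw [mul_left_comm, h0, h1, ← mul_assoc, ← mul_pow]
  simp

lemma IsGaussNodes.ne_zero (hγ : IsGaussNodes γ) (i : Fin s) : γ i ≠ 0 := by
  intro h
  have h1 : (rodrigues s).eval (γ i) = 0 := hγ.2 i
  rw [h, eval_zero_rodrigues] at h1
  have := Nat.factorial_ne_zero s
  simp_all

/-- The nodal polynomial is orthogonal to its cofactor q of (x - γ_i). If γ_i lay outside (0, 1),
the integrand (x - γ_i) q² would have constant sign and a nonzero integral. -/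
lemma IsGaussNodes.mem_Ioo (hγ : IsGaussNodes γ) (i : Fin s) : γ i ∈ Set.Ioo (0 : ℝ) 1 := by
  set q := Lagrange.nodal (Finset.univ.erase i) γ with hq
  have hfac : Lagrange.nodal Finset.univ γ = (X - C (γ i)) * q :=
    Lagrange.nodal_eq_mul_nodal_erase (Finset.mem_univ i)
  have hdeg : q.natDegree < s := by
    rw [hq, Lagrange.natDegree_nodal, Finset.card_erase_of_mem (Finset.mem_univ i)]
    have := i.pos
    simp only [Finset.card_univ, Fintype.card_fin]
    omega
  have hintegral := hγ.integral_mul_nodal q hdeg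
  have hfun : ∀ τ, q.eval τ * (Lagrange.nodal Finset.univ γ).eval τ =
      (τ - γ i) * q.eval τ ^ 2 := by
    intro τ
    rw [hfac]
    simp
    ring
  simp only [hfun] at hintegral
  have hfin : (q.roots.toFinset : Set ℝ).Finite := Finset.finite_toSet _
  have hcont : Continuous fun τ : ℝ => (τ - γ i) * q.eval τ ^ 2 := by
    have := q.continuous
    fun_prop
  obtain ⟨τ₀, hτ₀, hτr⟩ : ∃ τ ∈ Set.Ioo (0 : ℝ) 1, τ ∉ (q.roots.toFinset : Set ℝ) :=
    ((Set.Ioo_infinite one_pos).sdiff hfin).nonempty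
  have hqτ : q.eval τ₀ ≠ 0 := by
    intro h
    apply hτr
    simp only [Finset.mem_coe, Multiset.mem_toFinset]
    exact (mem_roots Lagrange.nodal_ne_zero).mpr h
  have hq2 : 0 < q.eval τ₀ ^ 2 := by positivity
  constructor
  · by_contra! hle
    have hpos := intervalIntegral.integral_pos (zero_lt_one) hcont.continuousOn
      (fun x hx => mul_nonneg (by linarith [hx.1]) (sq_nonneg (q.eval x)))
      ⟨τ₀, Set.Ioo_subset_Icc_self hτ₀, mul_pos (by linarith [hτ₀.1]) hq2⟩
    linarith
  · by_contra! hle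
    have hcont' : Continuous fun τ : ℝ => (γ i - τ) * q.eval τ ^ 2 := by
      have := q.continuous
      fun_prop
    have hpos := intervalIntegral.integral_pos (zero_lt_one) hcont'.continuousOn
      (fun x hx => mul_nonneg (sub_nonneg.mpr (hx.2.trans hle)) (sq_nonneg (q.eval x)))
      ⟨τ₀, Set.Ioo_subset_Icc_self hτ₀, mul_pos (sub_pos.mpr (hτ₀.2.trans_le hle)) hq2⟩
    have hneg : ∀ τ, (γ i - τ) * q.eval τ ^ 2 = -((τ - γ i) * q.eval τ ^ 2) := fun τ => by ring
    simp only [hneg, intervalIntegral.integral_neg] at hpos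
    linarith

/-- The primitives of the Lagrange basis polynomials for the nodes `γ`. -/
def collPoly (γ : Fin s → ℝ) (j : Fin s) : ℝ[X] := primitive (Lagrange.basis Finset.univ γ j)

lemma collA_eq (γ : Fin s → ℝ) (i j : Fin s) : collA γ i j = (collPoly γ j).eval (γ i) :=
  integral_eval _ _

lemma collB_eq (γ : Fin s → ℝ) (j : Fin s) : collB γ j = (collPoly γ j).eval 1 :=
  integral_eval _ _

lemma natDegree_collPoly_le (hγ : Function.Injective γ) (j : Fin s) :
    (collPoly γ j).natDegree ≤ s := by
  refine (natDegree_primitive_le _).trans ?_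
  rw [Lagrange.natDegree_basis hγ.injOn (Finset.mem_univ j)]
  have := j.pos
  simp only [Finset.card_univ, Fintype.card_fin]
  omega

lemma derivative_collPoly (γ : Fin s → ℝ) (j : Fin s) :
    derivative (collPoly γ j) = Lagrange.basis Finset.univ γ j := derivative_primitive _

lemma eval_basis_node (hγ : Function.Injective γ) (i j : Fin s) :
    (Lagrange.basis Finset.univ γ j).eval (γ i) = if i = j then 1 else 0 := by
  split_ifs with h
  · rw [h, Lagrange.eval_basis_self hγ.injOn (Finset.mem_univ j)]
  · exact Lagrange.eval_basis_of_ne (Ne.symm h) (Finset.mem_univ i)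

/-- A polynomial of degree `≤ s` is determined by its value at `0` and its derivatives at the
nodes. -/
lemma eq_sum_collPoly (hγ : Function.Injective γ) (p : ℝ[X]) (hp : p.natDegree ≤ s) :
    p = C (p.eval 0) + ∑ j, C ((derivative p).eval (γ j)) * collPoly γ j := by
  have hd : derivative p = ∑ j, C ((derivative p).eval (γ j)) * Lagrange.basis Finset.univ γ j := by
    by_cases h0 : derivative p = 0
    · simp [h0]
    have hlt : (derivative p).degree < (Finset.univ : Finset (Fin s)).card := by
      rw [degree_eq_natDegree h0]
      have hpd : p.natDegree ≠ 0 := fun h => h0 (derivative_of_natDegree_zero h)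
      have := natDegree_derivative_lt hpd
      simp only [Finset.card_univ, Fintype.card_fin]
      exact_mod_cast this.trans_le hp
    conv_lhs => rw [Lagrange.eq_interpolate hγ.injOn hlt, Lagrange.interpolate_apply]
  set q := C (p.eval 0) + ∑ j, C ((derivative p).eval (γ j)) * collPoly γ j with hq
  have hder : derivative (p - q) = 0 := by
    rw [derivative_sub, sub_eq_zero, hq]
    simp only [derivative_add, derivative_C, zero_add, derivative_sum, derivative_C_mul,
      derivative_collPoly]
    exact hd
  have hc := derivative_eq_zero.mp hder
  have h0 : (p - q).eval 0 = 0 := by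
    simp [hq, eval_finsetSum, collPoly, eval_zero_primitive]
  rw [eq_C_of_natDegree_eq_zero hc, eval_C] at h0
  have : p - q = 0 := by rw [eq_C_of_natDegree_eq_zero hc, h0, C_0]
  exact sub_eq_zero.mp this

lemma sum_collPoly_mul_pow (hγ : Function.Injective γ) (k : ℕ) (hk : k < s) (τ : ℝ) :
    ∑ j, (collPoly γ j).eval τ * γ j ^ k = τ ^ (k + 1) / (k + 1) := by
  have h := congrArg (eval τ) (eq_sum_collPoly hγ (X ^ (k + 1)) (by simpa using hk))
  simp only [eval_pow, eval_X, derivative_X_pow, eval_add, eval_C, eval_finsetSum, eval_mul,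
    ne_eq, Nat.add_eq_zero_iff, one_ne_zero, and_false, not_false_eq_true, zero_pow, zero_add,
    Nat.add_sub_cancel] at h
  rw [h, Finset.sum_div]
  refine Finset.sum_congr rfl fun j _ => ?_
  have : (k : ℝ) + 1 ≠ 0 := by positivity
  push_cast
  field_simp

/-- The quadrature rule with the Gauss nodes is exact up to degree `2 s - 1`. -/
lemma IsGaussNodes.integral_eq (hγ : IsGaussNodes γ) (p : ℝ[X]) (hp : p.natDegree < 2 * s) :
    ∫ τ in (0 : ℝ)..1, p.eval τ = ∑ j, collB γ j * p.eval (γ j) := by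
  set w := Lagrange.nodal Finset.univ γ with hw
  have hmon : w.Monic := Lagrange.nodal_monic
  have hwdeg : w.natDegree = s := by
    rw [hw, Lagrange.natDegree_nodal, Finset.card_univ, Fintype.card_fin]
  -- The quotient has degree below s and is orthogonal to w; the remainder agrees with p at the
  -- nodes and, having degree below s, is integrated exactly by the interpolatory rule.
  have hdecomp := modByMonic_add_div p w
  have hs : 0 < s := by omega
  have hr : (p %ₘ w).natDegree < s := by
    conv_rhs => rw [← hwdeg]
    exact natDegree_modByMonic_lt p hmon (by
      intro h; rw [h, natDegree_one] at hwdeg; omega)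
  have hq : (p /ₘ w).natDegree < s := by
    rw [natDegree_divByMonic p hmon, hwdeg]
    omega
  have hnode : ∀ j, p.eval (γ j) = (p %ₘ w).eval (γ j) := by
    intro j
    conv_lhs => rw [← hdecomp]
    rw [eval_add, eval_mul, hw, Lagrange.eval_nodal_at_node (Finset.mem_univ j)]
    ring
  have hrep : p %ₘ w = ∑ j, C ((p %ₘ w).eval (γ j)) * Lagrange.basis Finset.univ γ j := by
    have := eq_sum_collPoly hγ.1 (primitive (p %ₘ w))
      ((natDegree_primitive_le _).trans (by omega))
    have := congrArg derivative this
    simpa [derivative_primitive, derivative_collPoly] using this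
  have hintegral : ∫ τ in (0 : ℝ)..1, p.eval τ = ∫ τ in (0 : ℝ)..1, (p %ₘ w).eval τ := by
    have h0 := hγ.integral_mul_nodal _ hq
    have : ∀ τ, p.eval τ = (p %ₘ w).eval τ + (p /ₘ w).eval τ * w.eval τ := by
      intro τ
      conv_lhs => rw [← hdecomp]
      simp [mul_comm]
    simp only [this]
    rw [intervalIntegral.integral_add, h0, add_zero]
    · exact (Polynomial.continuous _).intervalIntegrable _ _
    · exact ((Polynomial.continuous _).mul (Polynomial.continuous _)).intervalIntegrable _ _
  rw [hintegral]
  simp only [hnode]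
  conv_lhs => rw [hrep]
  simp only [eval_finsetSum, eval_mul, eval_C]
  rw [intervalIntegral.integral_finsetSum]
  · refine Finset.sum_congr rfl fun j _ => ?_
    rw [intervalIntegral.integral_const_mul, collB, mul_comm]
  · intro j _
    exact (continuous_const.mul (Polynomial.continuous _)).intervalIntegrable _ _

lemma IsGaussNodes.sum_collB_mul_pow (hγ : IsGaussNodes γ) (k : ℕ) (hk : k < 2 * s) :
    ∑ j, collB γ j * γ j ^ k = 1 / (k + 1) := by
  have h := hγ.integral_eq (X ^ k) (by simpa using hk)
  simp only [eval_pow, eval_X, integral_pow] at h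
  rw [← h]
  simp

/-- The Runge–Kutta matrix of a collocation method whose nodes are nonzero is invertible. -/
lemma isUnit_det_collA (hγ : Function.Injective γ) (h0 : ∀ i, γ i ≠ 0) :
    IsUnit (Matrix.of (collA γ)).det := by
  rw [isUnit_iff_ne_zero]
  intro hdet
  obtain ⟨k, hk0, hk⟩ := Matrix.exists_mulVec_eq_zero_iff.mpr hdet
  apply hk0
  -- A kernel vector yields a polynomial of degree at most s with the s + 1 zeros 0, γ_1, …, γ_s;
  -- its derivatives at the nodes recover the vector.
  set p : ℝ[X] := ∑ j, C (k j) * collPoly γ j with hp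
  have hdeg : p.natDegree ≤ s :=
    natDegree_sum_le_of_forall_le _ _ fun j _ =>
      (natDegree_C_mul_le _ _).trans (natDegree_collPoly_le hγ j)
  have hroot : ∀ i, p.eval (γ i) = 0 := by
    intro i
    have := congrFun hk i
    simp only [Matrix.mulVec, dotProduct, Matrix.of_apply, Pi.zero_apply] at this
    rw [hp, eval_finsetSum, ← this]
    refine Finset.sum_congr rfl fun j _ => ?_
    rw [eval_mul, eval_C, collA_eq, mul_comm]
  have hroot0 : p.eval 0 = 0 := by
    rw [hp, eval_finsetSum]
    simp [collPoly, eval_zero_primitive]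
  have hp0 : p = 0 := by
    refine Polynomial.eq_zero_of_natDegree_lt_card_of_eval_eq_zero' p
      (insert 0 (Finset.univ.image γ)) ?_ ?_
    · intro x hx
      rw [Finset.mem_insert, Finset.mem_image] at hx
      rcases hx with rfl | ⟨i, _, rfl⟩
      exacts [hroot0, hroot i]
    · rw [Finset.card_insert_of_notMem, Finset.card_image_of_injective _ hγ]
      · simpa using Nat.lt_succ_of_le hdeg
      · simpa using h0
  funext i
  have := congrArg (fun q => (derivative q).eval (γ i)) hp0
  simp only [hp, derivative_sum, derivative_C_mul, derivative_collPoly, eval_finsetSum, eval_mul,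
    eval_C, eval_basis_node hγ, derivative_zero, eval_zero] at this
  simpa using this

/-- Stage increments can be prescribed when the nodes are nonzero. -/
lemma exists_sum_collA_smul_eq {F : Type*} [AddCommGroup F] [Module ℝ F]
    (hγ : Function.Injective γ) (h0 : ∀ i, γ i ≠ 0) (Y : Fin s → F) :
    ∃ k : Fin s → F, ∀ i, ∑ j, collA γ i j • k j = Y i := by
  have hu := isUnit_det_collA hγ h0
  refine ⟨fun j => ∑ l, (Matrix.of (collA γ))⁻¹ j l • Y l, fun i => ?_⟩
  have hmul := Matrix.mul_nonsing_inv _ hu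
  calc ∑ j, collA γ i j • ∑ l, (Matrix.of (collA γ))⁻¹ j l • Y l
      = ∑ l, (∑ j, collA γ i j * (Matrix.of (collA γ))⁻¹ j l) • Y l := by
        simp only [Finset.smul_sum, Finset.sum_smul, smul_smul]
        exact Finset.sum_comm
    _ = ∑ l, (1 : Matrix (Fin s) (Fin s) ℝ) i l • Y l := by
        refine Finset.sum_congr rfl fun l _ => ?_
        rw [← hmul, Matrix.mul_apply]
        rfl
    _ = Y i := by simp [Matrix.one_apply]

/-- The weights of extrapolation to `1` from the values at `0` and at the Gauss nodes; the value
at `0` has weight `(-1)ˢ`. -/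
lemma IsGaussNodes.exists_extrapolation (hγ : IsGaussNodes γ) :
    ∃ w : Fin s → ℝ, ∀ p : ℝ[X], p.natDegree ≤ s →
      p.eval 1 = (-1) ^ s * p.eval 0 + ∑ i, w i * p.eval (γ i) := by
  set N := Lagrange.nodal Finset.univ γ with hN
  have hN0 : N.eval 0 ≠ 0 :=
    Lagrange.eval_nodal_not_at_node fun i _ => (hγ.ne_zero i).symm
  refine ⟨fun i => (Lagrange.basis Finset.univ γ i).eval 1 -
      (-1) ^ s * (Lagrange.basis Finset.univ γ i).eval 0, fun p hp => ?_⟩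
  have hNdeg : N.natDegree = s := by
    rw [hN, Lagrange.natDegree_nodal, Finset.card_univ, Fintype.card_fin]
  -- Interpolation at the nodes misses only a multiple of N. The values of N at 0 and 1 differ by
  -- the factor (-1)^s, so c is eliminated between the two evaluations.
  obtain ⟨c, hc⟩ : ∃ c : ℝ, p = C c * N +
      ∑ i, C (p.eval (γ i)) * Lagrange.basis Finset.univ γ i := by
    refine ⟨p.coeff s, ?_⟩
    have hmon : N.Monic := Lagrange.nodal_monic
    set q := p - C (p.coeff s) * N with hq
    have hqn : ∀ i, q.eval (γ i) = p.eval (γ i) := by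
      intro i
      simp [hq, hN, Lagrange.eval_nodal_at_node]
    have hcs : q.coeff s = 0 := by
      have : N.coeff s = 1 := by
        have h1 := hmon.coeff_natDegree
        rwa [hNdeg] at h1
      simp [hq, this]
    have hqle : q.natDegree ≤ s :=
      (natDegree_sub_le _ _).trans
        (max_le hp ((natDegree_C_mul_le _ _).trans hNdeg.le))
    have hlt : q.degree < (Finset.univ : Finset (Fin s)).card := by
      rw [Finset.card_univ, Fintype.card_fin, degree_lt_iff_coeff_zero]
      intro m hm
      rcases hm.eq_or_lt with rfl | hm
      · exact hcs
      · exact coeff_eq_zero_of_natDegree_lt (hqle.trans_lt hm)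
    have hrep := Lagrange.eq_interpolate hγ.1.injOn hlt
    rw [Lagrange.interpolate_apply] at hrep
    simp only [hqn] at hrep
    rw [← hrep, hq]
    ring
  have h1 := congrArg (eval 1) hc
  have h0 := congrArg (eval 0) hc
  simp only [eval_add, eval_mul, eval_C, eval_finsetSum] at h1 h0
  rw [h1, h0, hN, hγ.eval_one_nodal]
  simp only [sub_mul, Finset.sum_sub_distrib, mul_add, Finset.mul_sum]
  have : ∀ i, p.eval (γ i) * (Lagrange.basis Finset.univ γ i).eval 1 =
    (Lagrange.basis Finset.univ γ i).eval 1 * p.eval (γ i) := fun i => mul_comm _ _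
  simp only [this]
  have h2 : ∀ i, (-1 : ℝ) ^ s * (p.eval (γ i) * (Lagrange.basis Finset.univ γ i).eval 0) =
    (-1) ^ s * (Lagrange.basis Finset.univ γ i).eval 0 * p.eval (γ i) := fun i => by ring
  simp only [h2]
  ring

end Nodes

end Generator

namespace Generator

open Set
open scoped ContDiff

/-! ### Uniform Taylor expansions in h τ -/

section UnifApprox

variable {ι E F G : Type*} [NormedAddCommGroup E] [NormedSpace ℝ E]
  [NormedAddCommGroup F] [NormedSpace ℝ F] [NormedAddCommGroup G] [NormedSpace ℝ G]

/-- A family of functions on `[0, 1]` has, uniformly, Taylor expansions of order `m` in the scaled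
variable `h τ`. -/
def UnifApprox (h : ι → ℝ) : ℕ → (ι → ℝ → E) → Prop
  | 0, g => ∃ C, ∀ i, ∀ τ ∈ Icc (0 : ℝ) 1, ‖g i τ‖ ≤ C
  | m + 1, g => ∃ (c : ι → E) (g₁ : ι → ℝ → E), (∃ C, ∀ i, ‖c i‖ ≤ C) ∧ UnifApprox h m g₁ ∧
      ∀ i, ∀ τ ∈ Icc (0 : ℝ) 1, g i τ = c i + (h i * τ) • g₁ i τ

namespace UnifApprox

variable {h : ι → ℝ} {m : ℕ}

lemma congr {g g' : ι → ℝ → E} (hg : UnifApprox h m g)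
    (heq : ∀ i, ∀ τ ∈ Icc (0 : ℝ) 1, g' i τ = g i τ) : UnifApprox h m g' := by
  cases m with
  | zero =>
    obtain ⟨C, hC⟩ := hg
    exact ⟨C, fun i τ hτ => by rw [heq i τ hτ]; exact hC i τ hτ⟩
  | succ m =>
    obtain ⟨c, g₁, hc, hg₁, hgg⟩ := hg
    exact ⟨c, g₁, hc, hg₁, fun i τ hτ => by rw [heq i τ hτ]; exact hgg i τ hτ⟩

lemma const {c : ι → E} (hc : ∃ C, ∀ i, ‖c i‖ ≤ C) (m : ℕ) :
    UnifApprox h m fun i _ => c i := by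
  induction m generalizing c with
  | zero => obtain ⟨C, hC⟩ := hc; exact ⟨C, fun i _ _ => hC i⟩
  | succ m ih =>
    exact ⟨c, fun _ _ => 0, hc, ih ⟨0, fun _ => by simp⟩, fun i τ _ => by simp⟩

lemma add {g g' : ι → ℝ → E} (hg : UnifApprox h m g) (hg' : UnifApprox h m g') :
    UnifApprox h m fun i τ => g i τ + g' i τ := by
  induction m generalizing g g' with
  | zero =>
    obtain ⟨C, hC⟩ := hg
    obtain ⟨C', hC'⟩ := hg'
    exact ⟨C + C', fun i τ hτ => norm_add_le_of_le (hC i τ hτ) (hC' i τ hτ)⟩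
  | succ m ih =>
    obtain ⟨c, g₁, ⟨C, hC⟩, hg₁, hgg⟩ := hg
    obtain ⟨c', g₁', ⟨C', hC'⟩, hg₁', hgg'⟩ := hg'
    refine ⟨fun i => c i + c' i, _, ⟨C + C', fun i => norm_add_le_of_le (hC i) (hC' i)⟩,
      ih hg₁ hg₁', fun i τ hτ => ?_⟩
    simp only [hgg i τ hτ, hgg' i τ hτ, smul_add]
    abel

lemma clm (L : E →L[ℝ] F) {g : ι → ℝ → E} (hg : UnifApprox h m g) :
    UnifApprox h m fun i τ => L (g i τ) := by
  induction m generalizing g with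
  | zero =>
    obtain ⟨C, hC⟩ := hg
    exact ⟨‖L‖ * C, fun i τ hτ => L.le_opNorm_of_le (hC i τ hτ)⟩
  | succ m ih =>
    obtain ⟨c, g₁, ⟨C, hC⟩, hg₁, hgg⟩ := hg
    refine ⟨fun i => L (c i), _, ⟨‖L‖ * C, fun i => L.le_opNorm_of_le (hC i)⟩, ih hg₁,
      fun i τ hτ => ?_⟩
    simp only [hgg i τ hτ, map_add, map_smul]

lemma neg {g : ι → ℝ → E} (hg : UnifApprox h m g) : UnifApprox h m fun i τ => -g i τ :=
  (hg.clm (-ContinuousLinearMap.id ℝ E)).congr fun _ _ _ => rfl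

lemma sub {g g' : ι → ℝ → E} (hg : UnifApprox h m g) (hg' : UnifApprox h m g') :
    UnifApprox h m fun i τ => g i τ - g' i τ := by
  simpa only [sub_eq_add_neg] using hg.add hg'.neg

lemma sum {κ : Type*} (t : Finset κ) {g : κ → ι → ℝ → E} (hg : ∀ k ∈ t, UnifApprox h m (g k)) :
    UnifApprox h m fun i τ => ∑ k ∈ t, g k i τ := by
  classical
  induction t using Finset.induction_on with
  | empty => exact (const ⟨0, fun _ => by simp⟩ m).congr (g := fun _ _ => (0 : E)) (by simp)
  | insert a t ha ih =>
    refine ((hg a (Finset.mem_insert_self _ _)).add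
      (ih fun k hk => hg k (Finset.mem_insert_of_mem hk))).congr fun i τ _ => ?_
    rw [Finset.sum_insert ha]

lemma mono_succ (hh : ∀ i, h i ∈ Ioc (0 : ℝ) 1) {g : ι → ℝ → E} (hg : UnifApprox h (m + 1) g) :
    UnifApprox h m g := by
  induction m generalizing g with
  | zero =>
    obtain ⟨c, g₁, ⟨C, hC⟩, ⟨C', hC'⟩, hgg⟩ := hg
    refine ⟨C + C', fun i τ hτ => ?_⟩
    rw [hgg i τ hτ]
    refine norm_add_le_of_le (hC i) ?_
    rw [norm_smul, Real.norm_eq_abs, abs_of_nonneg (mul_nonneg (hh i).1.le hτ.1)]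
    calc h i * τ * ‖g₁ i τ‖ ≤ 1 * ‖g₁ i τ‖ :=
          mul_le_mul_of_nonneg_right (mul_le_one₀ (hh i).2 hτ.1 hτ.2) (norm_nonneg _)
      _ ≤ C' := by rw [one_mul]; exact hC' i τ hτ
  | succ m ih =>
    obtain ⟨c, g₁, hc, hg₁, hgg⟩ := hg
    exact ⟨c, g₁, hc, ih hg₁, hgg⟩

lemma bounded (hh : ∀ i, h i ∈ Ioc (0 : ℝ) 1) {g : ι → ℝ → E} (hg : UnifApprox h m g) :
    ∃ C, ∀ i, ∀ τ ∈ Icc (0 : ℝ) 1, ‖g i τ‖ ≤ C := by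
  induction m with
  | zero => exact hg
  | succ m ih => exact ih (mono_succ hh hg)

lemma bilin (hh : ∀ i, h i ∈ Ioc (0 : ℝ) 1) (B : E →L[ℝ] F →L[ℝ] G)
    {g : ι → ℝ → E} {g' : ι → ℝ → F}
    (hg : UnifApprox h m g) (hg' : UnifApprox h m g') :
    UnifApprox h m fun i τ => B (g i τ) (g' i τ) := by
  induction m generalizing g g' with
  | zero =>
    obtain ⟨C, hC⟩ := hg
    obtain ⟨C', hC'⟩ := hg'
    exact ⟨‖B‖ * C * C', fun i τ hτ => B.le_of_opNorm₂_le_of_le le_rfl (hC i τ hτ) (hC' i τ hτ)⟩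
  | succ m ih =>
    have hg'm := mono_succ hh hg'
    obtain ⟨c, g₁, ⟨C, hC⟩, hg₁, hgg⟩ := hg
    obtain ⟨c', g₁', ⟨C', hC'⟩, hg₁', hgg'⟩ := hg'
    refine ⟨fun i => B (c i) (c' i), _,
      ⟨‖B‖ * C * C', fun i => B.le_of_opNorm₂_le_of_le le_rfl (hC i) (hC' i)⟩,
      -- B(g, g') = B(c, c') + hτ (B(g₁, g') + B(c, g₁')): the full g' is kept in one factor, at the
      -- lower order m.
      (ih hg₁ hg'm).add (ih (const ⟨C, hC⟩ m) hg₁'), fun i τ hτ => ?_⟩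
    have h2 : B (c i) (g' i τ) = B (c i) (c' i) + (h i * τ) • B (c i) (g₁' i τ) := by
      rw [hgg' i τ hτ, map_add, map_smul]
    beta_reduce
    rw [hgg i τ hτ, map_add, add_apply, h2, map_smul,
      smul_apply, smul_add]
    abel

lemma scaled_smul (hh : ∀ i, h i ∈ Ioc (0 : ℝ) 1) {g : ι → ℝ → E} (hg : UnifApprox h m g) :
    UnifApprox h m fun i τ => (h i * τ) • g i τ :=
  mono_succ hh ⟨fun _ => 0, g, ⟨0, fun _ => by simp⟩, hg, fun i τ _ => by simp⟩

lemma scaled_pow_smul (hh : ∀ i, h i ∈ Ioc (0 : ℝ) 1) {c : ι → E}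
    (hc : ∃ C, ∀ i, ‖c i‖ ≤ C) (k : ℕ) :
    UnifApprox h m fun i τ => (h i * τ) ^ k • c i := by
  induction k with
  | zero => exact (const hc m).congr fun i τ _ => by simp
  | succ k ih =>
    exact (scaled_smul hh ih).congr fun i τ _ => by rw [pow_succ', mul_smul]

lemma expansion (hh : ∀ i, h i ∈ Ioc (0 : ℝ) 1) {g : ι → ℝ → E} (hg : UnifApprox h m g) :
    ∃ C, ∀ i, ∃ q : ℕ → E, (∀ k, ‖q k‖ ≤ C) ∧ ∀ τ ∈ Icc (0 : ℝ) 1,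
      ‖g i τ - ∑ k ∈ Finset.range m, (h i * τ) ^ k • q k‖ ≤ C * (h i * τ) ^ m := by
  induction m generalizing g with
  | zero =>
    obtain ⟨C, hC⟩ := hg
    refine ⟨C, fun i => ⟨fun _ => 0, fun k => ?_, fun τ hτ => ?_⟩⟩
    · simpa using (norm_nonneg _).trans (hC i 0 (by simp))
    · simpa using hC i τ hτ
  | succ m ih =>
    obtain ⟨c, g₁, ⟨C, hC⟩, hg₁, hgg⟩ := hg
    obtain ⟨C', hC'⟩ := ih hg₁
    refine ⟨max C C', fun i => ?_⟩
    obtain ⟨q, hq, hqg⟩ := hC' i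
    refine ⟨fun k => Nat.casesOn k (c i) q, fun k => ?_, fun τ hτ => ?_⟩
    · cases k with
      | zero => exact (hC i).trans (le_max_left _ _)
      | succ k => exact (hq k).trans (le_max_right _ _)
    · have h0 : 0 ≤ h i * τ := mul_nonneg (hh i).1.le hτ.1
      rw [Finset.sum_range_succ', hgg i τ hτ]
      have : c i + (h i * τ) • g₁ i τ -
          (∑ k ∈ Finset.range m, (h i * τ) ^ (k + 1) • q k + (h i * τ) ^ 0 • c i) =
          (h i * τ) • (g₁ i τ - ∑ k ∈ Finset.range m, (h i * τ) ^ k • q k) := by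
        rw [smul_sub, Finset.smul_sum]
        simp only [smul_smul, ← pow_succ', pow_zero, one_smul]
        abel
      refine (congrArg norm this).trans_le ?_
      rw [norm_smul, Real.norm_eq_abs, abs_of_nonneg h0]
      calc _ ≤ h i * τ * (C' * (h i * τ) ^ m) := mul_le_mul_of_nonneg_left (hqg τ hτ) h0
        _ = C' * (h i * τ) ^ (m + 1) := by ring
        _ ≤ _ := mul_le_mul_of_nonneg_right (le_max_right _ _) (by positivity)

lemma of_expansion (hh : ∀ i, h i ∈ Ioc (0 : ℝ) 1) {g : ι → ℝ → E}
    (hg : ∃ C, ∀ i, ∃ q : ℕ → E, (∀ k, ‖q k‖ ≤ C) ∧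
    ∀ τ ∈ Icc (0 : ℝ) 1,
      ‖g i τ - ∑ k ∈ Finset.range m, (h i * τ) ^ k • q k‖ ≤ C * (h i * τ) ^ m) :
    UnifApprox h m g := by
  induction m generalizing g with
  | zero =>
    obtain ⟨C, hC⟩ := hg
    refine ⟨C, fun i τ hτ => ?_⟩
    obtain ⟨q, -, hq⟩ := hC i
    simpa using hq τ hτ
  | succ m ih =>
    obtain ⟨C, hC⟩ := hg
    choose q hq hqg using hC
    -- The difference quotient is meaningless at τ = 0; there the truncated expansion is taken as
    -- the value, so that its remainder is zero.
    refine ⟨fun i => q i 0, fun i τ => if τ = 0 then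
      ∑ k ∈ Finset.range m, (h i * τ) ^ k • q i (k + 1) else (h i * τ)⁻¹ • (g i τ - q i 0),
      ⟨C, fun i => hq i 0⟩, ih ⟨C, fun i => ⟨fun k => q i (k + 1), fun k => hq i _, ?_⟩⟩, ?_⟩
    · intro τ hτ
      have hC0 : 0 ≤ C := (norm_nonneg _).trans (hq i 0)
      have h0 : 0 ≤ h i * τ := mul_nonneg (hh i).1.le hτ.1
      split_ifs with hτ0
      · rw [sub_self, norm_zero]
        positivity
      · have hpos : 0 < h i * τ := mul_pos (hh i).1 (lt_of_le_of_ne hτ.1 (Ne.symm hτ0))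
        have h1 := hqg i τ hτ
        rw [Finset.sum_range_succ'] at h1
        simp only [pow_zero, one_smul] at h1
        have h2 : g i τ - (∑ k ∈ Finset.range m, (h i * τ) ^ (k + 1) • q i (k + 1) + q i 0) =
            (h i * τ) • ((h i * τ)⁻¹ • (g i τ - q i 0) -
              ∑ k ∈ Finset.range m, (h i * τ) ^ k • q i (k + 1)) := by
          rw [smul_sub, smul_inv_smul₀ hpos.ne', Finset.smul_sum]
          simp only [smul_smul, ← pow_succ']
          abel
        rw [h2, norm_smul, Real.norm_eq_abs, abs_of_pos hpos, pow_succ'] at h1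
        refine le_of_mul_le_mul_left (h1.trans_eq ?_) hpos
        ring
    · intro i τ hτ
      beta_reduce
      split_ifs with hτ0
      · subst hτ0
        have h1 := hqg i 0 hτ
        rw [Finset.sum_range_succ'] at h1
        simp [sub_eq_zero] at h1
        simp [h1]
      · have hpos : 0 < h i * τ := mul_pos (hh i).1 (lt_of_le_of_ne hτ.1 (Ne.symm hτ0))
        rw [smul_inv_smul₀ hpos.ne']
        abel

/-- Simultaneous expansions of a function and of its primitive. -/
lemma expansion_primitive (hh : ∀ i, h i ∈ Ioc (0 : ℝ) 1) {g Φ : ι → ℝ → E} (hg : UnifApprox h m g)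
    (hΦ : ∀ i, ∀ τ ∈ Icc (0 : ℝ) 1, HasDerivWithinAt (Φ i) (h i • g i τ) (Icc 0 1) τ) :
    ∃ C, ∀ i, ∃ q : ℕ → E, (∀ k, ‖q k‖ ≤ C) ∧ ∀ τ ∈ Icc (0 : ℝ) 1,
      ‖g i τ - ∑ k ∈ Finset.range m, (h i * τ) ^ k • q k‖ ≤ C * (h i * τ) ^ m ∧
      ‖Φ i τ - Φ i 0 - ∑ k ∈ Finset.range m, ((h i * τ) ^ (k + 1) / (k + 1)) • q k‖ ≤
        C * (h i * τ) ^ (m + 1) := by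
  obtain ⟨C, hC⟩ := expansion hh hg
  refine ⟨C, fun i => ?_⟩
  obtain ⟨q, hq, hqg⟩ := hC i
  refine ⟨q, hq, fun τ hτ => ⟨hqg τ hτ, ?_⟩⟩
  have hC0 : 0 ≤ C := (norm_nonneg _).trans (hq 0)
  set P : ℝ → E := fun σ => Φ i σ - ∑ k ∈ Finset.range m, ((h i * σ) ^ (k + 1) / (k + 1)) • q k
    with hP
  have hsub : Icc (0 : ℝ) τ ⊆ Icc 0 1 := Icc_subset_Icc_right hτ.2
  have hder : ∀ σ ∈ Icc (0 : ℝ) τ, HasDerivWithinAt P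
      (h i • (g i σ - ∑ k ∈ Finset.range m, (h i * σ) ^ k • q k)) (Icc 0 τ) σ := by
    intro σ hσ
    have h1 := (hΦ i σ (hsub hσ)).mono hsub
    have h2 : HasDerivWithinAt (fun σ => ∑ k ∈ Finset.range m,
        ((h i * σ) ^ (k + 1) / (k + 1)) • q k)
        (∑ k ∈ Finset.range m, (h i * (h i * σ) ^ k) • q k) (Icc 0 τ) σ := by
      refine HasDerivWithinAt.fun_sum fun k _ => ?_
      have h3 : HasDerivAt (fun σ : ℝ => (h i * σ) ^ (k + 1) / (k + 1))
          (h i * (h i * σ) ^ k) σ := by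
        have h4 := (((hasDerivAt_id σ).const_mul (h i)).pow (k + 1)).div_const ((k : ℝ) + 1)
        refine h4.congr_deriv ?_
        have : (k : ℝ) + 1 ≠ 0 := by positivity
        simp only [id, Nat.add_sub_cancel, mul_one]
        push_cast
        field_simp
      exact (h3.smul_const (q k)).hasDerivWithinAt
    refine (h1.sub h2).congr_deriv ?_
    rw [smul_sub, Finset.smul_sum]
    simp only [smul_smul]
  have hbound : ∀ σ ∈ Ico (0 : ℝ) τ,
      ‖h i • (g i σ - ∑ k ∈ Finset.range m, (h i * σ) ^ k • q k)‖ ≤ h i * (C * (h i * τ) ^ m) := by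
    intro σ hσ
    rw [norm_smul, Real.norm_eq_abs, abs_of_pos (hh i).1]
    refine mul_le_mul_of_nonneg_left ?_ (hh i).1.le
    refine (hqg σ (hsub (Ico_subset_Icc_self hσ))).trans ?_
    have := (hh i).1.le
    have := hσ.1
    have := hσ.2.le
    gcongr
  have hfin := norm_image_sub_le_of_norm_deriv_le_segment' hder hbound τ ⟨hτ.1, le_rfl⟩
  have hP0 : P 0 = Φ i 0 := by simp [hP]
  rw [hP0] at hfin
  calc _ = ‖P τ - Φ i 0‖ := by rw [hP, sub_right_comm]
    _ ≤ _ := hfin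
    _ = _ := by rw [sub_zero]; ring

/-- Integration gains one order. This is the step that builds expansions of solutions and of Picard
iterates without formulas for their higher derivatives. -/
lemma of_deriv (hh : ∀ i, h i ∈ Ioc (0 : ℝ) 1) {g Φ : ι → ℝ → E} (hg : UnifApprox h m g)
    (hΦ : ∀ i, ∀ τ ∈ Icc (0 : ℝ) 1, HasDerivWithinAt (Φ i) (h i • g i τ) (Icc 0 1) τ)
    (h0 : ∃ C, ∀ i, ‖Φ i 0‖ ≤ C) : UnifApprox h (m + 1) Φ := by
  obtain ⟨C, hC⟩ := expansion_primitive hh hg hΦ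
  obtain ⟨C₀, hC₀⟩ := h0
  refine of_expansion hh ⟨max C C₀, fun i => ?_⟩
  obtain ⟨q, hq, hqg⟩ := hC i
  refine ⟨fun k => Nat.casesOn k (Φ i 0) fun k => ((k : ℝ) + 1)⁻¹ • q k, fun k => ?_,
    fun τ hτ => ?_⟩
  · cases k with
    | zero => exact (hC₀ i).trans (le_max_right _ _)
    | succ k =>
      refine le_trans ?_ (le_max_left _ _)
      rw [norm_smul, norm_inv, Real.norm_eq_abs, abs_of_pos (by positivity)]
      calc ((k : ℝ) + 1)⁻¹ * ‖q k‖ ≤ 1 * ‖q k‖ :=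
            mul_le_mul_of_nonneg_right (inv_le_one_of_one_le₀ (by simp)) (norm_nonneg _)
        _ ≤ C := by rw [one_mul]; exact hq k
  · have h1 := (hqg τ hτ).2
    have h2 : 0 ≤ h i * τ := mul_nonneg (hh i).1.le hτ.1
    rw [Finset.sum_range_succ']
    have h3 : Φ i τ - (∑ k ∈ Finset.range m, (h i * τ) ^ (k + 1) • ((k : ℝ) + 1)⁻¹ • q k +
        (h i * τ) ^ 0 • Φ i 0) =
        Φ i τ - Φ i 0 - ∑ k ∈ Finset.range m, ((h i * τ) ^ (k + 1) / (k + 1)) • q k := by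
      simp only [pow_zero, one_smul, smul_smul, ← div_eq_mul_inv]
      rw [← sub_sub, sub_right_comm]
    refine (congrArg norm h3).trans_le ?_
    exact h1.trans (mul_le_mul_of_nonneg_right (le_max_left _ _) (by positivity))

end UnifApprox

end UnifApprox

/-! ### Smooth observables along solutions of differential equations -/

section Solution

variable {V : Type*} [NormedAddCommGroup V] [NormedSpace ℝ V]
  {E : Type*} [NormedAddCommGroup E] [NormedSpace ℝ E]

/-- `y` solves the autonomous differential equation `y' = f(y)` on `[0, T]`. -/
def SolvesODE (f : V → V) (T : ℝ) (y : ℝ → V) : Prop :=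
  ∀ t ∈ Icc 0 T, HasDerivWithinAt y (f (y t)) (Icc 0 T) t

/-- The derivative of the observable `φ` along solutions of `y' = f(y)`. -/
def lieDeriv (f : V → V) (φ : V → E) (x : V) : E := fderiv ℝ φ x (f x)

lemma contDiff_lieDeriv {f : V → V} (hf : ContDiff ℝ ∞ f) {φ : V → E} (hφ : ContDiff ℝ ∞ φ) :
    ContDiff ℝ ∞ (lieDeriv f φ) :=
  (hφ.fderiv_right (by simp)).clm_apply hf

namespace SolvesODE

variable {f : V → V} {T : ℝ} {y : ℝ → V}

lemma continuousOn (hy : SolvesODE f T y) : ContinuousOn y (Icc 0 T) :=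
  fun t ht => (hy t ht).continuousWithinAt

lemma hasDerivWithinAt_comp (hy : SolvesODE f T y) {φ : V → E} (hφ : ContDiff ℝ ∞ φ)
    {t : ℝ} (ht : t ∈ Icc 0 T) :
    HasDerivWithinAt (fun t => φ (y t)) (lieDeriv f φ (y t)) (Icc 0 T) t :=
  ((hφ.differentiable (by simp)) (y t)).hasFDerivAt.comp_hasDerivWithinAt t (hy t ht)

lemma exists_norm_comp_le (hy : SolvesODE f T y) {E : Type*} [NormedAddCommGroup E]
    {φ : V → E} (hφ : Continuous φ) :
    ∃ C, ∀ t ∈ Icc 0 T, ‖φ (y t)‖ ≤ C :=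
  isCompact_Icc.exists_bound_of_continuousOn (hφ.comp_continuousOn hy.continuousOn)

lemma hasDerivWithinAt_shift (hy : SolvesODE f T y) {φ : V → E} (hφ : ContDiff ℝ ∞ φ)
    {S : Set ℝ} {a h : ℝ}
    (hS : ∀ σ ∈ S, a + h * σ ∈ Icc 0 T) {τ : ℝ} (hτ : τ ∈ S) :
    HasDerivWithinAt (fun τ => φ (y (a + h * τ))) (h • lieDeriv f φ (y (a + h * τ))) S τ := by
  have h1 : HasDerivWithinAt (fun τ : ℝ => a + h * τ) h S τ := by
    simpa using (((hasDerivAt_id τ).const_mul h).const_add a).hasDerivWithinAt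
  exact (hy.hasDerivWithinAt_comp hφ (hS τ hτ)).scomp τ h1 hS

/-- The derivative of an observable along y is its Lie derivative, again a smooth observable;
induction over all observables at once raises the order. -/
lemma unifApprox (hy : SolvesODE f T y) (hf : ContDiff ℝ ∞ f) {ι : Type*}
    {a h : ι → ℝ} (hh : ∀ i, h i ∈ Ioc (0 : ℝ) 1)
    (ha : ∀ i, 0 ≤ a i) (haT : ∀ i, a i + h i ≤ T) (m : ℕ) {φ : V → E} (hφ : ContDiff ℝ ∞ φ) :
    UnifApprox h m fun i τ => φ (y (a i + h i * τ)) := by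
  have hmem : ∀ i, ∀ τ ∈ Icc (0 : ℝ) 1, a i + h i * τ ∈ Icc 0 T := by
    intro i τ hτ
    have h1 := mul_nonneg (hh i).1.le hτ.1
    have h2 := mul_le_mul_of_nonneg_left hτ.2 (hh i).1.le
    constructor <;> linarith [ha i, haT i]
  induction m generalizing φ with
  | zero =>
    obtain ⟨C, hC⟩ := hy.exists_norm_comp_le hφ.continuous
    exact ⟨C, fun i τ hτ => hC _ (hmem i τ hτ)⟩
  | succ m ih =>
    obtain ⟨C, hC⟩ := hy.exists_norm_comp_le hφ.continuous
    exact UnifApprox.of_deriv hh (ih (contDiff_lieDeriv hf hφ))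
      (fun i τ hτ => hy.hasDerivWithinAt_shift hφ (hmem i) hτ)
      ⟨C, fun i => hC _ (hmem i 0 (by simp))⟩

end SolvesODE

end Solution

end Generator

namespace Generator

open Set
open scoped ContDiff

/-! ### Errors of quadrature and extrapolation formulas -/

section Quadrature

variable {ι E : Type*} [NormedAddCommGroup E] [NormedSpace ℝ E] {s : ℕ} {γ : Fin s → ℝ}

lemma sum_smul_scaled_pow (w : Fin s → ℝ) (h : ℝ) (m : ℕ) (q : ℕ → E) :
    ∑ j, w j • ∑ k ∈ Finset.range m, (h * γ j) ^ k • q k =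
      ∑ k ∈ Finset.range m, (h ^ k * ∑ j, w j * γ j ^ k) • q k := by
  simp only [Finset.smul_sum, smul_smul, Finset.mul_sum, Finset.sum_smul]
  rw [Finset.sum_comm]
  refine Finset.sum_congr rfl fun k _ => Finset.sum_congr rfl fun j _ => ?_
  congr 1
  ring

/-- Error of a quadrature rule on `[0, τ]` that is exact for polynomials of degree `< m`. -/
lemma exists_quadrature_error_le {h : ι → ℝ} (hh : ∀ i, h i ∈ Ioc (0 : ℝ) 1) {m : ℕ}
    (hγ : ∀ j, γ j ∈ Icc (0 : ℝ) 1) {g Φ : ι → ℝ → E} (hg : UnifApprox h m g)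
    (hΦ : ∀ i, ∀ τ ∈ Icc (0 : ℝ) 1, HasDerivWithinAt (Φ i) (h i • g i τ) (Icc 0 1) τ)
    (w : Fin s → ℝ) {τ : ℝ} (hτ : τ ∈ Icc (0 : ℝ) 1)
    (hw : ∀ k < m, ∑ j, w j * γ j ^ k = τ ^ (k + 1) / (k + 1)) :
    ∃ C, ∀ i, ‖Φ i τ - Φ i 0 - h i • ∑ j, w j • g i (γ j)‖ ≤ C * h i ^ (m + 1) := by
  obtain ⟨C, hC⟩ := UnifApprox.expansion_primitive hh hg hΦ
  refine ⟨C + ∑ j, |w j| * C, fun i => ?_⟩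
  obtain ⟨q, hq, hqg⟩ := hC i
  have hC0 : 0 ≤ C := (norm_nonneg _).trans (hq 0)
  have hi := (hh i).1.le
  have hle : ∀ σ ∈ Icc (0 : ℝ) 1, ∀ n, C * (h i * σ) ^ n ≤ C * h i ^ n := by
    intro σ hσ n
    refine mul_le_mul_of_nonneg_left (pow_le_pow_left₀ (mul_nonneg hi hσ.1) ?_ n) hC0
    exact mul_le_of_le_one_right hi hσ.2
  have hexact : h i • ∑ j, w j • ∑ k ∈ Finset.range m, (h i * γ j) ^ k • q k =
      ∑ k ∈ Finset.range m, ((h i * τ) ^ (k + 1) / (k + 1)) • q k := by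
    rw [sum_smul_scaled_pow, Finset.smul_sum]
    refine Finset.sum_congr rfl fun k hk => ?_
    rw [hw k (Finset.mem_range.mp hk), smul_smul]
    congr 1
    ring
  have hsplit : Φ i τ - Φ i 0 - h i • ∑ j, w j • g i (γ j) =
      (Φ i τ - Φ i 0 - ∑ k ∈ Finset.range m, ((h i * τ) ^ (k + 1) / (k + 1)) • q k) -
      h i • ∑ j, w j • (g i (γ j) - ∑ k ∈ Finset.range m, (h i * γ j) ^ k • q k) := by
    simp only [smul_sub, Finset.sum_sub_distrib]
    rw [← hexact, Finset.smul_sum]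
    abel
  rw [hsplit, add_mul]
  refine norm_sub_le_of_le ((hqg τ hτ).2.trans (hle τ hτ _)) ?_
  rw [norm_smul, Real.norm_eq_abs, abs_of_nonneg hi]
  calc h i * ‖∑ j, w j • (g i (γ j) - ∑ k ∈ Finset.range m, (h i * γ j) ^ k • q k)‖
      ≤ h i * ∑ j, |w j| * (C * h i ^ m) := by
        refine mul_le_mul_of_nonneg_left (norm_sum_le_of_le _ fun j _ => ?_) hi
        rw [norm_smul, Real.norm_eq_abs]
        exact mul_le_mul_of_nonneg_left (((hqg _ (hγ j)).1).trans (hle _ (hγ j) _)) (abs_nonneg _)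
    _ = (∑ j, |w j| * C) * h i ^ (m + 1) := by
        rw [Finset.sum_mul, Finset.mul_sum]
        exact Finset.sum_congr rfl fun j _ => by ring

/-- Error of a linear extrapolation formula that is exact for polynomials of degree `< m`. -/
lemma exists_extrapolation_error_le {h : ι → ℝ} (hh : ∀ i, h i ∈ Ioc (0 : ℝ) 1) {m : ℕ}
    (hγ : ∀ j, γ j ∈ Icc (0 : ℝ) 1) {g : ι → ℝ → E} (hg : UnifApprox h m g)
    (r : ℝ) (w : Fin s → ℝ) (hw : ∀ k < m, r * 0 ^ k + ∑ j, w j * γ j ^ k = 1) :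
    ∃ C, ∀ i, ‖g i 1 - r • g i 0 - ∑ j, w j • g i (γ j)‖ ≤ C * h i ^ m := by
  obtain ⟨C, hC⟩ := UnifApprox.expansion hh hg
  refine ⟨C + |r| * C + ∑ j, |w j| * C, fun i => ?_⟩
  obtain ⟨q, hq, hqg⟩ := hC i
  have hC0 : 0 ≤ C := (norm_nonneg _).trans (hq 0)
  have hi := (hh i).1.le
  have hle : ∀ σ ∈ Icc (0 : ℝ) 1,
      ‖g i σ - ∑ k ∈ Finset.range m, (h i * σ) ^ k • q k‖ ≤ C * h i ^ m := by
    intro σ hσ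
    refine (hqg σ hσ).trans (mul_le_mul_of_nonneg_left
      (pow_le_pow_left₀ (mul_nonneg hi hσ.1) ?_ m) hC0)
    exact mul_le_of_le_one_right hi hσ.2
  have hexact : ∑ k ∈ Finset.range m, (h i * 1) ^ k • q k =
      r • ∑ k ∈ Finset.range m, (h i * 0) ^ k • q k +
      ∑ j, w j • ∑ k ∈ Finset.range m, (h i * γ j) ^ k • q k := by
    rw [sum_smul_scaled_pow, Finset.smul_sum, ← Finset.sum_add_distrib]
    refine Finset.sum_congr rfl fun k hk => ?_
    rw [smul_smul, ← add_smul]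
    congr 1
    have := hw k (Finset.mem_range.mp hk)
    calc (h i * 1) ^ k = h i ^ k * (r * 0 ^ k + ∑ j, w j * γ j ^ k) := by rw [this]; ring
      _ = _ := by rw [mul_pow]; ring
  have hsplit : g i 1 - r • g i 0 - ∑ j, w j • g i (γ j) =
      (g i 1 - ∑ k ∈ Finset.range m, (h i * 1) ^ k • q k) -
      r • (g i 0 - ∑ k ∈ Finset.range m, (h i * 0) ^ k • q k) -
      ∑ j, w j • (g i (γ j) - ∑ k ∈ Finset.range m, (h i * γ j) ^ k • q k) := by
    simp only [smul_sub, Finset.sum_sub_distrib]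
    rw [hexact]
    abel
  rw [hsplit, add_mul, add_mul]
  refine norm_sub_le_of_le (norm_sub_le_of_le (hle 1 (by simp)) ?_) ?_
  · rw [norm_smul, Real.norm_eq_abs, mul_assoc]
    exact mul_le_mul_of_nonneg_left (hle 0 (by simp)) (abs_nonneg _)
  · rw [Finset.sum_mul]
    refine norm_sum_le_of_le _ fun j _ => ?_
    rw [norm_smul, Real.norm_eq_abs, mul_assoc]
    exact mul_le_mul_of_nonneg_left (hle _ (hγ j)) (abs_nonneg _)

/-- Polynomials whose coefficients are of size `hˢ`, `s` being a bound of the degree, have uniform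
expansions in `h τ`. -/
lemma UnifApprox.eval_smul {h : ι → ℝ} (hh : ∀ i, h i ∈ Ioc (0 : ℝ) 1) {m : ℕ}
    (p : Polynomial ℝ) {n : ℕ} (hp : p.natDegree ≤ n) {d : ι → E}
    (hd : ∃ C, ∀ i, ‖d i‖ ≤ C * h i ^ n) : UnifApprox h m fun i τ => p.eval τ • d i := by
  obtain ⟨C, hC⟩ := hd
  have hC0 : ∀ i, 0 ≤ C := fun i =>
    nonneg_of_mul_nonneg_left ((norm_nonneg _).trans (hC i)) (pow_pos (hh i).1 n)
  -- Each τ^k is written as h^(-k) (hτ)^k; the loss h^(-k) is absorbed by d = O(h^n), as k ≤ n and h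
  -- ≤ 1.
  refine (UnifApprox.sum (Finset.range (n + 1)) fun k hk => UnifApprox.scaled_pow_smul hh
    (c := fun i => (p.coeff k * (h i ^ k)⁻¹) • d i) ⟨|p.coeff k| * C, fun i => ?_⟩ k).congr
    fun i τ _ => ?_
  · have hk' : k ≤ n := Nat.lt_succ_iff.mp (Finset.mem_range.mp hk)
    have hpos := pow_pos (hh i).1 k
    rw [norm_smul, norm_mul, Real.norm_eq_abs, mul_assoc, norm_inv, Real.norm_eq_abs,
      abs_of_pos hpos]
    refine mul_le_mul_of_nonneg_left ?_ (abs_nonneg _)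
    rw [inv_mul_le_iff₀ hpos, mul_comm]
    exact (hC i).trans (mul_le_mul_of_nonneg_left
      (pow_le_pow_of_le_one (hh i).1.le (hh i).2 hk') (hC0 i))
  · rw [Polynomial.eval_eq_sum_range' (Nat.lt_succ_of_le hp), Finset.sum_smul]
    refine Finset.sum_congr rfl fun k _ => ?_
    rw [smul_smul]
    congr 1
    have := (pow_pos (hh i).1 k).ne'
    rw [mul_pow]
    field_simp

lemma norm_sub_le_of_scaled_deriv {h : ℝ} (hh : 0 < h) {C : ℝ} {Φ g : ℝ → E}
    (hΦ : ∀ τ ∈ Icc (0 : ℝ) 1, HasDerivWithinAt Φ (h • g τ) (Icc 0 1) τ)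
    (hg : ∀ τ ∈ Icc (0 : ℝ) 1, ‖g τ‖ ≤ C) {σ τ : ℝ} (hσ : σ ∈ Icc (0 : ℝ) 1)
    (hτ : τ ∈ Icc (0 : ℝ) 1) : ‖Φ τ - Φ σ‖ ≤ C * h := by
  have hC0 : 0 ≤ C := (norm_nonneg _).trans (hg σ hσ)
  have h1 := (convex_Icc (0 : ℝ) 1).norm_image_sub_le_of_norm_hasDerivWithin_le (C := h * C) hΦ
    (fun x hx => by
      rw [norm_smul, Real.norm_eq_abs, abs_of_pos hh]
      exact mul_le_mul_of_nonneg_left (hg x hx) hh.le) hσ hτ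
  have h2 : ‖τ - σ‖ ≤ 1 := by
    rw [Real.norm_eq_abs, abs_le]
    constructor <;> linarith [hσ.1, hσ.2, hτ.1, hτ.2]
  calc _ ≤ h * C * ‖τ - σ‖ := h1
    _ ≤ h * C * 1 := mul_le_mul_of_nonneg_left h2 (by positivity)
    _ = C * h := by ring

end Quadrature

/-! ### Picard iterates for the adjoint variational equation -/

section Picard

variable {ι V : Type*} [NormedAddCommGroup V] [NormedSpace ℝ V]

/-- Picard iterates for the adjoint variational equation `W' = -h W A`, `W(1) = 1`. -/
def picard (h : ι → ℝ) (A : ι → ℝ → V →L[ℝ] V) : ℕ → ι → ℝ → V →L[ℝ] V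
  | 0 => fun _ _ => 1
  | m + 1 => fun i τ => 1 - ∫ σ in (1 : ℝ)..τ, h i • (picard h A m i σ).comp (A i σ)

variable {h : ι → ℝ} {A : ι → ℝ → V →L[ℝ] V}

lemma picard_one (m : ℕ) (i : ι) : picard h A m i 1 = 1 := by
  cases m <;> simp [picard]

lemma continuous_picard (hA : ∀ i, Continuous (A i)) (m : ℕ) (i : ι) :
    Continuous (picard h A m i) := by
  induction m with
  | zero => exact continuous_const
  | succ m ih =>
    refine continuous_const.sub (intervalIntegral.continuous_primitive ?_ _)
    intro a b
    exact ((ih.clm_comp (hA i)).const_smul (h i)).intervalIntegrable a b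

lemma hasDerivAt_picard_succ [CompleteSpace V] (hA : ∀ i, Continuous (A i)) (m : ℕ) (i : ι)
    (τ : ℝ) :
    HasDerivAt (picard h A (m + 1) i) (h i • -(picard h A m i τ).comp (A i τ)) τ := by
  have hc : Continuous fun σ => h i • (picard h A m i σ).comp (A i σ) :=
    ((continuous_picard hA m i).clm_comp (hA i)).const_smul (h i)
  have := (hc.integral_hasStrictDerivAt 1 τ).hasDerivAt.const_sub 1
  rwa [← smul_neg] at this

lemma unifApprox_picard [CompleteSpace V] (hh : ∀ i, h i ∈ Ioc (0 : ℝ) 1)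
    (hA : ∀ i, Continuous (A i))
    (hAa : ∀ n, UnifApprox h n A) (m n : ℕ) : UnifApprox h n (picard h A m) := by
  induction m generalizing n with
  | zero => exact UnifApprox.const ⟨‖(1 : V →L[ℝ] V)‖, fun _ => le_rfl⟩ n
  | succ m ih =>
    have hg : ∀ n, UnifApprox h n fun i τ => -(picard h A m i τ).comp (A i τ) := fun n =>
      (UnifApprox.bilin hh (ContinuousLinearMap.compL ℝ V V V) (ih n) (hAa n)).neg
    obtain ⟨C, hC⟩ := UnifApprox.bounded hh (hg 0)
    refine UnifApprox.mono_succ hh (UnifApprox.of_deriv hh (hg n)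
      (fun i τ _ => (hasDerivAt_picard_succ hA m i τ).hasDerivWithinAt)
      ⟨C + ‖(1 : V →L[ℝ] V)‖, fun i => ?_⟩)
    have h1 := norm_sub_le_of_scaled_deriv (hh i).1
      (fun τ _ => (hasDerivAt_picard_succ hA m i τ).hasDerivWithinAt) (hC i)
      (right_mem_Icc.mpr zero_le_one) (left_mem_Icc.mpr zero_le_one)
    have hC0 : 0 ≤ C := (norm_nonneg _).trans (hC i 0 (by simp))
    rw [picard_one] at h1
    calc _ = ‖(picard h A (m + 1) i 0 - 1) + 1‖ := by rw [sub_add_cancel]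
      _ ≤ _ := norm_add_le_of_le (h1.trans (mul_le_of_le_one_right hC0 (hh i).2)) le_rfl

/-- The value at 0 is the factor by which a step propagates the incoming error; being 1 + O(h), it
permits a Gronwall argument. -/
lemma exists_norm_picard_zero_sub_one_le [CompleteSpace V] (hh : ∀ i, h i ∈ Ioc (0 : ℝ) 1)
    (hA : ∀ i, Continuous (A i)) (hAa : ∀ n, UnifApprox h n A) (m : ℕ) :
    ∃ C, ∀ i, ‖picard h A (m + 1) i 0 - 1‖ ≤ C * h i := by
  obtain ⟨C, hC⟩ := UnifApprox.bounded hh (UnifApprox.bilin hh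
    (ContinuousLinearMap.compL ℝ V V V) (unifApprox_picard hh hA hAa m 0) (hAa 0)).neg
  refine ⟨C, fun i => ?_⟩
  have h1 := norm_sub_le_of_scaled_deriv (hh i).1
    (fun τ _ => (hasDerivAt_picard_succ hA m i τ).hasDerivWithinAt) (hC i)
    (right_mem_Icc.mpr zero_le_one) (left_mem_Icc.mpr zero_le_one)
  rwa [picard_one] at h1

/-- Every iteration integrates the previous difference against hA and gains a factor h. Finitely
many iterates therefore replace the exact adjoint solution to any prescribed order. -/
lemma exists_norm_picard_succ_sub_le [CompleteSpace V] (hh : ∀ i, h i ∈ Ioc (0 : ℝ) 1)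
    (hA : ∀ i, Continuous (A i)) (hAa : ∀ n, UnifApprox h n A) (m : ℕ) :
    ∃ C, ∀ i, ∀ τ ∈ Icc (0 : ℝ) 1,
      ‖picard h A (m + 1) i τ - picard h A m i τ‖ ≤ C * h i ^ (m + 1) := by
  have hone : (1 : ℝ) ∈ Icc (0 : ℝ) 1 := right_mem_Icc.mpr zero_le_one
  obtain ⟨a, ha⟩ := UnifApprox.bounded hh (hAa 0)
  induction m with
  | zero =>
    obtain ⟨C, hC⟩ := UnifApprox.bounded hh (UnifApprox.bilin hh
      (ContinuousLinearMap.compL ℝ V V V) (unifApprox_picard hh hA hAa 0 0) (hAa 0)).neg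
    refine ⟨C, fun i τ hτ => ?_⟩
    have h1 := norm_sub_le_of_scaled_deriv (hh i).1
      (fun τ _ => (hasDerivAt_picard_succ hA 0 i τ).hasDerivWithinAt) (hC i) hone hτ
    rw [picard_one] at h1
    simpa [picard] using h1
  | succ m ih =>
    obtain ⟨C, hC⟩ := ih
    refine ⟨C * a, fun i τ hτ => ?_⟩
    have hder : ∀ τ ∈ Icc (0 : ℝ) 1, HasDerivWithinAt
        (fun τ => picard h A (m + 2) i τ - picard h A (m + 1) i τ)
        (h i • -(picard h A (m + 1) i τ - picard h A m i τ).comp (A i τ)) (Icc 0 1) τ := by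
      intro τ _
      refine ((hasDerivAt_picard_succ hA (m + 1) i τ).sub
        (hasDerivAt_picard_succ hA m i τ)).hasDerivWithinAt.congr_deriv ?_
      rw [← smul_sub, ContinuousLinearMap.sub_comp]
      congr 1
      abel
    have h1 := norm_sub_le_of_scaled_deriv (E := V →L[ℝ] V) (C := C * h i ^ (m + 1) * a)
      (Φ := fun τ => picard h A (m + 2) i τ - picard h A (m + 1) i τ)
      (g := fun τ => -(picard h A (m + 1) i τ - picard h A m i τ).comp (A i τ)) (hh i).1 hder
      (fun τ hτ => by
        rw [norm_neg]
        refine (ContinuousLinearMap.opNorm_comp_le _ _).trans ?_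
        exact mul_le_mul (hC i τ hτ) (ha i τ hτ) (norm_nonneg _)
          ((norm_nonneg _).trans (hC i τ hτ))) hone hτ
    rw [picard_one, picard_one, sub_self, sub_zero] at h1
    exact h1.trans_eq (by ring)

end Picard

/-! ### Local Lipschitz and Taylor bounds; steps as an index set for uniform estimates -/

section Local

variable {V : Type*} [NormedAddCommGroup V] [NormedSpace ℝ V]

lemma exists_lipschitz_closedBall [ProperSpace V] {E : Type*} [NormedAddCommGroup E]
    [NormedSpace ℝ E] {φ : V → E} (hφ : ContDiff ℝ ∞ φ) (ρ : ℝ) :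
    ∃ L, 0 ≤ L ∧ ∀ x x' : V, ‖x‖ ≤ ρ → ‖x'‖ ≤ ρ → ‖φ x - φ x'‖ ≤ L * ‖x - x'‖ := by
  obtain ⟨L, hL⟩ := (isCompact_closedBall (0 : V) ρ).exists_bound_of_continuousOn
    (hφ.continuous_fderiv (by simp)).continuousOn
  refine ⟨max L 0, le_max_right _ _, fun x x' hx hx' => ?_⟩
  exact (convex_closedBall (0 : V) ρ).norm_image_sub_le_of_norm_fderiv_le
    (fun z _ => hφ.differentiable (by simp) z) (fun z hz => (hL z hz).trans (le_max_left _ _))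
    (by simpa using hx') (by simpa using hx)

lemma exists_taylor_closedBall [ProperSpace V] {E : Type*} [NormedAddCommGroup E]
    [NormedSpace ℝ E] {φ : V → E} (hφ : ContDiff ℝ ∞ φ) (ρ : ℝ) :
    ∃ L, 0 ≤ L ∧ ∀ x x' : V, ‖x‖ ≤ ρ → ‖x'‖ ≤ ρ →
      ‖φ x - φ x' - fderiv ℝ φ x' (x - x')‖ ≤ L * ‖x - x'‖ ^ 2 := by
  obtain ⟨L, hL0, hL⟩ := exists_lipschitz_closedBall (hφ.fderiv_right (m := ∞) (by simp)) ρ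
  refine ⟨L, hL0, fun x x' hx hx' => ?_⟩
  have hseg : segment ℝ x' x ⊆ Metric.closedBall (0 : V) ρ :=
    (convex_closedBall (0 : V) ρ).segment_subset (by simpa using hx') (by simpa using hx)
  have h1 := (convex_segment (𝕜 := ℝ) x' x).norm_image_sub_le_of_norm_fderiv_le' (𝕜 := ℝ) (f := φ)
    (φ := fderiv ℝ φ x') (C := L * ‖x - x'‖) (fun z _ => hφ.differentiable (by simp) z)
    (fun z hz => (hL z x' (by simpa using hseg hz) hx').trans
      (mul_le_mul_of_nonneg_left (by
        have := norm_sub_le_of_mem_segment hz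
        simpa using this) hL0))
    (left_mem_segment ℝ x' x) (right_mem_segment ℝ x' x)
  exact h1.trans_eq (by ring)

/-- A step of size `h ≤ h₁` of the collocation method for `y' = f(y)` near the solution `y`: it
starts at time `a` at the value `v`, and has the stages `Y`. -/
structure CollStep {s : ℕ} (γ : Fin s → ℝ) (f : V → V) (y : ℝ → V) (T ρ h₁ : ℝ) where
  (h a : ℝ)
  v : V
  Y : Fin s → V
  h_mem : h ∈ Ioc (0 : ℝ) 1
  h_le : h ≤ h₁
  a_nonneg : 0 ≤ a
  le_T : a + h ≤ T
  err : ‖v - y a‖ ≤ h ^ s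
  Y_le : ∀ i, ‖Y i‖ ≤ ρ
  stage : ∀ i, Y i = v + h • ∑ j, collA γ i j • f (Y j)

namespace CollStep

variable {s : ℕ} {γ : Fin s → ℝ} {f : V → V} {y : ℝ → V} {T ρ h₁ : ℝ}

/-- The result of the step. -/
def next (c : CollStep γ f y T ρ h₁) : V := c.v + c.h • ∑ j, collB γ j • f (c.Y j)

lemma time_mem (c : CollStep γ f y T ρ h₁) {τ : ℝ} (hτ : τ ∈ Icc (0 : ℝ) 1) :
    c.a + c.h * τ ∈ Icc 0 T := by
  have h1 := mul_nonneg c.h_mem.1.le hτ.1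
  have h2 := mul_le_mul_of_nonneg_left hτ.2 c.h_mem.1.le
  have := c.a_nonneg
  have := c.le_T
  constructor <;> linarith

end CollStep

end Local

end Generator

namespace Generator

open Set
open scoped ContDiff

lemma exists_uniform_bound {α : Type*} {s : ℕ} {F : Fin s → α → ℝ} {G : α → ℝ} (hG : ∀ x, 0 ≤ G x)
    (hF : ∀ i, ∃ C, ∀ x, F i x ≤ C * G x) : ∃ C, 0 ≤ C ∧ ∀ i x, F i x ≤ C * G x := by
  choose C hC using hF
  refine ⟨∑ i, |C i|, Finset.sum_nonneg fun i _ => abs_nonneg _, fun i x => ?_⟩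
  refine (hC i x).trans (mul_le_mul_of_nonneg_right ?_ (hG x))
  exact (le_abs_self _).trans
    (Finset.single_le_sum (f := fun i => |C i|) (fun i _ => abs_nonneg _) (Finset.mem_univ i))

/-! ### Defects of the exact solution in the stage and extrapolation formulas -/

section Defect

variable {V : Type*} [NormedAddCommGroup V] [NormedSpace ℝ V]
  {E : Type*} [NormedAddCommGroup E] [NormedSpace ℝ E]
  {s : ℕ} {γ : Fin s → ℝ} {f : V → V} {y : ℝ → V} {T : ℝ}

/-- The pairs of a step size and a time at which a step may start. -/
def stepDomain (T : ℝ) : Set (ℝ × ℝ) := {p | p.1 ∈ Ioc (0 : ℝ) 1 ∧ 0 ≤ p.2 ∧ p.2 + p.1 ≤ T}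

/-- The defect of the solution in the stage equations. -/
def defect (γ : Fin s → ℝ) (f : V → V) (φ : V → E) (y : ℝ → V) (h : ℝ) (i : Fin s) (a : ℝ) : E :=
  φ (y (a + h * γ i)) - φ (y a) - h • ∑ j, collA γ i j • lieDeriv f φ (y (a + h * γ j))

/-- The defect of the solution in the extrapolation formula with weights `w`. -/
def extrapolationDefect (γ : Fin s → ℝ) (w : Fin s → ℝ) (φ : V → E) (y : ℝ → V) (h a : ℝ) : E :=
  φ (y (a + h)) - (-1 : ℝ) ^ s • φ (y a) - ∑ i, w i • φ (y (a + h * γ i))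

lemma SolvesODE.exists_norm_defect_le (hy : SolvesODE f T y) (hf : ContDiff ℝ ∞ f)
    (hγ : IsGaussNodes γ) {φ : V → E} (hφ : ContDiff ℝ ∞ φ) :
    ∃ C, 0 ≤ C ∧ ∀ i, ∀ p ∈ stepDomain T, ‖defect γ f φ y p.1 i p.2‖ ≤ C * p.1 ^ (s + 1) := by
  have hnode : ∀ i, γ i ∈ Icc (0 : ℝ) 1 := fun i => Ioo_subset_Icc_self (hγ.mem_Ioo i)
  have hmain : ∀ i, ∃ C, ∀ p : stepDomain T,
      ‖defect γ f φ y p.1.1 i p.1.2‖ ≤ C * p.1.1 ^ (s + 1) := by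
    intro i
    have h1 := exists_quadrature_error_le (ι := stepDomain T) (h := fun p => p.1.1) (m := s)
      (fun p => p.2.1) hnode
      (hy.unifApprox hf (a := fun p : stepDomain T => p.1.2) (fun p => p.2.1)
        (fun p => p.2.2.1) (fun p => p.2.2.2) s (contDiff_lieDeriv hf hφ))
      (fun p τ hτ => hy.hasDerivWithinAt_shift hφ (S := Icc 0 1) (fun σ hσ => by
        have h1 := mul_nonneg p.2.1.1.le hσ.1
        have h2 := mul_le_mul_of_nonneg_left hσ.2 p.2.1.1.le
        have := p.2.2
        constructor <;> linarith) hτ)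
      (collA γ i) (hnode i) (fun k hk => by
        simp only [collA_eq]
        exact sum_collPoly_mul_pow hγ.1 k hk (γ i))
    simpa [defect] using h1
  obtain ⟨C, hC0, hC⟩ := exists_uniform_bound
    (fun p : stepDomain T => pow_nonneg p.2.1.1.le _) hmain
  exact ⟨C, hC0, fun i p hp => hC i ⟨p, hp⟩⟩

/-- Both properties come from testing the extrapolation formula: on monomials, and on the primitives
of the Lagrange basis, which vanish at 0. The second says that w is bᵀA⁻¹ for the Runge–Kutta matrix
A. -/
lemma IsGaussNodes.exists_extrapolation_weights (hγ : IsGaussNodes γ) :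
    ∃ w : Fin s → ℝ, (∀ k < s + 1, (-1) ^ s * 0 ^ k + ∑ i, w i * γ i ^ k = 1) ∧
      ∀ j, ∑ i, w i * collA γ i j = collB γ j := by
  obtain ⟨w, hw⟩ := hγ.exists_extrapolation
  refine ⟨w, fun k hk => ?_, fun j => ?_⟩
  · have := hw (Polynomial.X ^ k) (by simpa using Nat.lt_succ_iff.mp hk)
    simpa using this.symm
  · have := hw (collPoly γ j) (natDegree_collPoly_le hγ.1 j)
    rw [collB_eq, this]
    simp [collPoly, eval_zero_primitive, collA_eq]

lemma SolvesODE.exists_norm_extrapolationDefect_le (hy : SolvesODE f T y) (hf : ContDiff ℝ ∞ f)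
    (hγ : IsGaussNodes γ) {w : Fin s → ℝ}
    (hw : ∀ k < s + 1, (-1) ^ s * 0 ^ k + ∑ i, w i * γ i ^ k = 1)
    {φ : V → E} (hφ : ContDiff ℝ ∞ φ) :
    ∃ C, ∀ p ∈ stepDomain T, ‖extrapolationDefect γ w φ y p.1 p.2‖ ≤ C * p.1 ^ (s + 1) := by
  have h1 := exists_extrapolation_error_le (ι := stepDomain T) (h := fun p => p.1.1) (m := s + 1)
      (fun p => p.2.1) (fun i => Ioo_subset_Icc_self (hγ.mem_Ioo i))
      (hy.unifApprox hf (a := fun p : stepDomain T => p.1.2) (fun p => p.2.1)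
        (fun p => p.2.2.1) (fun p => p.2.2.2) (s + 1) hφ) ((-1) ^ s) w hw
  obtain ⟨C, hC⟩ := h1
  refine ⟨C, fun p hp => ?_⟩
  simpa [extrapolationDefect] using hC ⟨p, hp⟩

lemma lieDeriv_id (f : V → V) : lieDeriv f id = f := by
  funext x
  simp [lieDeriv]

end Defect

/-! ### Stage errors and the local error of order 2s + 1 -/

section Local

variable {V : Type*} [NormedAddCommGroup V] [NormedSpace ℝ V]
  {s : ℕ} {γ : Fin s → ℝ} {f : V → V} {y : ℝ → V} {T ρ h₁ : ℝ}

lemma CollStep.mem_stepDomain (c : CollStep γ f y T ρ h₁) : (c.h, c.a) ∈ stepDomain T :=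
  ⟨c.h_mem, c.a_nonneg, c.le_T⟩

/-- The stages are close to the solution, with an error of size `hˢ⁺¹`. -/
lemma exists_stage_error_le [ProperSpace V] (hy : SolvesODE f T y) (hf : ContDiff ℝ ∞ f)
    (hγ : IsGaussNodes γ) (hρ : ∀ t ∈ Icc 0 T, ‖y t‖ ≤ ρ) :
    ∃ h₁ > 0, ∃ C, 0 ≤ C ∧ ∀ c : CollStep γ f y T ρ h₁, ∀ i,
      ‖c.Y i - y (c.a + c.h * γ i)‖ ≤ C * (‖c.v - y c.a‖ + c.h ^ (s + 1)) := by
  have hnode : ∀ i, γ i ∈ Icc (0 : ℝ) 1 := fun i => Ioo_subset_Icc_self (hγ.mem_Ioo i)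
  obtain ⟨D, hD0, hD⟩ := hy.exists_norm_defect_le hf hγ contDiff_id
  obtain ⟨L, hL0, hL⟩ := exists_lipschitz_closedBall hf ρ
  set α : ℝ := ∑ i, ∑ j, |collA γ i j| with hα
  have hα0 : 0 ≤ α := Finset.sum_nonneg fun i _ => Finset.sum_nonneg fun j _ => abs_nonneg _
  -- This bound on the step size gives h α L ≤ 1/2, so the Lipschitz term is absorbed into the
  -- left-hand side at the cost of a factor 2.
  refine ⟨1 / (2 * (α * L + 1)), by positivity, 2 * (1 + D), by positivity, fun c i => ?_⟩
  have hh := c.h_mem.1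
  set η : Fin s → V := fun i => c.Y i - y (c.a + c.h * γ i) with hη
  have hYf : ∀ j, ‖f (c.Y j) - f (y (c.a + c.h * γ j))‖ ≤ L * ‖η‖ := fun j =>
    (hL _ _ (c.Y_le j) (hρ _ (c.time_mem (hnode j)))).trans
      (mul_le_mul_of_nonneg_left (norm_le_pi_norm η j) hL0)
  have hη_eq : ∀ i, η i = (c.v - y c.a) +
      c.h • ∑ j, collA γ i j • (f (c.Y j) - f (y (c.a + c.h * γ j))) -
      defect γ f id y c.h i c.a := by
    intro i
    simp only [hη, defect, lieDeriv_id, id, smul_sub, Finset.sum_sub_distrib]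
    conv_lhs => rw [c.stage i]
    abel
  have hbound : ‖η‖ ≤ ‖c.v - y c.a‖ + c.h * (α * (L * ‖η‖)) + D * c.h ^ (s + 1) := by
    have hpos : 0 ≤ ‖c.v - y c.a‖ + c.h * (α * (L * ‖η‖)) + D * c.h ^ (s + 1) := by positivity
    rw [pi_norm_le_iff_of_nonneg hpos]
    intro i
    rw [hη_eq i]
    refine norm_sub_le_of_le (norm_add_le_of_le le_rfl ?_) (hD i _ c.mem_stepDomain)
    rw [norm_smul, Real.norm_eq_abs, abs_of_pos hh]
    refine mul_le_mul_of_nonneg_left ?_ hh.le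
    calc ‖∑ j, collA γ i j • (f (c.Y j) - f (y (c.a + c.h * γ j)))‖
        ≤ ∑ j, |collA γ i j| * (L * ‖η‖) := norm_sum_le_of_le _ fun j _ => by
          rw [norm_smul, Real.norm_eq_abs]
          exact mul_le_mul_of_nonneg_left (hYf j) (abs_nonneg _)
      _ = (∑ j, |collA γ i j|) * (L * ‖η‖) := by rw [Finset.sum_mul]
      _ ≤ α * (L * ‖η‖) := by
          refine mul_le_mul_of_nonneg_right ?_ (by positivity)
          exact Finset.single_le_sum (f := fun i => ∑ j, |collA γ i j|)
            (fun i _ => Finset.sum_nonneg fun j _ => abs_nonneg _) (Finset.mem_univ i)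
  have hsmall : c.h * (α * L) ≤ 1 / 2 := by
    have h1 := c.h_le
    rw [le_div_iff₀ (by positivity)] at h1
    nlinarith
  have h2 : c.h * (α * (L * ‖η‖)) ≤ 1 / 2 * ‖η‖ := by
    calc c.h * (α * (L * ‖η‖)) = c.h * (α * L) * ‖η‖ := by ring
      _ ≤ _ := mul_le_mul_of_nonneg_right hsmall (norm_nonneg _)
  have h3 : ‖η‖ ≤ 2 * (‖c.v - y c.a‖ + D * c.h ^ (s + 1)) := by linarith
  refine (norm_le_pi_norm η i).trans (h3.trans ?_)
  have h4 : 0 ≤ c.h ^ (s + 1) := by positivity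
  have h5 := norm_nonneg (c.v - y c.a)
  nlinarith [mul_nonneg hD0 h5]

/-- The local error of the Gauss method has size `h²ˢ⁺¹`. -/
lemma exists_local_error_le [FiniteDimensional ℝ V] (hy : SolvesODE f T y) (hf : ContDiff ℝ ∞ f)
    (hs : 1 ≤ s) (hγ : IsGaussNodes γ) (hρ : ∀ t ∈ Icc 0 T, ‖y t‖ ≤ ρ) {C₁ : ℝ} (hC₁ : 0 ≤ C₁)
    (hstage : ∀ c : CollStep γ f y T ρ h₁, ∀ i,
      ‖c.Y i - y (c.a + c.h * γ i)‖ ≤ C₁ * (‖c.v - y c.a‖ + c.h ^ (s + 1))) :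
    ∃ C, 0 ≤ C ∧ ∀ c : CollStep γ f y T ρ h₁,
      ‖(c.next - y (c.a + c.h)) - (c.v - y c.a)‖ ≤
        C * (c.h * ‖c.v - y c.a‖ + c.h ^ (2 * s + 1)) := by
  have : ProperSpace V := FiniteDimensional.proper_real V
  have : CompleteSpace V := FiniteDimensional.complete ℝ V
  obtain ⟨r, rfl⟩ : ∃ r, s = r + 1 := ⟨s - 1, by omega⟩
  have hnode : ∀ i, γ i ∈ Icc (0 : ℝ) 1 := fun i => Ioo_subset_Icc_self (hγ.mem_Ioo i)
  obtain ⟨L, hL0, hL⟩ := exists_lipschitz_closedBall hf ρ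
  obtain ⟨L₂, hL₂0, hL₂⟩ := exists_taylor_closedBall hf ρ
  -- All admissible steps together form the index set of the expansions, so the constants below do
  -- not depend on the step.
  set h : CollStep γ f y T ρ h₁ → ℝ := CollStep.h with hh_def
  have hh : ∀ c, h c ∈ Ioc (0 : ℝ) 1 := fun c => c.h_mem
  have hhs : ∀ c, h c ^ (r + 1) ≤ 1 := fun c => pow_le_one₀ (hh c).1.le (hh c).2
  -- The entry condition `err` enters here: stage errors of size h^s suffice for the collocation
  -- polynomial to have uniform expansions.
  have hη : ∀ (c : CollStep γ f y T ρ h₁) i, ‖c.Y i - y (c.a + c.h * γ i)‖ ≤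
      2 * C₁ * h c ^ (r + 1) := by
    intro c i
    refine (hstage c i).trans ?_
    have h1 := c.err
    have h2 : c.h ^ (r + 1 + 1) ≤ c.h ^ (r + 1) :=
      pow_le_pow_of_le_one c.h_mem.1.le c.h_mem.2 (Nat.le_succ _)
    calc _ ≤ C₁ * (c.h ^ (r + 1) + c.h ^ (r + 1)) := by gcongr
      _ = _ := by ring
  have hyA : ∀ {E : Type _} [NormedAddCommGroup E] [NormedSpace ℝ E] (n : ℕ) (φ : V → E),
      ContDiff ℝ ∞ φ → UnifApprox h n fun c τ => φ (y (c.a + h c * τ)) := fun n φ hφ =>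
    hy.unifApprox hf hh CollStep.a_nonneg CollStep.le_T n hφ
  -- the derivative of the collocation polynomial
  set U' : CollStep γ f y T ρ h₁ → ℝ → V := fun c τ =>
    ∑ j, (Lagrange.basis Finset.univ γ j).eval τ • f (c.Y j) with hU'
  set U : CollStep γ f y T ρ h₁ → ℝ → V := fun c τ =>
    c.v + h c • ∑ j, (collPoly γ j).eval τ • f (c.Y j) with hU
  have hUder : ∀ c, ∀ τ ∈ Icc (0 : ℝ) 1, HasDerivWithinAt (U c) (h c • U' c τ) (Icc 0 1) τ := by
    intro c τ _
    refine HasDerivAt.hasDerivWithinAt ?_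
    refine HasDerivAt.const_add _ (HasDerivAt.const_smul _ (HasDerivAt.fun_sum fun j _ => ?_))
    rw [← derivative_collPoly]
    exact ((collPoly γ j).hasDerivAt τ).smul_const _
  have hU'a : ∀ n, UnifApprox h n U' := by
    intro n
    obtain ⟨C, hC⟩ := UnifApprox.expansion hh (hyA (r + 1) f hf)
    choose q hq hqg using hC
    -- Interpolation reproduces the Taylor part of degree below s; the rest d_j = O(h^s) multiplies
    -- Lagrange polynomials of degree below s and is covered by `UnifApprox.eval_smul` at every
    -- order.
    set d : Fin (r + 1) → CollStep γ f y T ρ h₁ → V := fun j c =>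
      f (c.Y j) - ∑ k ∈ Finset.range (r + 1), (h c * γ j) ^ k • q c k with hd
    have hdb : ∀ j, ∃ C, ∀ c, ‖d j c‖ ≤ C * h c ^ (r + 1) := by
      intro j
      refine ⟨L * (2 * C₁) + C, fun c => ?_⟩
      have hC0 : 0 ≤ C := (norm_nonneg _).trans (hq c 0)
      have e1 := (hL _ _ (c.Y_le j) (hρ _ (c.time_mem (hnode j)))).trans
        (mul_le_mul_of_nonneg_left (hη c j) hL0)
      have e2 := hqg c (γ j) (hnode j)
      have e3 : C * (h c * γ j) ^ (r + 1) ≤ C * h c ^ (r + 1) := by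
        refine mul_le_mul_of_nonneg_left (pow_le_pow_left₀ ?_ ?_ _) hC0
        · exact mul_nonneg (hh c).1.le (hnode j).1
        · exact mul_le_of_le_one_right (hh c).1.le (hnode j).2
      calc ‖d j c‖ = ‖(f (c.Y j) - f (y (c.a + c.h * γ j))) + (f (y (c.a + c.h * γ j)) -
            ∑ k ∈ Finset.range (r + 1), (h c * γ j) ^ k • q c k)‖ := by
            rw [hd, sub_add_sub_cancel]
        _ ≤ L * (2 * C₁ * h c ^ (r + 1)) + C * h c ^ (r + 1) :=
            norm_add_le_of_le e1 (e2.trans e3)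
        _ = _ := by ring
    refine ((UnifApprox.sum (Finset.range (r + 1)) fun k _ => UnifApprox.scaled_pow_smul hh
      (c := fun c => q c k) ⟨C, fun c => hq c k⟩ k).add (UnifApprox.sum Finset.univ fun j _ =>
        UnifApprox.eval_smul hh (Lagrange.basis Finset.univ γ j) (n := r + 1) ?_
          (hdb j))).congr fun c τ _ => ?_
    · rw [Lagrange.natDegree_basis hγ.1.injOn (Finset.mem_univ j)]
      simp
    · have hlag : ∀ k ∈ Finset.range (r + 1),
          ∑ j, (Lagrange.basis Finset.univ γ j).eval τ * γ j ^ k = τ ^ k := by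
        intro k hk
        have hdeg : (Polynomial.X ^ k : Polynomial ℝ).degree <
            (Finset.univ : Finset (Fin (r + 1))).card := by
          rw [Polynomial.degree_X_pow, Finset.card_univ, Fintype.card_fin]
          exact_mod_cast Finset.mem_range.mp hk
        have e1 := congrArg (Polynomial.eval τ) (Lagrange.eq_interpolate hγ.1.injOn hdeg)
        simp only [Lagrange.interpolate_apply, Polynomial.eval_finsetSum, Polynomial.eval_mul,
          Polynomial.eval_C, Polynomial.eval_pow, Polynomial.eval_X] at e1
        rw [e1]
        exact Finset.sum_congr rfl fun j _ => mul_comm _ _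
      have hP : ∑ k ∈ Finset.range (r + 1), (h c * τ) ^ k • q c k =
          ∑ j, (Lagrange.basis Finset.univ γ j).eval τ •
            ∑ k ∈ Finset.range (r + 1), (h c * γ j) ^ k • q c k := by
        rw [sum_smul_scaled_pow]
        refine Finset.sum_congr rfl fun k hk => ?_
        rw [hlag k hk, mul_pow]
      rw [hP, ← Finset.sum_add_distrib]
      refine Finset.sum_congr rfl fun j _ => ?_
      rw [← smul_add, hd, add_sub_cancel]
  obtain ⟨Cy, hCy⟩ := hy.exists_norm_comp_le (φ := id) continuous_id
  have hUa : ∀ n, UnifApprox h n U := by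
    intro n
    refine UnifApprox.mono_succ hh (UnifApprox.of_deriv hh (hU'a n) hUder ⟨1 + Cy, fun c => ?_⟩)
    have e1 : U c 0 = (c.v - y c.a) + y c.a := by
      simp [hU, collPoly, eval_zero_primitive]
    rw [e1]
    refine norm_add_le_of_le (c.err.trans (hhs c)) (hCy c.a ?_)
    simpa using c.time_mem (left_mem_Icc.mpr zero_le_one)
  -- the adjoint variational equation
  set A : CollStep γ f y T ρ h₁ → ℝ → V →L[ℝ] V := fun c τ =>
    fderiv ℝ f (y (c.a + h c * projIcc (0 : ℝ) 1 zero_le_one τ)) with hA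
  have hA_eq : ∀ c, ∀ τ ∈ Icc (0 : ℝ) 1, A c τ = fderiv ℝ f (y (c.a + h c * τ)) := by
    intro c τ hτ
    simp only [hA, projIcc_of_mem zero_le_one hτ]
  -- The projection onto [0, 1] makes A continuous on the whole line, as the Picard lemmas require;
  -- nothing changes on [0, 1].
  have hAc : ∀ c, Continuous (A c) := by
    intro c
    refine (hf.continuous_fderiv (by simp)).comp (hy.continuousOn.comp_continuous ?_ ?_)
    · fun_prop
    · exact fun τ => c.time_mem (projIcc (0 : ℝ) 1 zero_le_one τ).2
  have hAa : ∀ n, UnifApprox h n A := fun n =>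
    (hyA n _ (hf.fderiv_right (m := ∞) (by simp))).congr hA_eq
  obtain ⟨CA, hCA⟩ := UnifApprox.bounded hh (hAa 0)
  -- The derivative of W involves the previous iterate W₀. With s = r + 1 iterations, W - W₀ =
  -- O(h^s), and its product with a stage error is small enough.
  set W := picard h A (r + 1) with hW
  set W₀ := picard h A r with hW₀
  have hWa : ∀ n, UnifApprox h n W := unifApprox_picard hh hAc hAa (r + 1)
  have hW₀a : ∀ n, UnifApprox h n W₀ := unifApprox_picard hh hAc hAa r
  obtain ⟨CW, hCW⟩ := UnifApprox.bounded hh (hWa 0)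
  obtain ⟨CW₁, hCW₁⟩ := exists_norm_picard_zero_sub_one_le hh hAc hAa r
  obtain ⟨CW₂, hCW₂⟩ := exists_norm_picard_succ_sub_le hh hAc hAa r
  set e : CollStep γ f y T ρ h₁ → ℝ → V := fun c τ => U c τ - y (c.a + h c * τ) with he
  set g : CollStep γ f y T ρ h₁ → ℝ → V := fun c τ =>
    -((W₀ c τ).comp (A c τ)) (e c τ) + W c τ (U' c τ - f (y (c.a + h c * τ))) with hg
  -- The order 2s is the number of moments that the Gauss rule integrates exactly; it fixes the
  -- final exponent.
  have hga : UnifApprox h (2 * (r + 1)) g := by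
    refine UnifApprox.add ?_ ?_
    · exact (UnifApprox.bilin hh (ContinuousLinearMap.id ℝ (V →L[ℝ] V))
        (UnifApprox.bilin hh (ContinuousLinearMap.compL ℝ V V V) (hW₀a _) (hAa _))
        ((hUa _).sub (hyA _ id contDiff_id))).neg
    · exact UnifApprox.bilin hh (ContinuousLinearMap.id ℝ (V →L[ℝ] V)) (hWa _)
        ((hU'a _).sub (hyA _ f hf))
  have hΦ : ∀ c, ∀ τ ∈ Icc (0 : ℝ) 1,
      HasDerivWithinAt (fun τ => W c τ (e c τ)) (h c • g c τ) (Icc 0 1) τ := by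
    intro c τ hτ
    have e1 : HasDerivWithinAt (W c) _ (Icc 0 1) τ :=
      (hasDerivAt_picard_succ hAc r c τ).hasDerivWithinAt
    have e2 := hy.hasDerivWithinAt_shift contDiff_id (S := Icc 0 1) (fun σ hσ => c.time_mem hσ) hτ
    have e3 : HasDerivWithinAt (e c) _ (Icc 0 1) τ := (hUder c τ hτ).sub e2
    refine (e1.clm_apply e3).congr_deriv ?_
    simp only [lieDeriv_id, hg, ← hW₀, smul_apply, neg_apply, smul_add]
    rw [← map_smul, smul_sub]
  obtain ⟨CQ, hCQ⟩ := exists_quadrature_error_le hh hnode hga hΦ (collB γ)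
    (right_mem_Icc.mpr zero_le_one) (fun k hk => by
      rw [hγ.sum_collB_mul_pow k hk, one_pow])
  have hgnode : ∀ c i, ‖g c (γ i)‖ ≤ (|CW| * L₂ * (2 * C₁) + |CW₂| * |CA|) * C₁ *
      (‖c.v - y c.a‖ + h c ^ (2 * (r + 1))) := by
    intro c i
    have hUn : U c (γ i) = c.Y i := by
      simp only [hU, ← collA_eq]
      exact (c.stage i).symm
    have hU'n : U' c (γ i) = f (c.Y i) := by
      simp [hU', eval_basis_node hγ.1]
    set η := c.Y i - y (c.a + c.h * γ i) with hηdef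
    have hen : e c (γ i) = η := by simp only [he, hUn]; rfl
    -- At a node U' = f(U). Adding and subtracting W A η turns g into a Taylor remainder plus a term
    -- with W - W₀; either one is O(h^s) times the stage error.
    have hgn : g c (γ i) = W c (γ i) (f (c.Y i) - f (y (c.a + c.h * γ i)) - A c (γ i) η) +
        (W c (γ i) - W₀ c (γ i)) (A c (γ i) η) := by
      simp only [hg, hen, hU'n, map_sub, sub_apply]
      change -(W₀ c (γ i)) (A c (γ i) η) + (W c (γ i) (f (c.Y i)) -
        W c (γ i) (f (y (c.a + c.h * γ i)))) = _
      abel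
    have b1 : ‖f (c.Y i) - f (y (c.a + c.h * γ i)) - A c (γ i) η‖ ≤ L₂ * ‖η‖ ^ 2 := by
      rw [hA_eq c _ (hnode i)]
      exact hL₂ _ _ (c.Y_le i) (hρ _ (c.time_mem (hnode i)))
    have b2 : ‖A c (γ i) η‖ ≤ |CA| * ‖η‖ :=
      (A c (γ i)).le_of_opNorm_le ((hCA c _ (hnode i)).trans (le_abs_self _)) η
    have b3 : ‖W c (γ i)‖ ≤ |CW| := (hCW c _ (hnode i)).trans (le_abs_self _)
    have hpos : 0 ≤ h c := (hh c).1.le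
    have b4 : ‖W c (γ i) - W₀ c (γ i)‖ ≤ |CW₂| * h c ^ (r + 1) :=
      (hCW₂ c _ (hnode i)).trans
        (mul_le_mul_of_nonneg_right (le_abs_self _) (pow_nonneg hpos _))
    have b5 := hη c i
    have b6 := hstage c i
    rw [← hηdef] at b5
    have b7 : h c ^ (r + 1) * (‖c.v - y c.a‖ + h c ^ (r + 1 + 1)) ≤
        ‖c.v - y c.a‖ + h c ^ (2 * (r + 1)) := by
      rw [mul_add]
      refine add_le_add (mul_le_of_le_one_left (norm_nonneg _) (hhs c)) ?_
      rw [← pow_add]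
      exact pow_le_pow_of_le_one hpos (hh c).2 (by omega)
    have b8 : ‖η‖ ≤ C₁ * (‖c.v - y c.a‖ + h c ^ (r + 1 + 1)) := b6
    calc ‖g c (γ i)‖ ≤ |CW| * (L₂ * ‖η‖ ^ 2) + |CW₂| * h c ^ (r + 1) * (|CA| * ‖η‖) := by
          rw [hgn]
          refine norm_add_le_of_le ?_ ?_
          · exact ((W c (γ i)).le_of_opNorm_le b3 _).trans
              (mul_le_mul_of_nonneg_left b1 (abs_nonneg _))
          · exact (ContinuousLinearMap.le_of_opNorm_le _ b4 _).trans
              (mul_le_mul_of_nonneg_left b2 (by positivity))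
      _ = (|CW| * L₂ * ‖η‖ + |CW₂| * h c ^ (r + 1) * |CA|) * ‖η‖ := by ring
      _ ≤ (|CW| * L₂ * (2 * C₁ * h c ^ (r + 1)) + |CW₂| * h c ^ (r + 1) * |CA|) *
            (C₁ * (‖c.v - y c.a‖ + h c ^ (r + 1 + 1))) := by gcongr
      _ = (|CW| * L₂ * (2 * C₁) + |CW₂| * |CA|) * C₁ *
            (h c ^ (r + 1) * (‖c.v - y c.a‖ + h c ^ (r + 1 + 1))) := by ring
      _ ≤ _ := mul_le_mul_of_nonneg_left b7 (by positivity)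
  set CG := (|CW| * L₂ * (2 * C₁) + |CW₂| * |CA|) * C₁ with hCG
  have hCG0 : 0 ≤ CG := by positivity
  set β := ∑ j, |collB γ j| with hβ
  have hβ0 : 0 ≤ β := Finset.sum_nonneg fun j _ => abs_nonneg _
  refine ⟨|CQ| + β * CG + |CW₁|, by positivity, fun c => ?_⟩
  have hpos : 0 ≤ h c := (hh c).1.le
  have hQ := hCQ c
  have hF1 : W c 1 (e c 1) = c.next - y (c.a + c.h) := by
    simp only [hW, picard_one, he, hU, ← collB_eq, mul_one]
    rfl
  have he0 : e c 0 = c.v - y c.a := by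
    simp [he, hU, collPoly, eval_zero_primitive]
  rw [hF1, he0] at hQ
  -- Since W(1) = 1, the increment of We differs from that of e only by (W(0) - 1) applied to the
  -- incoming error.
  have hsplit : (c.next - y (c.a + c.h)) - (c.v - y c.a) =
      (c.next - y (c.a + c.h) - W c 0 (c.v - y c.a) - h c • ∑ j, collB γ j • g c (γ j)) +
      h c • ∑ j, collB γ j • g c (γ j) + (W c 0 - 1) (c.v - y c.a) := by
    rw [sub_apply, show (1 : V →L[ℝ] V) (c.v - y c.a) = c.v - y c.a from rfl]
    abel
  have t1 : ‖h c • ∑ j, collB γ j • g c (γ j)‖ ≤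
      h c * (β * (CG * (‖c.v - y c.a‖ + h c ^ (2 * (r + 1))))) := by
    rw [norm_smul, Real.norm_eq_abs, abs_of_nonneg hpos, hβ, Finset.sum_mul]
    refine mul_le_mul_of_nonneg_left (norm_sum_le_of_le _ fun j _ => ?_) hpos
    rw [norm_smul, Real.norm_eq_abs]
    exact mul_le_mul_of_nonneg_left (hgnode c j) (abs_nonneg _)
  have t2 : ‖(W c 0 - 1) (c.v - y c.a)‖ ≤ |CW₁| * h c * ‖c.v - y c.a‖ :=
    ContinuousLinearMap.le_of_opNorm_le _
      ((hCW₁ c).trans (mul_le_mul_of_nonneg_right (le_abs_self _) hpos)) _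
  have t3 := hQ.trans (mul_le_mul_of_nonneg_right (le_abs_self CQ)
    (pow_nonneg hpos (2 * (r + 1) + 1)))
  rw [hsplit]
  refine (norm_add_le_of_le (norm_add_le_of_le t3 t1) t2).trans ?_
  change _ ≤ (|CQ| + β * CG + |CW₁|) * (h c * ‖c.v - y c.a‖ + h c ^ (2 * (r + 1) + 1))
  have n1 : 0 ≤ |CQ| * (h c * ‖c.v - y c.a‖) := by positivity
  have n2 : 0 ≤ |CW₁| * h c ^ (2 * (r + 1) + 1) := by positivity
  have n3 : h c * (β * (CG * (‖c.v - y c.a‖ + h c ^ (2 * (r + 1))))) =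
      β * CG * (h c * ‖c.v - y c.a‖ + h c ^ (2 * (r + 1) + 1)) := by ring
  rw [n3]
  linarith

end Local

end Generator

namespace Generator

open Set Asymptotics
open scoped ContDiff

/-! ### Variation of the defects from one step to the next -/

section Translation

variable {V : Type*} [NormedAddCommGroup V] [NormedSpace ℝ V]
  {E : Type*} [NormedAddCommGroup E] [NormedSpace ℝ E]
  {s : ℕ} {γ : Fin s → ℝ} {f : V → V} {y : ℝ → V} {T : ℝ}

lemma SolvesODE.hasDerivWithinAt_translate (hy : SolvesODE f T y) {φ : V → E}
    (hφ : ContDiff ℝ ∞ φ) {S : Set ℝ} {d : ℝ} (hS : ∀ σ ∈ S, σ + d ∈ Icc 0 T) {t : ℝ}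
    (ht : t ∈ S) :
    HasDerivWithinAt (fun t => φ (y (t + d))) (lieDeriv f φ (y (t + d))) S t := by
  have h1 : HasDerivWithinAt (fun t : ℝ => t + d) 1 S t :=
    ((hasDerivAt_id t).add_const d).hasDerivWithinAt
  simpa [Function.comp_def] using (hy.hasDerivWithinAt_comp hφ (hS t ht)).scomp t h1 hS

lemma SolvesODE.exists_norm_comp_sub_le (hy : SolvesODE f T y) (hf : ContDiff ℝ ∞ f) {φ : V → E}
    (hφ : ContDiff ℝ ∞ φ) :
    ∃ C, ∀ t ∈ Icc 0 T, ∀ t' ∈ Icc 0 T, ‖φ (y t') - φ (y t)‖ ≤ C * ‖t' - t‖ := by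
  obtain ⟨C, hC⟩ := hy.exists_norm_comp_le (contDiff_lieDeriv hf hφ).continuous
  exact ⟨C, fun t ht t' ht' => (convex_Icc 0 T).norm_image_sub_le_of_norm_hasDerivWithin_le
    (fun x hx => hy.hasDerivWithinAt_comp hφ hx) hC ht ht'⟩

lemma translate_mem_Icc {h a : ℝ} (hh : 0 < h) (ha : 0 ≤ a) (haT : a + h + h ≤ T) {τ : ℝ}
    (hτ : τ ∈ Icc (0 : ℝ) 1) {t : ℝ} (ht : t ∈ Icc a (a + h)) : t + h * τ ∈ Icc 0 T := by
  have h1 := mul_nonneg hh.le hτ.1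
  have h2 := mul_le_mul_of_nonneg_left hτ.2 hh.le
  constructor <;> linarith [ht.1, ht.2]

/-- The time derivative of the defect of φ is the defect of the Lie derivative of φ, hence of the
same size h^(s+1); translation by h gains one power. The extrapolation defect is treated alike. -/
lemma SolvesODE.exists_norm_defect_sub_le (hy : SolvesODE f T y) (hf : ContDiff ℝ ∞ f)
    (hγ : IsGaussNodes γ) {φ : V → E} (hφ : ContDiff ℝ ∞ φ) :
    ∃ C, ∀ i, ∀ h ∈ Ioc (0 : ℝ) 1, ∀ a, 0 ≤ a → a + h + h ≤ T →
      ‖defect γ f φ y h i (a + h) - defect γ f φ y h i a‖ ≤ C * h ^ (s + 2) := by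
  have hnode : ∀ i, γ i ∈ Icc (0 : ℝ) 1 := fun i => Ioo_subset_Icc_self (hγ.mem_Ioo i)
  obtain ⟨C, -, hC⟩ := hy.exists_norm_defect_le hf hγ (contDiff_lieDeriv hf hφ)
  refine ⟨C, fun i h hh a ha haT => ?_⟩
  have hder : ∀ t ∈ Icc a (a + h), HasDerivWithinAt (defect γ f φ y h i)
      (defect γ f (lieDeriv f φ) y h i t) (Icc a (a + h)) t := by
    intro t ht
    have hmem := fun {τ : ℝ} (hτ : τ ∈ Icc (0 : ℝ) 1) (t : ℝ) (ht : t ∈ Icc a (a + h)) =>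
      translate_mem_Icc hh.1 ha haT hτ ht
    refine ((hy.hasDerivWithinAt_translate hφ (hmem (hnode i)) ht).sub ?_).sub
      (HasDerivWithinAt.const_smul _ (HasDerivWithinAt.fun_sum fun j _ =>
        HasDerivWithinAt.const_smul _ (hy.hasDerivWithinAt_translate (contDiff_lieDeriv hf hφ)
          (hmem (hnode j)) ht)))
    have := hy.hasDerivWithinAt_translate hφ (S := Icc a (a + h)) (d := 0)
      (fun σ hσ => by simpa using hmem (τ := 0) (by simp) σ hσ) ht
    simpa using this
  have hbound : ∀ t ∈ Icc a (a + h), ‖defect γ f (lieDeriv f φ) y h i t‖ ≤ C * h ^ (s + 1) :=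
    fun t ht => hC i (h, t) ⟨hh, ha.trans ht.1, by dsimp only; linarith [ht.2]⟩
  have h1 := (convex_Icc a (a + h)).norm_image_sub_le_of_norm_hasDerivWithin_le hder hbound
    (left_mem_Icc.mpr (by linarith [hh.1])) (right_mem_Icc.mpr (by linarith [hh.1]))
  rw [add_sub_cancel_left, Real.norm_eq_abs, abs_of_pos hh.1] at h1
  exact h1.trans_eq (by ring)

lemma SolvesODE.exists_norm_extrapolationDefect_sub_le (hy : SolvesODE f T y)
    (hf : ContDiff ℝ ∞ f) (hγ : IsGaussNodes γ) {w : Fin s → ℝ}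
    (hw : ∀ k < s + 1, (-1) ^ s * 0 ^ k + ∑ i, w i * γ i ^ k = 1)
    {φ : V → E} (hφ : ContDiff ℝ ∞ φ) :
    ∃ C, ∀ h ∈ Ioc (0 : ℝ) 1, ∀ a, 0 ≤ a → a + h + h ≤ T →
      ‖extrapolationDefect γ w φ y h (a + h) - extrapolationDefect γ w φ y h a‖ ≤
        C * h ^ (s + 2) := by
  have hnode : ∀ i, γ i ∈ Icc (0 : ℝ) 1 := fun i => Ioo_subset_Icc_self (hγ.mem_Ioo i)
  obtain ⟨C, hC⟩ := hy.exists_norm_extrapolationDefect_le hf hγ hw (contDiff_lieDeriv hf hφ)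
  refine ⟨C, fun h hh a ha haT => ?_⟩
  have hder : ∀ t ∈ Icc a (a + h), HasDerivWithinAt (extrapolationDefect γ w φ y h)
      (extrapolationDefect γ w (lieDeriv f φ) y h t) (Icc a (a + h)) t := by
    intro t ht
    have hmem := fun {τ : ℝ} (hτ : τ ∈ Icc (0 : ℝ) 1) (t : ℝ) (ht : t ∈ Icc a (a + h)) =>
      translate_mem_Icc hh.1 ha haT hτ ht
    refine (HasDerivWithinAt.sub (hy.hasDerivWithinAt_translate hφ
      (fun σ hσ => by simpa using hmem (τ := 1) (by simp) σ hσ) ht)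
      (HasDerivWithinAt.const_smul _ ?_)).sub
      (HasDerivWithinAt.fun_sum fun j _ =>
        HasDerivWithinAt.const_smul _ (hy.hasDerivWithinAt_translate hφ
          (hmem (hnode j)) ht))
    have := hy.hasDerivWithinAt_translate hφ (S := Icc a (a + h)) (d := 0)
      (fun σ hσ => by simpa using hmem (τ := 0) (by simp) σ hσ) ht
    simpa using this
  have hbound : ∀ t ∈ Icc a (a + h),
      ‖extrapolationDefect γ w (lieDeriv f φ) y h t‖ ≤ C * h ^ (s + 1) :=
    fun t ht => hC (h, t) ⟨hh, ha.trans ht.1, by dsimp only; linarith [ht.2]⟩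
  have h1 := (convex_Icc a (a + h)).norm_image_sub_le_of_norm_hasDerivWithin_le hder hbound
    (left_mem_Icc.mpr (by linarith [hh.1])) (right_mem_Icc.mpr (by linarith [hh.1]))
  rw [add_sub_cancel_left, Real.norm_eq_abs, abs_of_pos hh.1] at h1
  exact h1.trans_eq (by ring)

end Translation

/-! ### Solvability of the stage equations -/

section Existence

variable {V : Type*} [NormedAddCommGroup V] [NormedSpace ℝ V]
  {s : ℕ} {γ : Fin s → ℝ} {f : V → V}

lemma norm_smul_sum_collA_le {h B : ℝ} (hh : 0 ≤ h) (hB : 0 ≤ B) {k : Fin s → V}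
    (hk : ∀ j, ‖k j‖ ≤ B) (i : Fin s) :
    ‖h • ∑ j, collA γ i j • k j‖ ≤ h * ((∑ i, ∑ j, |collA γ i j|) * B) := by
  rw [norm_smul, Real.norm_eq_abs, abs_of_nonneg hh]
  refine mul_le_mul_of_nonneg_left ?_ hh
  calc ‖∑ j, collA γ i j • k j‖ ≤ ∑ j, |collA γ i j| * B := norm_sum_le_of_le _ fun j _ => by
        rw [norm_smul, Real.norm_eq_abs]
        exact mul_le_mul_of_nonneg_left (hk j) (abs_nonneg _)
    _ = (∑ j, |collA γ i j|) * B := by rw [Finset.sum_mul]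
    _ ≤ _ := by
        refine mul_le_mul_of_nonneg_right ?_ hB
        exact Finset.single_le_sum (f := fun i => ∑ j, |collA γ i j|)
          (fun i _ => Finset.sum_nonneg fun j _ => abs_nonneg _) (Finset.mem_univ i)

/-- The stage equations have a solution if the step size is small. -/
lemma exists_stages [FiniteDimensional ℝ V] (hf : ContDiff ℝ ∞ f) (γ : Fin s → ℝ) (ρ : ℝ) :
    ∃ h₁ > 0, ∀ h : ℝ, 0 < h → h ≤ h₁ → ∀ v : V, ‖v‖ ≤ ρ →
      ∃ Y : Fin s → V, ∀ i, Y i = v + h • ∑ j, collA γ i j • f (Y j) := by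
  have : ProperSpace V := FiniteDimensional.proper_real V
  have : CompleteSpace V := FiniteDimensional.complete ℝ V
  obtain ⟨L, hL0, hL⟩ := exists_lipschitz_closedBall hf (ρ + 1)
  obtain ⟨B, hB⟩ := (isCompact_closedBall (0 : V) (ρ + 1)).exists_bound_of_continuousOn
    hf.continuous.continuousOn
  set α : ℝ := ∑ i, ∑ j, |collA γ i j| with hα
  have hα0 : 0 ≤ α := Finset.sum_nonneg fun i _ => Finset.sum_nonneg fun j _ => abs_nonneg _
  -- One choice of step size serves two purposes: the term with B keeps the iteration in the unit
  -- ball about v, the term with L makes it a contraction with factor 1/2.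
  refine ⟨1 / (2 * (α * L + α * |B| + 1)), by positivity, fun h hh hle v hv => ?_⟩
  have hsmall : h * (α * L) ≤ 1 / 2 ∧ h * (α * |B|) ≤ 1 := by
    rw [le_div_iff₀ (by positivity)] at hle
    have h1 : 0 ≤ h * (α * L) := by positivity
    have h2 : 0 ≤ h * (α * |B|) := by positivity
    constructor <;> nlinarith
  set S : Set (Fin s → V) := Metric.closedBall (fun _ => v) 1 with hS
  have hSmem : ∀ Y ∈ S, ∀ j, ‖Y j‖ ≤ ρ + 1 := by
    intro Y hY j
    have h1 : ‖Y j - v‖ ≤ 1 :=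
      (norm_le_pi_norm (Y - fun _ => v) j).trans (by simpa [hS, dist_eq_norm] using hY)
    calc ‖Y j‖ = ‖v + (Y j - v)‖ := by rw [add_sub_cancel]
      _ ≤ ρ + 1 := norm_add_le_of_le hv h1
  set Θ : (Fin s → V) → Fin s → V := fun Y i => v + h • ∑ j, collA γ i j • f (Y j) with hΘ
  have hmaps : MapsTo Θ S S := by
    intro Y hY
    rw [hS, mem_closedBall_iff_norm, pi_norm_le_iff_of_nonneg zero_le_one]
    intro i
    simp only [hΘ, Pi.sub_apply, add_sub_cancel_left]
    refine (norm_smul_sum_collA_le hh.le (abs_nonneg B) (fun j => ?_) i).trans hsmall.2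
    exact (hB _ (by simpa using hSmem Y hY j)).trans (le_abs_self _)
  have hcontr : ContractingWith (1 / 2) (hmaps.restrict Θ S S) := by
    refine ⟨by norm_num, LipschitzWith.of_dist_le_mul fun Y Y' => ?_⟩
    rw [Subtype.dist_eq, Subtype.dist_eq, dist_eq_norm, dist_eq_norm]
    rw [pi_norm_le_iff_of_nonneg (by positivity)]
    intro i
    have h1 : (Θ Y.1 - Θ Y'.1) i = h • ∑ j, collA γ i j • (f (Y.1 j) - f (Y'.1 j)) := by
      simp only [hΘ, Pi.sub_apply, add_sub_add_left_eq_sub, smul_sub, Finset.sum_sub_distrib]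
    change ‖(Θ Y.1 - Θ Y'.1) i‖ ≤ _
    rw [h1]
    refine (norm_smul_sum_collA_le hh.le (B := L * ‖Y.1 - Y'.1‖) (by positivity)
      (fun j => ?_) i).trans ?_
    · exact (hL _ _ (hSmem _ Y.2 j) (hSmem _ Y'.2 j)).trans
        (mul_le_mul_of_nonneg_left (norm_le_pi_norm (Y.1 - Y'.1) j) hL0)
    · calc h * (α * (L * ‖Y.1 - Y'.1‖)) = h * (α * L) * ‖Y.1 - Y'.1‖ := by ring
        _ ≤ 1 / 2 * ‖Y.1 - Y'.1‖ := mul_le_mul_of_nonneg_right hsmall.1 (norm_nonneg _)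
        _ = _ := by simp
  obtain ⟨Y, -, hY, -⟩ := hcontr.exists_fixedPoint' (Metric.isClosed_closedBall.isComplete) hmaps
    (x := fun _ => v) (Metric.mem_closedBall_self zero_le_one) (edist_ne_top _ _)
  exact ⟨Y, fun i => (congrFun hY i).symm⟩

end Existence

end Generator

namespace Generator

open Set Asymptotics
open scoped ContDiff

/-! ### Errors of the extrapolated algebraic variable -/

section Extrapolation

variable {V : Type*} [NormedAddCommGroup V] [NormedSpace ℝ V]
  {s : ℕ} {γ : Fin s → ℝ} {f : V → V} {y : ℝ → V} {T ρ h₁ : ℝ}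

/-- The error of the derivative at the end of a step, extrapolated from the exact derivative at its
beginning and the derivatives at the stages. -/
def CollStep.extrapolationError (w : Fin s → ℝ) (c : CollStep γ f y T ρ h₁) : V :=
  ∑ i, w i • f (c.Y i) + (-1 : ℝ) ^ s • f (y c.a) - f (y (c.a + c.h))

lemma CollStep.extrapolationError_eq (w : Fin s → ℝ) (c : CollStep γ f y T ρ h₁) :
    c.extrapolationError w = ∑ i, w i • (f (c.Y i) - f (y (c.a + c.h * γ i))) -
      extrapolationDefect γ w f y c.h c.a := by
  simp only [extrapolationError, extrapolationDefect, smul_sub, Finset.sum_sub_distrib]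
  abel

variable {C₁ : ℝ} {K : ℝ}

/-- Stage errors and extrapolation defect are both O(h^(s+1)); the incoming error h^(2s) does not
spoil this, because 2s ≥ s + 1. -/
lemma exists_norm_extrapolationError_le [ProperSpace V] (hy : SolvesODE f T y)
    (hf : ContDiff ℝ ∞ f) (hs : 1 ≤ s) (hγ : IsGaussNodes γ) (hρ : ∀ t ∈ Icc 0 T, ‖y t‖ ≤ ρ)
    (hC₁ : 0 ≤ C₁)
    (hstage : ∀ c : CollStep γ f y T ρ h₁, ∀ i,
      ‖c.Y i - y (c.a + c.h * γ i)‖ ≤ C₁ * (‖c.v - y c.a‖ + c.h ^ (s + 1)))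
    {w : Fin s → ℝ} (hw : ∀ k < s + 1, (-1) ^ s * 0 ^ k + ∑ i, w i * γ i ^ k = 1) :
    ∃ C, ∀ c : CollStep γ f y T ρ h₁, ‖c.v - y c.a‖ ≤ K * c.h ^ (2 * s) →
      ‖c.extrapolationError w‖ ≤ C * c.h ^ (s + 1) := by
  have hnode : ∀ i, γ i ∈ Icc (0 : ℝ) 1 := fun i => Ioo_subset_Icc_self (hγ.mem_Ioo i)
  obtain ⟨L, hL0, hL⟩ := exists_lipschitz_closedBall hf ρ
  obtain ⟨D, hD⟩ := hy.exists_norm_extrapolationDefect_le hf hγ hw hf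
  refine ⟨∑ i, |w i| * (L * (C₁ * (|K| + 1))) + D, fun c hc => ?_⟩
  rw [c.extrapolationError_eq, add_mul, Finset.sum_mul]
  refine norm_sub_le_of_le (norm_sum_le_of_le _ fun i _ => ?_) (hD _ c.mem_stepDomain)
  rw [norm_smul, Real.norm_eq_abs, mul_assoc]
  refine mul_le_mul_of_nonneg_left ?_ (abs_nonneg _)
  have h1 : c.h ^ (2 * s) ≤ c.h ^ (s + 1) :=
    pow_le_pow_of_le_one c.h_mem.1.le c.h_mem.2 (by omega)
  have h2 : ‖c.v - y c.a‖ ≤ |K| * c.h ^ (s + 1) :=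
    hc.trans (mul_le_mul (le_abs_self _) h1 (pow_nonneg c.h_mem.1.le _) (abs_nonneg _))
  calc ‖f (c.Y i) - f (y (c.a + c.h * γ i))‖ ≤ L * ‖c.Y i - y (c.a + c.h * γ i)‖ :=
        hL _ _ (c.Y_le i) (hρ _ (c.time_mem (hnode i)))
    _ ≤ L * (C₁ * (|K| * c.h ^ (s + 1) + c.h ^ (s + 1))) := by
        gcongr
        exact (hstage c i).trans (by gcongr)
    _ = _ := by ring

/-- Two consecutive steps of the same size whose initial errors have size `h²ˢ`. -/
structure StepPair (γ : Fin s → ℝ) (f : V → V) (y : ℝ → V) (T ρ h₁ K : ℝ) where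
  (c c' : CollStep γ f y T ρ h₁)
  h_eq : c'.h = c.h
  a_eq : c'.a = c.a + c.h
  v_eq : c'.v = c.next
  err : ‖c.v - y c.a‖ ≤ K * c.h ^ (2 * s)
  err' : ‖c'.v - y c'.a‖ ≤ K * c.h ^ (2 * s)

/-- The leading error term varies smoothly in time, so consecutive steps differ by one further power
of h. This is the cancellation that odd s exploits. -/
lemma exists_norm_extrapolationError_sub_le [ProperSpace V] (hy : SolvesODE f T y)
    (hf : ContDiff ℝ ∞ f) (hs : 1 ≤ s) (hγ : IsGaussNodes γ) (hρ : ∀ t ∈ Icc 0 T, ‖y t‖ ≤ ρ)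
    (hstage : ∀ c : CollStep γ f y T ρ h₁, ∀ i,
      ‖c.Y i - y (c.a + c.h * γ i)‖ ≤ C₁ * (‖c.v - y c.a‖ + c.h ^ (s + 1)))
    {C₂ : ℝ} (hlocal : ∀ c : CollStep γ f y T ρ h₁,
      ‖(c.next - y (c.a + c.h)) - (c.v - y c.a)‖ ≤
        C₂ * (c.h * ‖c.v - y c.a‖ + c.h ^ (2 * s + 1)))
    {w : Fin s → ℝ} (hw : ∀ k < s + 1, (-1) ^ s * 0 ^ k + ∑ i, w i * γ i ^ k = 1) :
    ∃ C, ∀ p : StepPair γ f y T ρ h₁ K,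
      ‖p.c'.extrapolationError w - p.c.extrapolationError w‖ ≤ C * p.c.h ^ (s + 2) := by
  have hnode : ∀ i, γ i ∈ Icc (0 : ℝ) 1 := fun i => Ioo_subset_Icc_self (hγ.mem_Ioo i)
  set h : StepPair γ f y T ρ h₁ K → ℝ := fun p => p.c.h with hh
  have h_mem : ∀ p, h p ∈ Ioc (0 : ℝ) 1 := fun p => p.c.h_mem
  have hpow : ∀ {m n : ℕ}, n ≤ m → (fun p => h p ^ m) =O[⊤] fun p => h p ^ n := by
    intro m n hmn
    refine isBigO_top.mpr ⟨1, fun p => ?_⟩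
    have h0 := (h_mem p).1.le
    rw [Real.norm_of_nonneg (pow_nonneg h0 _), Real.norm_of_nonneg (pow_nonneg h0 _), one_mul]
    exact pow_le_pow_of_le_one h0 (h_mem p).2 hmn
  have of_le : ∀ {E : Type _} [NormedAddCommGroup E] {F : StepPair γ f y T ρ h₁ K → E} {m : ℕ},
      (∃ C, ∀ p, ‖F p‖ ≤ C * h p ^ m) → F =O[⊤] fun p => h p ^ m := by
    rintro E _ F m ⟨C, hC⟩
    refine isBigO_top.mpr ⟨C, fun p => ?_⟩
    rw [Real.norm_of_nonneg (pow_nonneg (h_mem p).1.le _)]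
    exact hC p
  have smul_h : ∀ {F : StepPair γ f y T ρ h₁ K → V} {m : ℕ}, F =O[⊤] (fun p => h p ^ m) →
      (fun p => h p • F p) =O[⊤] fun p => h p ^ (m + 1) := by
    intro F m hF
    refine ((isBigO_refl h ⊤).smul hF).congr_right fun p => ?_
    rw [smul_eq_mul, pow_succ']
  set Y : Fin s → StepPair γ f y T ρ h₁ K → V := fun i p => y (p.c.a + p.c.h * γ i) with hY
  set Y' : Fin s → StepPair γ f y T ρ h₁ K → V := fun i p => y (p.c.a + p.c.h + p.c.h * γ i)
    with hY'
  set η : Fin s → StepPair γ f y T ρ h₁ K → V := fun i p => p.c.Y i - Y i p with hη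
  set η' : Fin s → StepPair γ f y T ρ h₁ K → V := fun i p => p.c'.Y i - Y' i p with hη'
  have hYmem : ∀ i (p : StepPair γ f y T ρ h₁ K), p.c.a + p.c.h * γ i ∈ Icc 0 T := fun i p =>
    p.c.time_mem (hnode i)
  have hYmem' : ∀ i (p : StepPair γ f y T ρ h₁ K), p.c.a + p.c.h + p.c.h * γ i ∈ Icc 0 T := by
    intro i p
    have := p.c'.time_mem (hnode i)
    rwa [p.h_eq, p.a_eq] at this
  have hend : ∀ p : StepPair γ f y T ρ h₁ K, p.c.a + p.c.h + p.c.h ≤ T := by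
    intro p
    have := p.c'.le_T
    rwa [p.h_eq, p.a_eq] at this
  have err0 : (fun p : StepPair γ f y T ρ h₁ K => p.c.v - y p.c.a) =O[⊤] fun p => h p ^ (2 * s) :=
    of_le ⟨K, fun p => p.err⟩
  have errη : ∀ i, η i =O[⊤] fun p => h p ^ (s + 1) := by
    intro i
    have h1 : η i =O[⊤] fun p => ‖p.c.v - y p.c.a‖ + h p ^ (s + 1) := by
      refine isBigO_top.mpr ⟨C₁, fun p => ?_⟩
      rw [Real.norm_of_nonneg (add_nonneg (norm_nonneg _) (pow_nonneg (h_mem p).1.le _))]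
      exact hstage p.c i
    exact h1.trans ((err0.norm_left.trans (hpow (by omega))).add (isBigO_refl _ _))
  have errη' : ∀ i, η' i =O[⊤] fun p => h p ^ (s + 1) := by
    intro i
    have h1 : η' i =O[⊤] fun p => ‖p.c'.v - y p.c'.a‖ + h p ^ (s + 1) := by
      refine isBigO_top.mpr ⟨C₁, fun p => ?_⟩
      rw [Real.norm_of_nonneg (add_nonneg (norm_nonneg _) (pow_nonneg (h_mem p).1.le _))]
      have := hstage p.c' i
      rw [p.h_eq, p.a_eq] at this
      rw [p.a_eq]
      exact this
    have h2 : (fun p : StepPair γ f y T ρ h₁ K => p.c'.v - y p.c'.a) =O[⊤]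
        fun p => h p ^ (2 * s) := of_le ⟨K, fun p => p.err'⟩
    exact h1.trans ((h2.norm_left.trans (hpow (by omega))).add (isBigO_refl _ _))
  -- the errors of the derivatives at the stages
  obtain ⟨L, hL0, hL⟩ := exists_lipschitz_closedBall hf ρ
  set φ : Fin s → StepPair γ f y T ρ h₁ K → V := fun i p => f (p.c.Y i) - f (Y i p) with hφ
  set φ' : Fin s → StepPair γ f y T ρ h₁ K → V := fun i p => f (p.c'.Y i) - f (Y' i p) with hφ'
  have errφ : ∀ i, φ i =O[⊤] fun p => h p ^ (s + 1) := fun i =>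
    (isBigO_top.mpr ⟨L, fun p => hL _ _ (p.c.Y_le i) (hρ _ (hYmem i p))⟩ :
      φ i =O[⊤] η i).trans (errη i)
  have errφ' : ∀ i, φ' i =O[⊤] fun p => h p ^ (s + 1) := fun i =>
    (isBigO_top.mpr ⟨L, fun p => hL _ _ (p.c'.Y_le i) (hρ _ (hYmem' i p))⟩ :
      φ' i =O[⊤] η' i).trans (errη' i)
  obtain ⟨D, hD⟩ := hy.exists_norm_defect_sub_le hf hγ contDiff_id
  -- Subtracting the two stage equations leaves the local error O(h^(2s+1)), h times differences of
  -- size h^(s+1), and the variation of the defect.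
  have hdelta : ∀ i, (fun p => η' i p - η i p) =O[⊤] fun p => h p ^ (s + 2) := by
    intro i
    have e1 : (fun p : StepPair γ f y T ρ h₁ K =>
        (p.c.next - y (p.c.a + p.c.h)) - (p.c.v - y p.c.a)) =O[⊤] fun p => h p ^ (s + 2) := by
      have h1 : (fun p : StepPair γ f y T ρ h₁ K =>
          (p.c.next - y (p.c.a + p.c.h)) - (p.c.v - y p.c.a)) =O[⊤]
          fun p => h p * ‖p.c.v - y p.c.a‖ + h p ^ (2 * s + 1) := by
        refine isBigO_top.mpr ⟨C₂, fun p => ?_⟩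
        have h0 := (h_mem p).1.le
        rw [Real.norm_of_nonneg (by positivity)]
        exact hlocal p.c
      have h2 : (fun p : StepPair γ f y T ρ h₁ K => h p * ‖p.c.v - y p.c.a‖) =O[⊤]
          fun p => h p ^ (2 * s + 1) :=
        ((isBigO_refl h ⊤).mul err0.norm_left).congr_right fun p => by rw [pow_succ']
      exact h1.trans ((h2.add (isBigO_refl _ _)).trans (hpow (by omega)))
    have e2 : (fun p => h p • ∑ j, collA γ i j • (φ' j p - φ j p)) =O[⊤] fun p => h p ^ (s + 2) :=
      smul_h (IsBigO.fun_sum fun j _ => ((errφ' j).sub (errφ j)).const_smul_left (collA γ i j))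
    have e3 : (fun p : StepPair γ f y T ρ h₁ K => defect γ f id y p.c.h i (p.c.a + p.c.h) -
        defect γ f id y p.c.h i p.c.a) =O[⊤] fun p => h p ^ (s + 2) :=
      of_le ⟨D, fun p => hD i p.c.h p.c.h_mem p.c.a p.c.a_nonneg (hend p)⟩
    refine ((e1.add e2).sub e3).congr_left fun p => ?_
    have s1 := p.c.stage i
    have s2 := p.c'.stage i
    rw [p.h_eq, p.v_eq] at s2
    have s3 : η' i p = p.c.next + p.c.h • ∑ j, collA γ i j • f (p.c'.Y j) - Y' i p := by
      rw [← s2]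
    have s4 : η i p = p.c.v + p.c.h • ∑ j, collA γ i j • f (p.c.Y j) - Y i p := by
      rw [← s1]
    rw [s3, s4]
    simp only [hφ, hφ', hY, hY', hh, defect, lieDeriv_id, id, smul_sub, Finset.sum_sub_distrib]
    abel
  -- linearization
  obtain ⟨L₂, hL₂0, hL₂⟩ := exists_taylor_closedBall hf ρ
  obtain ⟨B, hB⟩ := hy.exists_norm_comp_le (hf.continuous_fderiv (by simp))
  obtain ⟨B', hB'⟩ := hy.exists_norm_comp_sub_le hf (hf.fderiv_right (m := ∞) (by simp))
  have sq_le : ∀ {F G : StepPair γ f y T ρ h₁ K → V}, G =O[⊤] (fun p => h p ^ (s + 1)) →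
      (∃ C, ∀ p, ‖F p‖ ≤ C * ‖G p‖ ^ 2) → F =O[⊤] fun p => h p ^ (s + 2) := by
    rintro F G hG ⟨C, hC⟩
    have h1 : F =O[⊤] fun p => ‖G p‖ ^ 2 :=
      isBigO_top.mpr ⟨C, fun p => by rw [Real.norm_of_nonneg (sq_nonneg _)]; exact hC p⟩
    refine h1.trans ((hG.norm_left.pow 2).trans ?_)
    simp only [← pow_mul]
    exact hpow (by omega)
  have hφdelta : ∀ i, (fun p => φ' i p - φ i p) =O[⊤] fun p => h p ^ (s + 2) := by
    intro i
    have r1 : (fun p => φ i p - fderiv ℝ f (Y i p) (η i p)) =O[⊤] fun p => h p ^ (s + 2) :=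
      sq_le (errη i) ⟨L₂, fun p => hL₂ _ _ (p.c.Y_le i) (hρ _ (hYmem i p))⟩
    have r2 : (fun p => φ' i p - fderiv ℝ f (Y' i p) (η' i p)) =O[⊤] fun p => h p ^ (s + 2) :=
      sq_le (errη' i) ⟨L₂, fun p => hL₂ _ _ (p.c'.Y_le i) (hρ _ (hYmem' i p))⟩
    have r3 : (fun p => (fderiv ℝ f (Y' i p) - fderiv ℝ f (Y i p)) (η' i p)) =O[⊤]
        fun p => h p ^ (s + 2) := by
      have h1 : (fun p => (fderiv ℝ f (Y' i p) - fderiv ℝ f (Y i p)) (η' i p)) =O[⊤]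
          fun p => h p • η' i p := by
        refine isBigO_top.mpr ⟨B', fun p => ?_⟩
        rw [norm_smul, ← mul_assoc]
        refine ContinuousLinearMap.le_of_opNorm_le _ ?_ _
        refine (hB' _ (hYmem i p) _ (hYmem' i p)).trans_eq ?_
        rw [show p.c.a + p.c.h + p.c.h * γ i - (p.c.a + p.c.h * γ i) = h p by simp only [hh]; ring]
      exact h1.trans (smul_h (errη' i))
    have r4 : (fun p => fderiv ℝ f (Y i p) (η' i p - η i p)) =O[⊤] fun p => h p ^ (s + 2) := by
      have h1 : (fun p => fderiv ℝ f (Y i p) (η' i p - η i p)) =O[⊤] fun p => η' i p - η i p :=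
        isBigO_top.mpr ⟨B, fun p => ContinuousLinearMap.le_of_opNorm_le _ (hB _ (hYmem i p)) _⟩
      exact h1.trans (hdelta i)
    -- The difference splits into two quadratic remainders, the drift of the Jacobian over time h,
    -- and the Jacobian applied to the change of the stage error.
    refine (((r2.sub r1).add r3).add r4).congr_left fun p => ?_
    simp only [sub_apply, map_sub]
    abel
  obtain ⟨D', hD'⟩ := hy.exists_norm_extrapolationDefect_sub_le hf hγ hw hf
  have hdef : (fun p : StepPair γ f y T ρ h₁ K =>
      extrapolationDefect γ w f y p.c.h (p.c.a + p.c.h) -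
        extrapolationDefect γ w f y p.c.h p.c.a) =O[⊤] fun p => h p ^ (s + 2) :=
    of_le ⟨D', fun p => hD' p.c.h p.c.h_mem p.c.a p.c.a_nonneg (hend p)⟩
  have hfin : (fun p : StepPair γ f y T ρ h₁ K =>
      p.c'.extrapolationError w - p.c.extrapolationError w) =O[⊤] fun p => h p ^ (s + 2) := by
    refine ((IsBigO.fun_sum (s := Finset.univ)
      fun i _ => (hφdelta i).const_smul_left (w i)).sub hdef).congr_left fun p => ?_
    rw [CollStep.extrapolationError_eq, CollStep.extrapolationError_eq, p.h_eq, p.a_eq]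
    simp only [Pi.smul_apply, smul_sub, Finset.sum_sub_distrib, hφ, hφ', hY, hY']
    abel
  obtain ⟨C, hC⟩ := isBigO_top.mp hfin
  refine ⟨C, fun p => (hC p).trans_eq ?_⟩
  rw [Real.norm_of_nonneg (pow_nonneg (h_mem p).1.le _)]

end Extrapolation

end Generator

/-! ### Global error: discrete Gronwall and alternating sums -/

namespace Generator

open Set
open scoped ContDiff

/-- The recursion is required only where the bound already holds: the local estimate applies only to
steps that start close to the solution. -/
lemma le_mul_exp_of_le_of_succ_le {u : ℕ → ℝ} {α β : ℝ} (hα : 0 ≤ α) (hβ : 0 ≤ β) {n : ℕ}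
    (h0 : u 0 ≤ 0) (hu : ∀ m < n, u m ≤ β * m * Real.exp (α * m) →
      u (m + 1) ≤ (1 + α) * u m + β) {m : ℕ} (hm : m ≤ n) : u m ≤ β * m * Real.exp (α * m) := by
  induction m with
  | zero => simpa using h0
  | succ m ih =>
    have ih' := ih (by omega)
    have h1 := hu m (by omega) ih'
    have h2 : 1 + α ≤ Real.exp α := by linarith [Real.add_one_le_exp α]
    have h3 : Real.exp (α * (m + 1 : ℕ)) = Real.exp α * Real.exp (α * m) := by
      rw [← Real.exp_add]
      congr 1
      push_cast
      ring
    have h4 : 1 ≤ Real.exp (α * (m + 1 : ℕ)) := Real.one_le_exp (by positivity)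
    calc u (m + 1) ≤ (1 + α) * u m + β := h1
      _ ≤ (1 + α) * (β * m * Real.exp (α * m)) + β := by gcongr
      _ ≤ Real.exp α * (β * m * Real.exp (α * m)) + β := by gcongr
      _ = β * m * Real.exp (α * (m + 1 : ℕ)) + β * 1 := by rw [h3]; ring
      _ ≤ β * m * Real.exp (α * (m + 1 : ℕ)) + β * Real.exp (α * (m + 1 : ℕ)) := by gcongr
      _ = _ := by push_cast; ring

/-- Over two steps the sign returns and only d_{m+1} - d_m is added. -/
lemma norm_le_of_alternating {E : Type*} [NormedAddCommGroup E] {ζ d : ℕ → E} {n : ℕ} {δ ε : ℝ}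
    (hδ : 0 ≤ δ) (hε : 0 ≤ ε) (h0 : ζ 0 = 0) (hζ : ∀ m < n, ζ (m + 1) = -ζ m + d m)
    (hd : ∀ m < n, ‖d m‖ ≤ δ) (hdd : ∀ m, m + 1 < n → ‖d (m + 1) - d m‖ ≤ ε) (m : ℕ)
    (hm : m ≤ n) : ‖ζ m‖ ≤ δ + m * ε := by
  induction m using Nat.strong_induction_on with
  | _ m ih =>
    match m with
    | 0 => simpa [h0] using hδ
    | 1 =>
      rw [hζ 0 (by omega), h0, neg_zero, zero_add]
      have := hd 0 (by omega)
      simp only [Nat.cast_one, one_mul]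
      linarith
    | m + 2 =>
      have h1 : ζ (m + 2) = ζ m + (d (m + 1) - d m) := by
        rw [hζ (m + 1) (by omega), hζ m (by omega)]
        abel
      rw [h1]
      refine (norm_add_le_of_le (ih m (by omega) (by omega)) (hdd m (by omega))).trans ?_
      push_cast
      linarith

section Global

variable {V : Type*} [NormedAddCommGroup V] [NormedSpace ℝ V] [FiniteDimensional ℝ V]
  {Z : Type*} [NormedAddCommGroup Z] [NormedSpace ℝ Z]
  {s : ℕ} {γ : Fin s → ℝ} {f : V → V} {y : ℝ → V} {T : ℝ}

/-- Data of `n` steps of the collocation method for `y' = f(y)`, `z = P f(y)`. -/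
structure IsCollSequence (γ w : Fin s → ℝ) (f : V → V) (P : V →L[ℝ] Z) (h : ℝ) (n : ℕ)
    (v : ℕ → V) (Y : ℕ → Fin s → V) (z : ℕ → Z) : Prop where
  stage : ∀ m < n, ∀ i, Y m i = v m + h • ∑ j, collA γ i j • f (Y m j)
  next : ∀ m < n, v (m + 1) = v m + h • ∑ j, collB γ j • f (Y m j)
  extrapolate : ∀ m < n, z (m + 1) = (-1 : ℝ) ^ s • z m + ∑ i, w i • P (f (Y m i))

/-- Global error of the Gauss method applied to a semi-explicit differential-algebraic equation of
index one. -/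
theorem exists_global_error_le (hy : SolvesODE f T y) (hf : ContDiff ℝ ∞ f) (hT : 0 ≤ T)
    (hs : 1 ≤ s) (hγ : IsGaussNodes γ) {w : Fin s → ℝ}
    (hw : ∀ k < s + 1, (-1) ^ s * 0 ^ k + ∑ i, w i * γ i ^ k = 1) (P : V →L[ℝ] Z)
    (hap : ∀ ρ, ∃ h₁ > 0, ∃ ρ', ∀ h : ℝ, 0 < h → h ≤ h₁ → ∀ (v : V) (Y : Fin s → V), ‖v‖ ≤ ρ →
      (∀ i, Y i = v + h • ∑ j, collA γ i j • f (Y j)) → ∀ i, ‖Y i‖ ≤ ρ') :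
    ∃ h₀ > 0, h₀ ≤ 1 ∧ ∃ C, 0 ≤ C ∧ ∀ h : ℝ, 0 < h → h ≤ h₀ → ∀ n : ℕ, n * h ≤ T →
      ∀ v Y z, IsCollSequence γ w f P h n v Y z → v 0 = y 0 → z 0 = P (f (y 0)) →
        ‖v n - y (n * h)‖ ≤ C * h ^ (2 * s) ∧
        (Even s → ‖z n - P (f (y (n * h)))‖ ≤ C * h ^ s) ∧
        (Odd s → ‖z n - P (f (y (n * h)))‖ ≤ C * h ^ (s + 1)) := by
  have : ProperSpace V := FiniteDimensional.proper_real V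
  obtain ⟨ρ₀, hρ₀⟩ := hy.exists_norm_comp_le (φ := id) continuous_id
  -- The margin 1 covers every start whose error is at most h^s ≤ 1; all stages then lie in one
  -- fixed ball, whichever solution of the stage equations is taken.
  obtain ⟨hₐ, hₐ0, ρ₁, hρ₁⟩ := hap (ρ₀ + 1)
  set ρ := max ρ₀ ρ₁ with hρ_def
  have hρ : ∀ t ∈ Icc 0 T, ‖y t‖ ≤ ρ := fun t ht => (hρ₀ t ht).trans (le_max_left _ _)
  obtain ⟨h₁, h₁0, C₁, hC₁, hstage⟩ := exists_stage_error_le hy hf hγ hρ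
  obtain ⟨C₂, hC₂, hlocal⟩ := exists_local_error_le hy hf hs hγ hρ hC₁ hstage
  -- The Gronwall constant for α = C₂h and β = C₂h^(2s+1), with the number of steps bounded by T /
  -- h.
  set K := C₂ * T * Real.exp (C₂ * T) with hK
  have hK0 : 0 ≤ K := by positivity
  obtain ⟨C₃, hC₃⟩ := exists_norm_extrapolationError_le (K := K) hy hf hs hγ hρ hC₁ hstage hw
  obtain ⟨C₄, hC₄⟩ :=
    exists_norm_extrapolationError_sub_le (K := K) hy hf hs hγ hρ hstage hlocal hw
  -- The bound 1 / (K + 1) forces K h^(2s) ≤ h^s, so the global bound re-establishes the entry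
  -- condition of the next step.
  refine ⟨min (min hₐ h₁) (1 / (K + 1)), by positivity, ?_,
    max K (‖P‖ * |C₃| + T * (‖P‖ * |C₃|) + T * (‖P‖ * |C₄|)), le_max_of_le_left hK0, ?_⟩
  · refine (min_le_right _ _).trans ?_
    rw [div_le_one (by positivity)]
    linarith
  intro h hh hle n hn v Y z hseq hv0 hz0
  have hle_a : h ≤ hₐ := hle.trans ((min_le_left _ _).trans (min_le_left _ _))
  have hle_1 : h ≤ h₁ := hle.trans ((min_le_left _ _).trans (min_le_right _ _))
  have hleK : h ≤ 1 / (K + 1) := hle.trans (min_le_right _ _)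
  have hle1 : h ≤ 1 := hleK.trans (by rw [div_le_one (by positivity)]; linarith)
  have hKs : K * h ^ (2 * s) ≤ h ^ s := by
    have h1 : h ^ s ≤ h := pow_le_of_le_one hh.le hle1 (by omega)
    have h2 : K * h ≤ 1 := by
      rw [le_div_iff₀ (by positivity)] at hleK
      linarith
    calc K * h ^ (2 * s) = (K * h ^ s) * h ^ s := by ring
      _ ≤ (K * h) * h ^ s := by gcongr
      _ ≤ 1 * h ^ s := by gcongr
      _ = h ^ s := one_mul _
  have htime : ∀ m, m ≤ n → (m : ℝ) * h ≤ T := fun m hm =>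
    (mul_le_mul_of_nonneg_right (by exact_mod_cast hm) hh.le).trans hn
  have hbig : ∀ m, m ≤ n → C₂ * h ^ (2 * s + 1) * m * Real.exp (C₂ * h * m) ≤ K * h ^ (2 * s) := by
    intro m hm
    have h1 := htime m hm
    have h2 : C₂ * h * m ≤ C₂ * T := by
      calc C₂ * h * m = C₂ * (m * h) := by ring
        _ ≤ C₂ * T := by gcongr
    calc C₂ * h ^ (2 * s + 1) * m * Real.exp (C₂ * h * m)
        = C₂ * (m * h) * Real.exp (C₂ * h * m) * h ^ (2 * s) := by ring
      _ ≤ C₂ * T * Real.exp (C₂ * T) * h ^ (2 * s) := by gcongr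
      _ = _ := rfl
  have hstep : ∀ m < n, ‖v m - y (m * h)‖ ≤ K * h ^ (2 * s) →
      ∃ c : CollStep γ f y T ρ h₁, c.h = h ∧ c.a = m * h ∧ c.v = v m ∧ c.Y = Y m := by
    intro m hm herr
    have hs1 : h ^ s ≤ 1 := pow_le_one₀ hh.le hle1
    have hT' := htime (m + 1) hm
    push_cast at hT'
    have hmem : (m : ℝ) * h ∈ Icc 0 T := ⟨by positivity, htime m hm.le⟩
    have hvm : ‖v m‖ ≤ ρ₀ + 1 := by
      calc ‖v m‖ = ‖y (m * h) + (v m - y (m * h))‖ := by rw [add_sub_cancel]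
        _ ≤ ρ₀ + 1 := norm_add_le_of_le (hρ₀ _ hmem) (herr.trans (hKs.trans hs1))
    exact ⟨⟨h, m * h, v m, Y m, ⟨hh, hle1⟩, hle_1, hmem.1, by linarith, herr.trans hKs,
      fun i => (hρ₁ h hh hle_a _ _ hvm (hseq.stage m hm) i).trans (le_max_right _ _),
      hseq.stage m hm⟩, rfl, rfl, rfl, rfl⟩
  have hcast : ∀ m : ℕ, ((m + 1 : ℕ) : ℝ) * h = m * h + h := by
    intro m
    push_cast
    ring
  have herr : ∀ m, m ≤ n → ‖v m - y (m * h)‖ ≤ K * h ^ (2 * s) := by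
    intro m hm
    refine (le_mul_exp_of_le_of_succ_le (u := fun m => ‖v m - y (m * h)‖) (α := C₂ * h)
      (β := C₂ * h ^ (2 * s + 1)) (n := n) (by positivity) (by positivity) (by simp [hv0])
      (fun m hm hum => ?_) hm).trans (hbig m hm)
    obtain ⟨c, hch, hca, hcv, hcY⟩ := hstep m hm (hum.trans (hbig m hm.le))
    have h1 := hlocal c
    have h2 : c.next = v (m + 1) := by
      rw [hseq.next m hm, CollStep.next, hcv, hch, hcY]
    rw [h2, hca, hch, hcv, ← hcast] at h1
    calc ‖v (m + 1) - y ((m + 1 : ℕ) * h)‖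
        = ‖(v m - y (m * h)) + ((v (m + 1) - y ((m + 1 : ℕ) * h)) - (v m - y (m * h)))‖ := by
          rw [add_sub_cancel]
      _ ≤ ‖v m - y (m * h)‖ + C₂ * (h * ‖v m - y (m * h)‖ + h ^ (2 * s + 1)) :=
          norm_add_le_of_le le_rfl h1
      _ = _ := by ring
  have hC : ∀ m < n, ∃ c : CollStep γ f y T ρ h₁,
      c.h = h ∧ c.a = m * h ∧ c.v = v m ∧ c.Y = Y m := fun m hm => hstep m hm (herr m hm.le)
  set d : ℕ → V := fun m => ∑ i, w i • f (Y m i) + (-1 : ℝ) ^ s • f (y (m * h)) -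
    f (y ((m + 1 : ℕ) * h)) with hd
  have hdc : ∀ (m : ℕ) (c : CollStep γ f y T ρ h₁), c.h = h → c.a = m * h → c.Y = Y m →
      c.extrapolationError w = d m := by
    intro m c hch hca hcY
    rw [CollStep.extrapolationError, hcY, hca, hch, ← hcast]
  have hd1 : ∀ m < n, ‖P (d m)‖ ≤ ‖P‖ * |C₃| * h ^ (s + 1) := by
    intro m hm
    obtain ⟨c, hch, hca, hcv, hcY⟩ := hC m hm
    have h1 := hC₃ c (by rw [hcv, hca, hch]; exact herr m hm.le)
    rw [hdc m c hch hca hcY, hch] at h1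
    rw [mul_assoc]
    exact P.le_opNorm_of_le (h1.trans (mul_le_mul_of_nonneg_right (le_abs_self _) (by positivity)))
  have hd2 : ∀ m, m + 1 < n → ‖P (d (m + 1)) - P (d m)‖ ≤ ‖P‖ * |C₄| * h ^ (s + 2) := by
    intro m hm
    obtain ⟨c, hch, hca, hcv, hcY⟩ := hC m (by omega)
    obtain ⟨c', hch', hca', hcv', hcY'⟩ := hC (m + 1) hm
    have h1 := hC₄ ⟨c, c', by rw [hch', hch], by rw [hca', hca, hch, hcast],
      by rw [hcv', hseq.next m (by omega), CollStep.next, hcv, hch, hcY],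
      by rw [hcv, hca, hch]; exact herr m (by omega),
      by rw [hcv', hca', hch]; exact herr (m + 1) hm.le⟩
    dsimp only at h1
    rw [hdc m c hch hca hcY, hdc (m + 1) c' hch' hca' hcY', hch] at h1
    rw [mul_assoc, ← map_sub]
    exact P.le_opNorm_of_le (h1.trans (mul_le_mul_of_nonneg_right (le_abs_self _) (by positivity)))
  set ζ : ℕ → Z := fun m => z m - P (f (y (m * h))) with hζ
  have hζ0 : ζ 0 = 0 := by simp [hζ, hz0]
  have hζs : ∀ m < n, ζ (m + 1) = (-1 : ℝ) ^ s • ζ m + P (d m) := by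
    intro m hm
    simp only [hζ, hd, hseq.extrapolate m hm, map_sub, map_add, map_sum, map_smul, smul_sub]
    abel
  have hpow1 : (n : ℝ) * h ^ (s + 1) ≤ T * h ^ s := by
    calc (n : ℝ) * h ^ (s + 1) = n * h * h ^ s := by ring
      _ ≤ _ := by gcongr
  have hpow2 : (n : ℝ) * h ^ (s + 2) ≤ T * h ^ (s + 1) := by
    calc (n : ℝ) * h ^ (s + 2) = n * h * h ^ (s + 1) := by ring
      _ ≤ _ := by gcongr
  set q₃ := ‖P‖ * |C₃| with hq₃
  set q₄ := ‖P‖ * |C₄| with hq₄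
  have hq₃0 : 0 ≤ q₃ := by positivity
  have hq₄0 : 0 ≤ q₄ := by positivity
  refine ⟨(herr n le_rfl).trans (mul_le_mul_of_nonneg_right (le_max_left _ _) (by positivity)),
    fun heven => ?_, fun hodd => ?_⟩
  -- Without a change of sign the contributions accumulate, and n ≤ T / h costs one power of h.
  · have hmain : ∀ m, m ≤ n → ‖ζ m‖ ≤ m * (q₃ * h ^ (s + 1)) := by
      intro m hm
      induction m with
      | zero => simp [hζ0]
      | succ m ih =>
        rw [hζs m (by omega), heven.neg_one_pow, one_smul]
        refine (norm_add_le_of_le (ih (by omega)) (hd1 m (by omega))).trans_eq ?_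
        push_cast
        ring
    calc ‖ζ n‖ ≤ n * (q₃ * h ^ (s + 1)) := hmain n le_rfl
      _ = q₃ * (n * h ^ (s + 1)) := by ring
      _ ≤ q₃ * (T * h ^ s) := by gcongr
      _ = T * q₃ * h ^ s := by ring
      _ ≤ _ := by
        refine mul_le_mul_of_nonneg_right (le_max_of_le_right ?_) (by positivity)
        have : 0 ≤ T * q₄ := by positivity
        linarith
  · have hmain := norm_le_of_alternating (ζ := ζ) (d := fun m => P (d m)) (n := n)
      (δ := q₃ * h ^ (s + 1)) (ε := q₄ * h ^ (s + 2)) (by positivity) (by positivity) hζ0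
      (fun m hm => by rw [hζs m hm, hodd.neg_one_pow, neg_one_smul]) hd1 hd2 n le_rfl
    calc ‖ζ n‖ ≤ q₃ * h ^ (s + 1) + n * (q₄ * h ^ (s + 2)) := hmain
      _ = q₃ * h ^ (s + 1) + q₄ * (n * h ^ (s + 2)) := by ring
      _ ≤ q₃ * h ^ (s + 1) + q₄ * (T * h ^ (s + 1)) := by gcongr
      _ = (q₃ + T * q₄) * h ^ (s + 1) := by ring
      _ ≤ _ := by
        refine mul_le_mul_of_nonneg_right (le_max_of_le_right ?_) (by positivity)
        have : 0 ≤ T * q₃ := by positivity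
        linarith

end Global

end Generator

namespace Generator

open Set
open scoped ContDiff

/-! ### Block form of the descriptor system -/

section Blocks

variable (p : Params) (E : Matrix (Fin 6) (Fin 6) ℝ)

lemma col_inj {a a' b b' : Fin 4 → ℝ} {c c' d d' : Fin 6 → ℝ} {e e' : ℝ} :
    col a b c d e = col a' b' c' d' e' ↔ a = a' ∧ b = b' ∧ c = c' ∧ d = d' ∧ e = e' := by
  constructor
  · intro h
    refine ⟨funext fun i => congrFun h (.inl (.inl i)), funext fun i => congrFun h (.inl (.inr i)),
      funext fun i => congrFun h (.inr (.inl (.inl i))),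
      funext fun i => congrFun h (.inr (.inl (.inr i))), congrFun h (.inr (.inr ()))⟩
  · rintro ⟨rfl, rfl, rfl, rfl, rfl⟩
    rfl

lemma col_blocks (x : State) : col x.dPsi x.Psi x.dTheta x.Theta x.time = x := by
  funext i
  rcases i with (i | i) | ((i | i) | i) <;> rfl

lemma mM_mulVec (a b : Fin 4 → ℝ) (c d : Fin 6 → ℝ) (e : ℝ) :
    mM p E *ᵥ col a b c d e = col 0 (p.KL *ᵥ b) (p.J *ᵥ c) (E *ᵥ d) e := by
  simp only [mM, col, Matrix.fromBlocks_mulVec, Sum.elim_comp_inl, Sum.elim_comp_inr,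
    Matrix.zero_mulVec, zero_add, add_zero, Matrix.one_mulVec]

lemma mP_sub_mQ_mulVec (a b : Fin 4 → ℝ) (c d : Fin 6 → ℝ) (e : ℝ) :
    (mP p E - mQ p) *ᵥ col a b c d e =
      col (-(p.KR *ᵥ a) - p.KL *ᵥ b) (p.KL *ᵥ a) (-(p.D *ᵥ c) - E *ᵥ d) (E *ᵥ c) 0 := by
  rw [Matrix.sub_mulVec]
  simp only [mP, mQ, col, Matrix.fromBlocks_mulVec, Sum.elim_comp_inl, Sum.elim_comp_inr,
    Matrix.zero_mulVec, zero_add, add_zero, Matrix.neg_mulVec]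
  funext i
  rcases i with (i | i) | ((i | i) | i) <;> simp <;> ring

lemma mN_sub_mV_mulVec (a b : Fin 4 → ℝ) (c d : Fin 6 → ℝ) (e : ℝ) :
    (mN - mV) *ᵥ col a b c d e = col a 0 c 0 e := by
  simp only [mN, mV, sub_zero, col, Matrix.fromBlocks_mulVec, Sum.elim_comp_inl,
    Sum.elim_comp_inr, Matrix.zero_mulVec, zero_add, add_zero, Matrix.one_mulVec]

variable {p E}

lemma Params.Admissible.isUnit_det_KL (hp : p.Admissible) : IsUnit p.KL.det := by
  rw [isUnit_iff_ne_zero, Params.KL, Matrix.det_smul, Matrix.det_diagonal]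
  simp [Fin.prod_univ_succ, hp.Δ_ne, hp.Lr_ne, hp.sum_ne, -neg_add_rev]

lemma Params.Admissible.isUnit_det_KR (hp : p.Admissible) : IsUnit p.KR.det := by
  rw [isUnit_iff_ne_zero, Params.KR, Matrix.det_diagonal]
  simp [Fin.prod_univ_succ, hp.R_ne, hp.Rf_ne, hp.Rq_ne]

lemma Params.Admissible.isUnit_det_J (hp : p.Admissible) : IsUnit p.J.det := by
  rw [isUnit_iff_ne_zero, Params.J, Matrix.det_diagonal]
  exact Finset.prod_ne_zero_iff.mpr fun i _ => hp.inertia_ne i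

/-- The entries `p.KL` and `E` of the structure matrix cancel the inverses in the effort. -/
lemma rhs_eq (hp : p.Admissible) (hE : IsUnit E.det) (x : State) :
    rhs p E x = col (p.Is x.time - p.KR *ᵥ x.dPsi - (p.KL + p.Γ (x.Theta 4)) *ᵥ x.Psi)
      (p.KL *ᵥ x.dPsi)
      (p.T - p.D *ᵥ x.dTheta - (p.K *ᵥ x.Theta + (1 / 2 : ℝ) • p.torqueForm x.Psi x.Theta))
      (E *ᵥ x.dTheta) 1 := by
  rw [rhs, z, u, mP_sub_mQ_mulVec, mN_sub_mV_mulVec, Matrix.mulVec_mulVec _ p.KL,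
    Matrix.mul_nonsing_inv _ hp.isUnit_det_KL, Matrix.one_mulVec, Matrix.mulVec_mulVec _ E,
    Matrix.mul_nonsing_inv _ hE, Matrix.one_mulVec]
  funext i
  rcases i with (i | i) | ((i | i) | i) <;> simp [col] <;> ring

end Blocks

/-! ### Reduction to an ordinary differential equation -/

section Reduction

/-- The differential variables `(Ψ, dθ/dt, θ, t)`. -/
abbrev Reduced : Type := (Fin 4 → ℝ) × (Fin 6 → ℝ) × (Fin 6 → ℝ) × ℝ

/-- The differential variables of a state. -/
def reduce : State →ₗ[ℝ] Reduced where
  toFun x := (x.Psi, x.dTheta, x.Theta, x.time)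
  map_add' _ _ := rfl
  map_smul' _ _ := rfl

/-- The algebraic variables `dΨ/dt` of a state. -/
def algebraicPart : State →ₗ[ℝ] (Fin 4 → ℝ) where
  toFun x := x.dPsi
  map_add' _ _ := rfl
  map_smul' _ _ := rfl

/-- The vector field of the underlying ordinary differential equation. -/
def field (p : Params) (v : Reduced) : Reduced :=
  (p.KR⁻¹ *ᵥ (p.Is v.2.2.2 - (p.KL + p.Γ (v.2.2.1 4)) *ᵥ v.1),
    p.J⁻¹ *ᵥ (p.T - p.D *ᵥ v.2.1 -
      (p.K *ᵥ v.2.2.1 + (1 / 2 : ℝ) • p.torqueForm v.1 v.2.2.1)),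
    v.2.1, 1)

variable {p : Params} {E : Matrix (Fin 6) (Fin 6) ℝ}

lemma mulVec_eq_iff_of_isUnit {n : ℕ} {A : Matrix (Fin n) (Fin n) ℝ} (hA : IsUnit A.det)
    (x b : Fin n → ℝ) : A *ᵥ x = b ↔ x = A⁻¹ *ᵥ b := by
  constructor
  · rintro rfl
    rw [Matrix.mulVec_mulVec, Matrix.nonsing_inv_mul _ hA, Matrix.one_mulVec]
  · rintro rfl
    rw [Matrix.mulVec_mulVec, Matrix.mul_nonsing_inv _ hA, Matrix.one_mulVec]

lemma algebraic_iff (hp : p.Admissible) (x : State) :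
    p.KR *ᵥ x.dPsi + (p.KL + p.Γ (x.Theta 4)) *ᵥ x.Psi = p.Is x.time ↔
      algebraicPart x = (field p (reduce x)).1 := by
  rw [← eq_sub_iff_add_eq, mulVec_eq_iff_of_isUnit hp.isUnit_det_KR]
  rfl

lemma mM_mulVec_eq_rhs_iff (hp : p.Admissible) (hE : IsUnit E.det) (k x : State) :
    mM p E *ᵥ k = rhs p E x ↔
      algebraicPart x = (field p (reduce x)).1 ∧ reduce k = field p (reduce x) := by
  rw [rhs_eq hp hE]
  conv_lhs => rw [← col_blocks k]
  rw [mM_mulVec, col_inj, ← algebraic_iff hp, mulVec_eq_iff_of_isUnit hp.isUnit_det_J,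
    mulVec_eq_iff_of_isUnit hp.isUnit_det_KL, mulVec_eq_iff_of_isUnit hE,
    Matrix.mulVec_mulVec, Matrix.mulVec_mulVec, Matrix.nonsing_inv_mul _ hp.isUnit_det_KL,
    Matrix.nonsing_inv_mul _ hE, Matrix.one_mulVec, Matrix.one_mulVec]
  have halg : (0 = p.Is x.time - p.KR *ᵥ x.dPsi - (p.KL + p.Γ (x.Theta 4)) *ᵥ x.Psi) ↔
      p.KR *ᵥ x.dPsi + (p.KL + p.Γ (x.Theta 4)) *ᵥ x.Psi = p.Is x.time := by
    rw [eq_comm, sub_sub, sub_eq_zero, eq_comm]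
  rw [halg]
  -- The second block only equates the Ψ-part of k with dΨ/dt; the algebraic equation then
  -- identifies it with the first component of the vector field.
  refine and_congr_right fun h => ?_
  have h1 : x.dPsi = (field p (reduce x)).1 := (algebraic_iff hp x).mp h
  rw [Prod.ext_iff, Prod.ext_iff, Prod.ext_iff, ← h1]
  exact Iff.rfl

end Reduction

/-! ### Smoothness of the vector field -/

section Smooth

variable (p : Params)

lemma contDiff_mulVec {X : Type*} [NormedAddCommGroup X] [NormedSpace ℝ X] {m n : ℕ}
    {A : X → Matrix (Fin m) (Fin n) ℝ} {g : X → Fin n → ℝ}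
    (hA : ∀ i j, ContDiff ℝ ∞ fun x => A x i j) (hg : ContDiff ℝ ∞ g) :
    ContDiff ℝ ∞ fun x => A x *ᵥ g x := by
  refine contDiff_pi.mpr fun i => ?_
  simp only [Matrix.mulVec, dotProduct]
  exact ContDiff.sum fun j _ => (hA i j).mul (contDiff_pi.mp hg j)

lemma contDiff_Γ (i j : Fin 4) : ContDiff ℝ ∞ fun φ => p.Γ φ i j := by
  fin_cases i <;> fin_cases j <;> simp [Params.Γ] <;> fun_prop

lemma contDiff_dΓ (i j : Fin 4) : ContDiff ℝ ∞ fun φ => p.dΓ φ i j :=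
  (contDiff_infty_iff_deriv.mp (contDiff_Γ p i j)).2

lemma contDiff_Is : ContDiff ℝ ∞ p.Is := by
  refine contDiff_pi.mpr fun i => ?_
  fin_cases i <;> simp [Params.Is] <;> fun_prop

lemma contDiff_field : ContDiff ℝ ∞ (field p) := by
  have hθ : ContDiff ℝ ∞ fun v : Reduced => v.2.2.1 4 := by fun_prop
  refine ContDiff.prodMk ?_ (ContDiff.prodMk ?_ (ContDiff.prodMk ?_ contDiff_const))
  · refine contDiff_mulVec (fun _ _ => contDiff_const) (ContDiff.sub ?_ ?_)
    · exact (contDiff_Is p).comp (by fun_prop)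
    · refine contDiff_mulVec (fun i j => ?_) contDiff_fst
      simp only [Matrix.add_apply]
      exact contDiff_const.add ((contDiff_Γ p i j).comp hθ)
  · refine contDiff_mulVec (fun _ _ => contDiff_const) (ContDiff.sub (ContDiff.sub contDiff_const
      (contDiff_mulVec (fun _ _ => contDiff_const) (by fun_prop))) (ContDiff.add
      (contDiff_mulVec (fun _ _ => contDiff_const) (by fun_prop)) (ContDiff.const_smul _ ?_)))
    refine contDiff_pi.mpr fun i => ?_
    have hform : ContDiff ℝ ∞ fun v : Reduced => v.1 ⬝ᵥ (p.dΓ (v.2.2.1 4) *ᵥ v.1) := by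
      have h1 : ContDiff ℝ ∞ fun v : Reduced => p.dΓ (v.2.2.1 4) *ᵥ v.1 :=
        contDiff_mulVec (fun i j => (contDiff_dΓ p i j).comp hθ) contDiff_fst
      simp only [dotProduct]
      exact ContDiff.sum fun j _ => ContDiff.mul (by fun_prop) (contDiff_pi.mp h1 j)
    fin_cases i <;> simp only [Params.torqueForm] <;> first | exact hform | exact contDiff_const
  · fun_prop

end Smooth

/-! ### Growth of the vector field -/

section Growth

variable (p : Params)

lemma norm_mulVec_le {m n : ℕ} {A : Matrix (Fin m) (Fin n) ℝ} {C : ℝ} (hC : 0 ≤ C)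
    (hA : ∀ i j, |A i j| ≤ C) (x : Fin n → ℝ) : ‖A *ᵥ x‖ ≤ n * C * ‖x‖ := by
  rw [pi_norm_le_iff_of_nonneg (by positivity)]
  intro i
  calc ‖(A *ᵥ x) i‖ = ‖∑ j, A i j * x j‖ := rfl
    _ ≤ ∑ _j : Fin n, C * ‖x‖ := by
        refine norm_sum_le_of_le _ fun j _ => ?_
        rw [norm_mul]
        exact mul_le_mul (hA i j) (norm_le_pi_norm x j) (norm_nonneg _) hC
    _ = n * C * ‖x‖ := by simp [mul_assoc]

lemma exists_norm_mulVec_le {m n : ℕ} (A : Matrix (Fin m) (Fin n) ℝ) :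
    ∃ C, 0 ≤ C ∧ ∀ x, ‖A *ᵥ x‖ ≤ C * ‖x‖ := by
  set C := ∑ i, ∑ j, |A i j| with hC
  have hC0 : 0 ≤ C := Finset.sum_nonneg fun i _ => Finset.sum_nonneg fun j _ => abs_nonneg _
  refine ⟨n * C, by positivity, norm_mulVec_le hC0 fun i j => ?_⟩
  exact (Finset.single_le_sum (f := fun j => |A i j|) (fun j _ => abs_nonneg _)
    (Finset.mem_univ j)).trans (Finset.single_le_sum (f := fun i => ∑ j, |A i j|)
      (fun i _ => Finset.sum_nonneg fun j _ => abs_nonneg _) (Finset.mem_univ i))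

lemma abs_Γ_le (φ : ℝ) (i j : Fin 4) : |p.Γ φ i j| ≤ |√(3 / 2) * p.Mg / p.Δ| := by
  rw [Params.Γ, Matrix.smul_apply, smul_eq_mul, abs_mul]
  refine mul_le_of_le_one_right (abs_nonneg _) ?_
  fin_cases i <;> fin_cases j <;> simp [Real.abs_cos_le_one, Real.abs_sin_le_one]

lemma abs_dΓ_le (φ : ℝ) (i j : Fin 4) : |p.dΓ φ i j| ≤ |√(3 / 2) * p.Mg / p.Δ| := by
  simp only [Params.dΓ, Matrix.of_apply, Params.Γ, Matrix.smul_apply, smul_eq_mul]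
  rw [deriv_const_mul_field, abs_mul]
  refine mul_le_of_le_one_right (abs_nonneg _) ?_
  fin_cases i <;> fin_cases j <;> simp [Real.abs_cos_le_one, Real.abs_sin_le_one]

lemma exists_norm_Is_le : ∃ C, 0 ≤ C ∧ ∀ t, ‖p.Is t‖ ≤ C := by
  refine ⟨|p.Us / p.R| + |p.Uf / p.Rf|, by positivity, fun t => ?_⟩
  rw [pi_norm_le_iff_of_nonneg (by positivity)]
  have h1 := mul_le_of_le_one_right (abs_nonneg (p.Us / p.R)) (Real.abs_cos_le_one (p.ωs * t))
  have h2 := mul_le_of_le_one_right (abs_nonneg (p.Us / p.R)) (Real.abs_sin_le_one (p.ωs * t))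
  rw [← abs_mul] at h1 h2
  have h3 := abs_nonneg (p.Us / p.R)
  have h4 := abs_nonneg (p.Uf / p.Rf)
  intro i
  rw [Real.norm_eq_abs]
  fin_cases i
  · change |p.Us / p.R * Real.cos (p.ωs * t)| ≤ _
    linarith
  · change |p.Us / p.R * Real.sin (p.ωs * t)| ≤ _
    linarith
  · change |p.Uf / p.Rf| ≤ _
    linarith
  · change |(0 : ℝ)| ≤ _
    rw [abs_zero]
    linarith

lemma exists_norm_torqueForm_le :
    ∃ C, 0 ≤ C ∧ ∀ Ψ θ, ‖p.torqueForm Ψ θ‖ ≤ C * ‖Ψ‖ ^ 2 := by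
  set c := |√(3 / 2) * p.Mg / p.Δ| with hc
  have hc0 : 0 ≤ c := abs_nonneg _
  refine ⟨4 * ((4 : ℕ) * c), by positivity, fun Ψ θ => ?_⟩
  have h0 : 0 ≤ 4 * ((4 : ℕ) * c) * ‖Ψ‖ ^ 2 := by positivity
  rw [pi_norm_le_iff_of_nonneg h0]
  have h1 := norm_mulVec_le hc0 (abs_dΓ_le p (θ 4)) Ψ
  have h2 : ‖Ψ ⬝ᵥ (p.dΓ (θ 4) *ᵥ Ψ)‖ ≤ 4 * ((4 : ℕ) * c) * ‖Ψ‖ ^ 2 := by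
    calc ‖∑ j, Ψ j * (p.dΓ (θ 4) *ᵥ Ψ) j‖ ≤ ∑ _j : Fin 4, ‖Ψ‖ * ((4 : ℕ) * c * ‖Ψ‖) := by
          refine norm_sum_le_of_le _ fun j _ => ?_
          rw [norm_mul]
          exact mul_le_mul (norm_le_pi_norm Ψ j) ((norm_le_pi_norm _ j).trans h1)
            (norm_nonneg _) (norm_nonneg _)
      _ = _ := by
          simp
          ring
  intro i
  fin_cases i
  all_goals first
    | exact h2
    | exact (norm_zero (E := ℝ)).trans_le h0

/-- Rotor angle and time enter the Ψ-equation only through sines and cosines, so growth is linear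
and involves Ψ alone. -/
lemma exists_norm_field_fst_le : ∃ C, 0 ≤ C ∧ ∀ v, ‖(field p v).1‖ ≤ C * (1 + ‖v.1‖) := by
  obtain ⟨a, ha0, ha⟩ := exists_norm_mulVec_le p.KR⁻¹
  obtain ⟨b, hb0, hb⟩ := exists_norm_mulVec_le p.KL
  obtain ⟨c, hc0, hc⟩ := exists_norm_Is_le p
  set g := |√(3 / 2) * p.Mg / p.Δ| with hg
  have hg0 : 0 ≤ g := abs_nonneg _
  refine ⟨a * (c + b + (4 : ℕ) * g), by positivity, fun v => ?_⟩
  have h1 : ‖p.Is v.2.2.2 - (p.KL + p.Γ (v.2.2.1 4)) *ᵥ v.1‖ ≤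
      c + (b * ‖v.1‖ + (4 : ℕ) * g * ‖v.1‖) := by
    rw [Matrix.add_mulVec]
    exact norm_sub_le_of_le (hc _) (norm_add_le_of_le (hb _) (norm_mulVec_le hg0 (abs_Γ_le p _) _))
  calc ‖(field p v).1‖ ≤ a * ‖p.Is v.2.2.2 - (p.KL + p.Γ (v.2.2.1 4)) *ᵥ v.1‖ := ha _
    _ ≤ a * (c + (b * ‖v.1‖ + (4 : ℕ) * g * ‖v.1‖)) := by gcongr
    _ = a * (c + (b + (4 : ℕ) * g) * ‖v.1‖) := by ring
    _ ≤ a * ((c + b + (4 : ℕ) * g) * (1 + ‖v.1‖)) := by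
        gcongr
        have h2 : 0 ≤ c * ‖v.1‖ := by positivity
        have h3 : 0 ≤ (4 : ℕ) * g := by positivity
        linarith
    _ = _ := by ring

/-- The torque, quadratic in Ψ, is the only obstruction to linear growth; a bound on Ψ removes it.
-/
lemma exists_norm_field_le (r : ℝ) :
    ∃ C, 0 ≤ C ∧ ∀ v, ‖v.1‖ ≤ r → ‖field p v‖ ≤ C * (1 + ‖v‖) := by
  obtain ⟨C, hC0, hC⟩ := exists_norm_field_fst_le p
  obtain ⟨a, ha0, ha⟩ := exists_norm_mulVec_le p.J⁻¹
  obtain ⟨d, hd0, hd⟩ := exists_norm_mulVec_le p.D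
  obtain ⟨k, hk0, hk⟩ := exists_norm_mulVec_le p.K
  obtain ⟨c, hc0, hc⟩ := exists_norm_torqueForm_le p
  set B := ‖p.T‖ + 1 / 2 * (c * r ^ 2) + d + k with hB
  have hB0 : 0 ≤ B := by positivity
  refine ⟨C + a * B + 1, by positivity, fun v hv => ?_⟩
  have hn := norm_nonneg v
  have hv1 : ‖v.1‖ ≤ ‖v‖ := norm_fst_le v
  have hv2 : ‖v.2.1‖ ≤ ‖v‖ := (norm_fst_le v.2).trans (norm_snd_le v)
  have hv3 : ‖v.2.2.1‖ ≤ ‖v‖ := (norm_fst_le v.2.2).trans ((norm_snd_le v.2).trans (norm_snd_le v))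
  have hCn : 0 ≤ C * ‖v‖ := by positivity
  have haB : 0 ≤ a * B := by positivity
  have haBn : 0 ≤ a * B * ‖v‖ := by positivity
  have h1 : ‖(field p v).1‖ ≤ C * (1 + ‖v‖) := (hC v).trans (by gcongr)
  have h2 : ‖(field p v).2.1‖ ≤ a * (B * (1 + ‖v‖)) := by
    refine (ha _).trans (mul_le_mul_of_nonneg_left ?_ ha0)
    have e1 : ‖(1 / 2 : ℝ) • p.torqueForm v.1 v.2.2.1‖ ≤ 1 / 2 * (c * r ^ 2) := by
      rw [norm_smul, Real.norm_of_nonneg (by norm_num)]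
      gcongr
      exact (hc _ _).trans (by gcongr)
    have e2 : ‖p.D *ᵥ v.2.1‖ ≤ d * ‖v‖ := (hd _).trans (by gcongr)
    have e3 : ‖p.K *ᵥ v.2.2.1‖ ≤ k * ‖v‖ := (hk _).trans (by gcongr)
    refine (norm_sub_le_of_le (norm_sub_le_of_le le_rfl e2) (norm_add_le_of_le e3 e1)).trans ?_
    have e4 : 0 ≤ (‖p.T‖ + 1 / 2 * (c * r ^ 2)) * ‖v‖ := by positivity
    rw [hB]
    linarith
  have h3 : ‖(field p v).2.2.1‖ ≤ ‖v‖ := hv2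
  have h4 : ‖(field p v).2.2.2‖ ≤ 1 := by
    change ‖(1 : ℝ)‖ ≤ 1
    simp
  rw [Prod.norm_def, Prod.norm_def, Prod.norm_def]
  refine max_le ?_ (max_le ?_ (max_le ?_ ?_)) <;> linarith

end Growth

end Generator

namespace Generator

open Set
open scoped ContDiff

/-! ### A priori bounds for all solutions of the stage equations -/

section Apriori

variable {s : ℕ} (γ : Fin s → ℝ)

/-- A priori bound for the solutions of stage equations with a right-hand side of linear growth. -/
lemma exists_norm_stage_le {C : ℝ} (hC : 0 ≤ C) :
    ∃ h₁ > 0, ∀ {F : Type} [NormedAddCommGroup F] [NormedSpace ℝ F] (h : ℝ), 0 < h → h ≤ h₁ →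
      ∀ (v : F) (Y k : Fin s → F), (∀ i, ‖k i‖ ≤ C * (1 + ‖Y i‖)) →
        (∀ i, Y i = v + h • ∑ j, collA γ i j • k j) → ∀ i, ‖Y i‖ ≤ 2 * ‖v‖ + 1 := by
  set α : ℝ := ∑ i, ∑ j, |collA γ i j| with hα
  have hα0 : 0 ≤ α := Finset.sum_nonneg fun i _ => Finset.sum_nonneg fun j _ => abs_nonneg _
  refine ⟨1 / (2 * (α * C + 1)), by positivity, fun {F} _ _ h hh hle v Y k hk hY i => ?_⟩
  have hsmall : h * (α * C) ≤ 1 / 2 := by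
    rw [le_div_iff₀ (by positivity)] at hle
    nlinarith
  have hn := norm_nonneg Y
  have hbound : ‖Y‖ ≤ ‖v‖ + h * (α * (C * (1 + ‖Y‖))) := by
    rw [pi_norm_le_iff_of_nonneg (by positivity)]
    intro i
    rw [hY i]
    refine norm_add_le_of_le le_rfl (norm_smul_sum_collA_le hh.le (by positivity) (fun j => ?_) i)
    exact (hk j).trans (by gcongr; exact norm_le_pi_norm Y j)
  have h2 : h * (α * (C * (1 + ‖Y‖))) ≤ 1 / 2 * (1 + ‖Y‖) := by
    calc h * (α * (C * (1 + ‖Y‖))) = h * (α * C) * (1 + ‖Y‖) := by ring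
      _ ≤ _ := by gcongr
  refine (norm_le_pi_norm Y i).trans ?_
  linarith

lemma exists_norm_stage_field_le (p : Params) (ρ : ℝ) :
    ∃ h₁ > 0, ∃ ρ', ∀ h : ℝ, 0 < h → h ≤ h₁ → ∀ (v : Reduced) (Y : Fin s → Reduced), ‖v‖ ≤ ρ →
      (∀ i, Y i = v + h • ∑ j, collA γ i j • field p (Y j)) → ∀ i, ‖Y i‖ ≤ ρ' := by
  obtain ⟨C, hC0, hC⟩ := exists_norm_field_fst_le p
  obtain ⟨C', hC0', hC'⟩ := exists_norm_field_le p (2 * ρ + 1)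
  -- The linear-growth bound is used twice: for the Ψ-components by themselves, and then, with Ψ
  -- bounded, for the full stages.
  obtain ⟨h₁, h₁0, H₁⟩ := exists_norm_stage_le γ hC0
  obtain ⟨h₂, h₂0, H₂⟩ := exists_norm_stage_le γ hC0'
  refine ⟨min h₁ h₂, lt_min h₁0 h₂0, 2 * ρ + 1, fun h hh hle v Y hv hY i => ?_⟩
  have hΨ : ∀ i, ‖(Y i).1‖ ≤ 2 * ρ + 1 := by
    intro i
    have h1 := H₁ h hh (hle.trans (min_le_left _ _)) v.1 (fun i => (Y i).1)
      (fun i => (field p (Y i)).1) (fun i => hC (Y i)) (fun i => by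
        conv_lhs => rw [hY i]
        simp [Prod.fst_sum]) i
    linarith [norm_fst_le v]
  have h2 := H₂ h hh (hle.trans (min_le_right _ _)) v Y (fun i => field p (Y i))
    (fun i => hC' (Y i) (hΨ i)) hY i
  linarith

end Apriori

/-! ### The Gauss method for the descriptor system -/

section Method

variable {p : Params} {E : Matrix (Fin 6) (Fin 6) ℝ} {Tm : ℝ} {X : ℝ → State}

lemma IsSolution.solvesODE (hp : p.Admissible) (hE : IsUnit E.det) (hX : IsSolution p E Tm X) :
    SolvesODE (field p) Tm fun t => reduce (X t) := by
  intro t ht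
  obtain ⟨v, hv, hMv⟩ := hX t ht
  rw [← ((mM_mulVec_eq_rhs_iff hp hE _ _).mp hMv).2]
  exact (LinearMap.toContinuousLinearMap reduce).hasFDerivAt.comp_hasDerivWithinAt t hv

lemma IsSolution.algebraicPart_eq (hp : p.Admissible) (hE : IsUnit E.det)
    (hX : IsSolution p E Tm X) {t : ℝ} (ht : t ∈ Icc 0 Tm) :
    algebraicPart (X t) = (field p (reduce (X t))).1 := by
  obtain ⟨v, -, hMv⟩ := hX t ht
  exact ((mM_mulVec_eq_rhs_iff hp hE _ _).mp hMv).1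

variable {s : ℕ} {γ : Fin s → ℝ}

/-- A step of the method amounts to a step for the underlying ordinary differential equation
together with an extrapolation of the algebraic variables. -/
lemma IsStep.exists_stages (hp : p.Admissible) (hE : IsUnit E.det) {w : Fin s → ℝ}
    (hw : (-1) ^ s + ∑ i, w i = 1) (hwB : ∀ j, ∑ i, w i * collA γ i j = collB γ j)
    {h : ℝ} {x x' : State} (hx : IsStep γ p E h x x') :
    ∃ Y : Fin s → Reduced, (∀ i, Y i = reduce x + h • ∑ j, collA γ i j • field p (Y j)) ∧
      reduce x' = reduce x + h • ∑ j, collB γ j • field p (Y j) ∧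
      algebraicPart x' = (-1 : ℝ) ^ s • algebraicPart x + ∑ i, w i • (field p (Y i)).1 := by
  obtain ⟨k, hk, rfl⟩ := hx
  have hk' := fun i => (mM_mulVec_eq_rhs_iff hp hE _ _).mp (hk i)
  refine ⟨fun i => reduce (x + h • ∑ j, collA γ i j • k j), fun i => ?_, ?_, ?_⟩
  · simp only [← (hk' _).2]
    simp only [map_add, map_smul, map_sum]
  · simp only [← (hk' _).2]
    simp only [map_add, map_smul, map_sum]
  · simp only [← (hk' _).1]
    simp only [map_add, map_smul, map_sum, smul_add, Finset.sum_add_distrib, ← Finset.sum_smul]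
    -- The old value has total weight (-1)^s + ∑ w_i = 1, and the increments combine through ∑ w_i
    -- a_ij = b_j.
    rw [← add_assoc, ← add_smul, hw, one_smul]
    congr 1
    simp only [smul_comm _ h, ← Finset.smul_sum]
    congr 1
    simp only [Finset.smul_sum, smul_smul]
    rw [Finset.sum_comm]
    refine Finset.sum_congr rfl fun j _ => ?_
    rw [← Finset.sum_smul, hwB]

/-- Stages of the reduced equation lift to the full system: the algebraic increments must reach
prescribed stage values, which is possible since the Runge–Kutta matrix is invertible and h ≠ 0. -/
lemma exists_isStep (hp : p.Admissible) (hE : IsUnit E.det) (hγ : IsGaussNodes γ) {h : ℝ}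
    (hh : h ≠ 0) {x : State} {Y : Fin s → Reduced}
    (hY : ∀ i, Y i = reduce x + h • ∑ j, collA γ i j • field p (Y j)) :
    ∃ x', IsStep γ p E h x x' := by
  obtain ⟨κ, hκ⟩ := exists_sum_collA_smul_eq hγ.1 hγ.ne_zero
    fun i => h⁻¹ • ((field p (Y i)).1 - algebraicPart x)
  set k : Fin s → State := fun j => col (κ j) (field p (Y j)).1 (field p (Y j)).2.1
    (field p (Y j)).2.2.1 (field p (Y j)).2.2.2 with hk
  have hk1 : ∀ j, reduce (k j) = field p (Y j) := fun j => rfl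
  have hk2 : ∀ j, algebraicPart (k j) = κ j := fun j => rfl
  refine ⟨_, k, fun i => (mM_mulVec_eq_rhs_iff hp hE _ _).mpr ?_, rfl⟩
  have h1 : reduce (x + h • ∑ j, collA γ i j • k j) = Y i := by
    conv_rhs => rw [hY i]
    simp only [map_add, map_smul, map_sum, hk1]
  rw [h1]
  refine ⟨?_, rfl⟩
  simp only [map_add, map_smul, map_sum, hk2, hκ i]
  rw [smul_inv_smul₀ hh, add_sub_cancel]

lemma IsNumericalSolution.exists_isCollSequence (hp : p.Admissible) (hE : IsUnit E.det)
    {w : Fin s → ℝ} (hw : (-1) ^ s + ∑ i, w i = 1)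
    (hwB : ∀ j, ∑ i, w i * collA γ i j = collB γ j) {h : ℝ} {x0 : State} {n : ℕ} {xs : ℕ → State}
    (hxs : IsNumericalSolution γ p E h x0 n xs) :
    ∃ Y, IsCollSequence γ w (field p) (ContinuousLinearMap.fst ℝ (Fin 4 → ℝ) _) h n
      (fun m => reduce (xs m)) Y fun m => algebraicPart (xs m) := by
  have h1 := fun m hm => (hxs.2 m hm).exists_stages hp hE hw hwB
  choose! Y hY1 hY2 hY3 using h1
  exact ⟨Y, hY1, hY2, hY3⟩

end Method

end Generator

end

theorem theorem1 (p : Generator.Params) (hp : p.Admissible)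
    (E : Matrix (Fin 6) (Fin 6) ℝ) (hE : IsUnit E.det) (hEsymm : E.IsSymm)
    (s : ℕ) (hs : 1 ≤ s) (γ : Fin s → ℝ) (hγ : Generator.IsGaussNodes γ)
    (Tm : ℝ) (hTm : 0 < Tm)
    (x0 : Generator.State) (hx0 : Generator.IsConsistent p x0)
    (X : ℝ → Generator.State) (hX : Generator.IsSolution p E Tm X) (hX0 : X 0 = x0) :
    ∃ h₀ > 0, ∃ C : ℝ, ∀ h : ℝ, 0 < h → h ≤ h₀ → ∀ n : ℕ, n * h ≤ Tm →
      (∃ xs : ℕ → Generator.State, Generator.IsNumericalSolution γ p E h x0 n xs) ∧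
      ∀ xs : ℕ → Generator.State, Generator.IsNumericalSolution γ p E h x0 n xs →
        ‖(xs n).Psi - (X (n * h)).Psi‖ ≤ C * h ^ (2 * s) ∧
        ‖(xs n).dTheta - (X (n * h)).dTheta‖ ≤ C * h ^ (2 * s) ∧
        ‖(xs n).Theta - (X (n * h)).Theta‖ ≤ C * h ^ (2 * s) ∧
        (Even s → ‖(xs n).dPsi - (X (n * h)).dPsi‖ ≤ C * h ^ s) ∧
        (Odd s → ‖(xs n).dPsi - (X (n * h)).dPsi‖ ≤ C * h ^ (s + 1)) := by
  open Generator in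
  have hy := hX.solvesODE hp hE
  have hf := contDiff_field p
  obtain ⟨w, hw, hwB⟩ := hγ.exists_extrapolation_weights
  have hw0 : (-1) ^ s + ∑ i, w i = 1 := by simpa using hw 0 (by omega)
  obtain ⟨h₀, h₀0, h₀1, C, hC0, hglobal⟩ := exists_global_error_le hy hf hTm.le hs hγ hw
    (ContinuousLinearMap.fst ℝ (Fin 4 → ℝ) _) (exists_norm_stage_field_le γ p)
  obtain ⟨ρ₀, hρ₀⟩ := hy.exists_norm_comp_le (φ := id) continuous_id
  -- This ball contains every numerical value, as the exact solution is bounded by ρ₀ and the error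
  -- by C once h ≤ 1.
  obtain ⟨h₁, h₁0, hstages⟩ := exists_stages hf γ (ρ₀ + C)
  have herr : ∀ h : ℝ, 0 < h → h ≤ h₀ → ∀ n : ℕ, n * h ≤ Tm → ∀ xs : ℕ → State,
      IsNumericalSolution γ p E h x0 n xs →
        ‖reduce (xs n) - reduce (X (n * h))‖ ≤ C * h ^ (2 * s) ∧
        (Even s → ‖algebraicPart (xs n) - algebraicPart (X (n * h))‖ ≤ C * h ^ s) ∧
        (Odd s → ‖algebraicPart (xs n) - algebraicPart (X (n * h))‖ ≤ C * h ^ (s + 1)) := by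
    intro h hh hle n hn xs hxs
    obtain ⟨Y, hY⟩ := hxs.exists_isCollSequence hp hE hw0 hwB
    have h1 := hglobal h hh hle n hn _ Y _ hY (by rw [hxs.1, hX0])
      (by
        rw [hxs.1, (algebraic_iff hp x0).mp hx0.2, hX0]
        rfl)
    rw [hX.algebraicPart_eq hp hE ⟨by positivity, hn⟩]
    exact h1
  refine ⟨min h₀ h₁, lt_min h₀0 h₁0, C, fun h hh hle n hn => ⟨?_, fun xs hxs => ?_⟩⟩
  · have hle0 := hle.trans (min_le_left _ _)
    induction n with
    | zero => exact ⟨fun _ => x0, rfl, fun m hm => absurd hm (Nat.not_lt_zero m)⟩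
    | succ n ih =>
      have hn' : (n : ℝ) * h ≤ Tm := by
        push_cast at hn
        linarith
      obtain ⟨xs, hxs⟩ := ih hn'
      -- The error bound holds for any numerical solution already computed; it keeps the current
      -- value in the ball where a further step exists.
      have h1 := (herr h hh hle0 n hn' xs hxs).1
      have h2 : C * h ^ (2 * s) ≤ C :=
        mul_le_of_le_one_right hC0 (pow_le_one₀ hh.le (hle0.trans h₀1))
      have h3 : ‖reduce (xs n)‖ ≤ ρ₀ + C := by
        calc ‖reduce (xs n)‖ = ‖reduce (X (n * h)) + (reduce (xs n) - reduce (X (n * h)))‖ := by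
              rw [add_sub_cancel]
          _ ≤ ρ₀ + C := norm_add_le_of_le (hρ₀ _ ⟨by positivity, hn'⟩) (h1.trans h2)
      obtain ⟨Y, hY⟩ := hstages h hh (hle.trans (min_le_right _ _)) _ h3
      obtain ⟨x', hx'⟩ := exists_isStep hp hE hγ hh.ne' hY
      refine ⟨fun m => if m ≤ n then xs m else x', by simpa using hxs.1, fun m hm => ?_⟩
      rcases Nat.lt_succ_iff_lt_or_eq.mp hm with hlt | rfl
      · simpa [hlt.le, Nat.succ_le_of_lt hlt] using hxs.2 m hlt
      · simpa using hx'
  · obtain ⟨h1, h2, h3⟩ := herr h hh (hle.trans (min_le_left _ _)) n hn xs hxs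
    rw [← map_sub] at h1
    refine ⟨(norm_fst_le _).trans h1, ?_, ?_, h2, h3⟩
    · exact (norm_fst_le (reduce (xs n - X (n * h))).2).trans ((norm_snd_le _).trans h1)
    · exact (norm_fst_le (reduce (xs n - X (n * h))).2.2).trans
        ((norm_snd_le (reduce (xs n - X (n * h))).2).trans ((norm_snd_le _).trans h1))
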